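/- **Conventions.** All structures are finite, and a signature is a finite set $\Sigma$ of relation symbols. The incidence structure of a $\Sigma$-structure $\mathfrak A=\langle A,\bar R\rangle$ is $\mathfrak A_{\mathrm{in}}=\langle A\mathbin{\dot\cup}E,(P_R)_{R\in\Sigma},\mathrm{in}_0,\dots,\mathrm{in}_{r-1}\rangle$, where $r$ is the maximal arity of a symbol of $\Sigma$, $E$ is the set of all tuples that belong to some relation of $\mathfrak A$, $P_R=\{\bar c\in E:\bar c\in R\}$, and $\mathrm{in}_i=\{(a,\bar c)\in A\times E: |\bar c|>i,\ a=c_i\}$. An MSO-transduction expands its input by $m$ arbitrary unary predicates (the parameters), takes $k\ge 1$ disjoint copies, with (if $k\ge2$) unary predicates for the copies and a binary relation linking the copies of the same element, and then applies a definition scheme $\langle\chi,\delta(x),(\varphi_R(\bar x))_R\rangle$ of monadic second-order formulae: if $\chi$ holds, the output has as domain the set defined by $\delta$, and as relations the restrictions to that domain of the relations defined by the $\varphi_R$. The numbers $m,k$ and the formulae are fixed for the transduction, and $\tau(\mathfrak A)$ is the set of all outputs (up to isomorphism), over all choices of the parameters. For classes $\mathcal C,\mathcal K$ of structures, each over some signature,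 write $\mathcal C\sqsubseteq_{\mathrm{in}}\mathcal K$ if there is an MSO-transduction $\tau$ with $\{\mathfrak A_{\mathrm{in}}:\mathfrak A\in\mathcal C\}\subseteq\bigcup_{\mathfrak B\in\mathcal K}\tau(\mathfrak B_{\mathrm{in}})$, and $\mathcal C\sqsubset_{\mathrm{in}}\mathcal K$ if $\mathcal C\sqsubseteq_{\mathrm{in}}\mathcal K$ and $\mathcal K\not\sqsubseteq_{\mathrm{in}}\mathcal C$. For $n\in\mathbb N$, let $\mathcal T_n=\{m^{<n}:m\in\mathbb N\}$, where $m^{<n}$ is the complete $m$-ary tree of height $n$: its vertices are the sequences of length less than $n$ over $\{0,\dots,m-1\}$, with an edge from $x$ to $xd$ for every $d$ (so $m^{<0}$ is empty and $m^{<1}$ has one vertex). A tree decomposition of $\mathfrak A$ is a family $(U_v)_{v\in T}$ of subsets of $A$ indexed by a finite, possibly empty, rooted tree $T$ such that, for every $a\in A$, the set $\{v\in T:a\in U_v\}$ is nonempty and connected in $T$, and every tuple in a relation of $\mathfrak A$ is contained in some $U_v$. Its width is $\sup_{v\in T}(|U_v|-1)$. The $n$-depth tree-width $\mathrm{twd}_n(\mathfrak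 A)$ is the minimal width of a tree decomposition of $\mathfrak A$ whose underlying tree has height at most $n$, that is, in which every vertex has fewer than $n$ proper ancestors ($\infty$ if there is none), and $\mathrm{twd}_n(\mathcal C)=\sup_{\mathfrak A\in\mathcal C}\mathrm{twd}_n(\mathfrak A)$. **Theorem.** Let $n\in\mathbb N$. 1. For every signature $\Sigma$ and every class $\mathcal C$ of $\Sigma$-structures, if $\mathcal T_{n+1}\not\sqsubseteq_{\mathrm{in}}\mathcal C$, then $\mathrm{twd}_n(\mathcal C)<\infty$ and $\mathcal C\sqsubseteq_{\mathrm{in}}\mathcal T_n$. 2. $\mathcal T_{n+1}$ covers $\mathcal T_n$: we have $\mathcal T_n\sqsubset_{\mathrm{in}}\mathcal T_{n+1}$, and there is no class $\mathcal D$ of structures, over any signature, with $\mathcal T_n\sqsubset_{\mathrm{in}}\mathcal D\sqsubset_{\mathrm{in}}\mathcal T_{n+1}$. -/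

import Mathlib

namespace MSOTrans

open FirstOrder

/-! ### Finite relational structures -/

/-- A finite structure over the signature `L`. Signatures are Mathlib languages; in the theorem
they are relational (no function symbols) and have finitely many relation symbols. -/
structure FinStr (L : FirstOrder.Language.{0, 0}) where
  carrier : Type
  str : L.Structure carrier
  fin : Finite carrier

instance (L : FirstOrder.Language.{0, 0}) : CoeSort (FinStr L) Type := ⟨FinStr.carrier⟩

instance {L : FirstOrder.Language.{0, 0}} (A : FinStr L) : L.Structure A := A.str

instance {L : FirstOrder.Language.{0, 0}} (A : FinStr L) : Finite A := A.fin

/-! ### Incidence structures -/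

/-- The relation symbols of the signature of incidence structures: a unary symbol `P_R` for every
`R` in the signature, and binary symbols `in_0, …, in_{r-1}`, where `r` is the maximal arity
(`i < r` holds iff some relation symbol has arity greater than `i`). -/
inductive IncRel (L : FirstOrder.Language.{0, 0}) : ℕ → Type
  | P {k : ℕ} (R : L.Relations k) : IncRel L 1
  | inc (i : ℕ) (hi : ∃ r, i < r ∧ Nonempty (L.Relations r)) : IncRel L 2

/-- The signature of the incidence structures of `L`-structures. -/
def incLang (L : FirstOrder.Language.{0, 0}) : FirstOrder.Language.{0, 0} := ⟨fun _ => Empty, IncRel L⟩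

instance (L : FirstOrder.Language.{0, 0}) : (incLang L).IsRelational :=
  fun _ => inferInstanceAs (IsEmpty Empty)

/-- The set `E` of all tuples that belong to some relation of `A`. A tuple that belongs to
several relations occurs only once. -/
def Tuples {L : FirstOrder.Language.{0, 0}} (A : FinStr L) : Type :=
  {c : Σ k, Fin k → A // ∃ R : L.Relations c.1, FirstOrder.Language.Structure.RelMap R c.2}

instance {L : FirstOrder.Language.{0, 0}} [Finite (Σ k, L.Relations k)] (A : FinStr L) :
    Finite (Tuples A) := by
  let f : Tuples A → Σ R : (Σ k, L.Relations k), (Fin R.1 → A) :=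
    fun c => ⟨⟨c.1.1, c.2.choose⟩, c.1.2⟩
  refine Finite.of_injective f fun c d h => Subtype.ext ?_
  exact congrArg
    (fun s : (Σ R : (Σ k, L.Relations k), (Fin R.1 → A)) => (⟨s.1.1, s.2⟩ : Σ k, Fin k → A)) h

/-- The incidence structure `A_in` of `A`, with domain the disjoint union of `A` and `E`. -/
def incidence {L : FirstOrder.Language.{0, 0}} [Finite (Σ k, L.Relations k)] (A : FinStr L) :
    FinStr (incLang L) where
  carrier := A ⊕ Tuples A
  str :=
    { funMap := fun f => isEmptyElim f
      RelMap := fun {_} S => match S with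
        | .P (k := k) R => fun x => ∃ (c : Fin k → A) (h : FirstOrder.Language.Structure.RelMap R c),
            x 0 = Sum.inr ⟨⟨k, c⟩, R, h⟩
        | .inc i _ => fun x => ∃ (e : Tuples A) (h : i < e.1.1),
            x 0 = Sum.inl (e.1.2 ⟨i, h⟩) ∧ x 1 = Sum.inr e }
  fin := inferInstance

/-! ### Monadic second-order logic -/

/-- Monadic second-order formulae whose free set variables are numbered `0, …, n-1`. There are only
set variables; the atomic formulae are `X ⊆ Y` and `R Z₀ … Z_{k-1}`. -/
inductive MSO (L : FirstOrder.Language.{0, 0}) : ℕ → Type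
  | falsum {n : ℕ} : MSO L n
  | sub {n : ℕ} (X Y : Fin n) : MSO L n
  | rel {n k : ℕ} (R : L.Relations k) (Z : Fin k → Fin n) : MSO L n
  | imp {n : ℕ} (φ ψ : MSO L n) : MSO L n
  | all {n : ℕ} (φ : MSO L (n + 1)) : MSO L n

/-- Satisfaction. `R Z₀ … Z_{k-1}` says that there are `aᵢ ∈ Zᵢ` with `(a₀, …, a_{k-1}) ∈ R`. The
quantifier in `all φ` binds the last set variable of `φ`. -/
def MSO.Realize {L : FirstOrder.Language.{0, 0}} (A : FinStr L) : {n : ℕ} → MSO L n → (Fin n → Set A) → Prop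
  | _, .falsum, _ => False
  | _, .sub X Y, v => v X ⊆ v Y
  | _, .rel (k := k) R Z, v => ∃ a : Fin k → A, (∀ i, a i ∈ v (Z i)) ∧ FirstOrder.Language.Structure.RelMap R a
  | _, .imp φ ψ, v => φ.Realize A v → ψ.Realize A v
  | _, .all φ, v => ∀ X : Set A, φ.Realize A (Fin.snoc v X)

/-- Satisfaction of a formula by elements: an element stands for its singleton. -/
def MSO.RealizeElts {L : FirstOrder.Language.{0, 0}} (A : FinStr L) {n : ℕ} (φ : MSO L n) (a : Fin n → A) :
    Prop :=
  φ.Realize A fun i => {a i}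

/-! ### Transductions -/

/-- `m` unary relation symbols. -/
inductive ColourRel (m : ℕ) : ℕ → Type
  | Q (i : Fin m) : ColourRel m 1

/-- The signature consisting of `m` unary relation symbols. -/
def colourLang (m : ℕ) : FirstOrder.Language.{0, 0} := ⟨fun _ => Empty, ColourRel m⟩

instance (m : ℕ) : (colourLang m).IsRelational := fun _ => inferInstanceAs (IsEmpty Empty)

/-- The expansion of `A` by the unary predicates `Q₀, …, Q_{m-1}`. -/
def expand {L : FirstOrder.Language.{0, 0}} {m : ℕ} (A : FinStr L) (Q : Fin m → Set A) :
    FinStr (L.sum (colourLang m)) where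
  carrier := A
  str :=
    letI : (colourLang m).Structure A :=
      { funMap := fun f => isEmptyElim f
        RelMap := fun {_} S => match S with
          | .Q i => fun x => x 0 ∈ Q i }
    L.sumStructure (colourLang m) A
  fin := inferInstance

/-- The symbols `∼, P₀, …, P_{k-1}` added by the operation `copy_k`; nothing is added for `k = 1`. -/
inductive CopyRel (k : ℕ) : ℕ → Type
  | P (hk : 2 ≤ k) (i : Fin k) : CopyRel k 1
  | sim (hk : 2 ≤ k) : CopyRel k 2

/-- The signature consisting of the symbols added by `copy_k`. -/
def copyLang (k : ℕ) : FirstOrder.Language.{0, 0} := ⟨fun _ => Empty, CopyRel k⟩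

instance (k : ℕ) : (copyLang k).IsRelational := fun _ => inferInstanceAs (IsEmpty Empty)

/-- `copy_k(A)`: the disjoint union of `k` copies of `A`, where `(a, i)` is the copy of `a` in the
`i`-th component, expanded by `P_i = {(a, i) | a ∈ A}` and `(a, i) ∼ (b, j) ↔ a = b` if `k ≥ 2`. -/
def copy {L : FirstOrder.Language.{0, 0}} [L.IsRelational] (k : ℕ) (A : FinStr L) :
    FinStr (L.sum (copyLang k)) where
  carrier := A × Fin k
  str :=
    letI : L.Structure (A × Fin k) :=
      { funMap := fun f => isEmptyElim f
        RelMap := fun R x =>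
          ∃ i : Fin k, (∀ j, (x j).2 = i) ∧ FirstOrder.Language.Structure.RelMap R fun j => (x j).1 }
    letI : (copyLang k).Structure (A × Fin k) :=
      { funMap := fun f => isEmptyElim f
        RelMap := fun {_} S => match S with
          | .P _ i => fun x => (x 0).2 = i
          | .sim _ => fun x => (x 0).1 = (x 1).1 }
    L.sumStructure (copyLang k) (A × Fin k)
  fin := inferInstance

/-- The definition scheme `⟨χ, δ(x), (φ_R(x̄))_R⟩` of a basic MSO-transduction from `L`-structures
to `Γ`-structures. -/
structure BasicTransduction (L Γ : FirstOrder.Language.{0, 0}) where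
  chi : MSO L 0
  delta : MSO L 1
  phi : {r : ℕ} → Γ.Relations r → MSO L r

/-- The basic transduction `τ` is defined at `A`, that is, `A ⊨ χ`. -/
def BasicTransduction.DefinedAt {L Γ : FirstOrder.Language.{0, 0}} (τ : BasicTransduction L Γ)
    (A : FinStr L) : Prop :=
  τ.chi.RealizeElts A Fin.elim0

/-- The value `τ(A)`: its domain is `D = {a ∈ A | A ⊨ δ(a)}` and its relations are
`R = {ā ∈ D^r | A ⊨ φ_R(ā)}`. -/
def BasicTransduction.apply {L Γ : FirstOrder.Language.{0, 0}} [Γ.IsRelational] (τ : BasicTransduction L Γ)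
    (A : FinStr L) : FinStr Γ where
  carrier := {a : A // τ.delta.RealizeElts A fun _ => a}
  str :=
    { funMap := fun f => isEmptyElim f
      RelMap := fun R x => (τ.phi R).RealizeElts A fun i => (x i).1 }
  fin := inferInstance

/-- An MSO-transduction `τ₀ ∘ copy_k ∘ exp_m` from `L`-structures to `Γ`-structures. -/
structure Transduction (L Γ : FirstOrder.Language.{0, 0}) where
  copies : ℕ
  one_le_copies : 1 ≤ copies
  params : ℕ
  base : BasicTransduction ((L.sum (colourLang params)).sum (copyLang copies)) Γ

/-- The set `τ(A)` of all values of `τ` at `A`, for all choices of the parameters. Structures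
are considered up to isomorphism. -/
def Transduction.image {L Γ : FirstOrder.Language.{0, 0}} [L.IsRelational] [Γ.IsRelational]
    (τ : Transduction L Γ) (A : FinStr L) : Set (FinStr Γ) :=
  {B | ∃ Q : Fin τ.params → Set A, τ.base.DefinedAt (copy τ.copies (expand A Q)) ∧
    Nonempty (B ≃[Γ] τ.base.apply (copy τ.copies (expand A Q)))}

/-! ### The transduction preorders -/

section Preorder

variable {L L' : FirstOrder.Language.{0, 0}} [L.IsRelational] [L'.IsRelational]

/-- `C ⊑ K`: there is a transduction `τ` such that `C ⊆ τ(K)`. -/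
def Below (C : Set (FinStr L)) (K : Set (FinStr L')) : Prop :=
  ∃ τ : Transduction L' L, C ⊆ ⋃ A ∈ K, τ.image A

variable [Finite (Σ k, L.Relations k)] [Finite (Σ k, L'.Relations k)]

/-- `C ⊑_in K`: the class of incidence structures of `C` is `⊑` that of `K`. -/
def BelowIn (C : Set (FinStr L)) (K : Set (FinStr L')) : Prop :=
  Below (incidence '' C) (incidence '' K)

/-- `C ⊏_in K`. -/
def StrictBelowIn (C : Set (FinStr L)) (K : Set (FinStr L')) : Prop :=
  BelowIn C K ∧ ¬ BelowIn K C

/-- `K` covers `C`: `C ⊏_in K`, and no class `D` of finite structures, over any finite relational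
signature, satisfies `C ⊏_in D ⊏_in K`. -/
def CoversIn (C : Set (FinStr L)) (K : Set (FinStr L')) : Prop :=
  StrictBelowIn C K ∧
    ∀ (M : FirstOrder.Language.{0, 0}) [M.IsRelational] [Finite (Σ k, M.Relations k)] (D : Set (FinStr M)),
      ¬ (StrictBelowIn C D ∧ StrictBelowIn D K)

end Preorder

/-! ### The classes of complete trees -/

/-- The signature `{edg}` has one binary relation symbol, hence is finite. -/
instance : Finite (Σ k, FirstOrder.Language.graph.Relations k) :=
  Finite.of_surjective (fun _ : Unit => (⟨2, FirstOrder.Language.adj⟩ : Σ k, FirstOrder.Language.graph.Relations k))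
    fun ⟨_, R⟩ => by cases R; exact ⟨(), rfl⟩

/-- The complete `m`-ary tree `m^{<n}` of height `n`, as a successor-tree: its vertices are the
sequences of length less than `n` over `{0, …, m-1}`, and `(x, y)` is an edge iff `y = x d` for
some `d`. It is empty for `n = 0`. -/
def completeTree (m n : ℕ) : FinStr FirstOrder.Language.graph where
  carrier := {x : List (Fin m) // x.length < n}
  str :=
    { funMap := fun f => isEmptyElim f
      RelMap := fun {_} S => match S with
        | .adj => fun x => ∃ d : Fin m, (x 1).1 = (x 0).1 ++ [d] }
  fin := (List.finite_length_lt (Fin m) n).to_subtype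

/-- The class `T_n` of all complete trees of height `n`. -/
def completeTrees (n : ℕ) : Set (FinStr FirstOrder.Language.graph) :=
  Set.range fun m => completeTree m n

/-! ### Tree decompositions -/

/-- Two sequences are adjacent if one of them extends the other by one letter. -/
def seqGraph (D : Type) : SimpleGraph (List D) where
  Adj x y := (∃ d, y = x ++ [d]) ∨ ∃ d, x = y ++ [d]
  symm := ⟨fun _ _ h => h.symm⟩
  loopless := ⟨fun x h => by rcases h with ⟨d, h⟩ | ⟨d, h⟩ <;> simp at h⟩

/-- A tree decomposition `(U_v)_{v ∈ T}` of `A`. Its underlying rooted tree is a tree domain, that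
is, a finite prefix closed set `T` of finite sequences over some set `D` (possibly the empty tree).
The edges of `T` link a sequence with its extensions by one letter. The values `U v` for `v ∉ T`
play no role. -/
structure TreeDecomposition {L : FirstOrder.Language.{0, 0}} (A : FinStr L) where
  D : Type
  T : Set (List D)
  finite : T.Finite
  prefix_closed : ∀ x y : List D, x ++ y ∈ T → x ∈ T
  U : List D → Set A
  /-- For every element `a`, the set `{v ∈ T | a ∈ U_v}` is nonempty and connected in `T`. -/
  connected : ∀ a : A, ((seqGraph D).induce {v | v ∈ T ∧ a ∈ U v}).Connected
  /-- Every tuple of every relation is contained in some component. -/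
  covers : ∀ (k : ℕ) (R : L.Relations k) (c : Fin k → A), FirstOrder.Language.Structure.RelMap R c →
    ∃ v ∈ T, ∀ i, c i ∈ U v

/-- The underlying tree has height at most `n`: the level of every vertex is less than `n`. -/
def TreeDecomposition.HeightLE {L : FirstOrder.Language.{0, 0}} {A : FinStr L} (d : TreeDecomposition A)
    (n : ℕ) : Prop :=
  ∀ v ∈ d.T, v.length < n

/-- The width `sup_{v ∈ T} (|U_v| - 1)` of a tree decomposition. -/
noncomputable def TreeDecomposition.width {L : FirstOrder.Language.{0, 0}} {A : FinStr L}
    (d : TreeDecomposition A) : EReal :=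
  ⨆ v ∈ d.T, (((d.U v).ncard : EReal) - 1)

/-- The `n`-depth tree-width of `A`: the minimal width of a tree decomposition of height at
most `n` (it is `∞` if there is none, which happens only for `n = 0`). -/
noncomputable def twd {L : FirstOrder.Language.{0, 0}} (n : ℕ) (A : FinStr L) : EReal :=
  ⨅ (d : TreeDecomposition A) (_ : d.HeightLE n), d.width

/-- The `n`-depth tree-width of a class of structures. -/
noncomputable def classTwd {L : FirstOrder.Language.{0, 0}} (n : ℕ) (C : Set (FinStr L)) : EReal :=
  ⨆ A ∈ C, twd n A

end MSOTrans

/-! ### Definability in monadic second-order logic, and a tool for building transductions. -/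

namespace MSOTrans

open FirstOrder

/-! ### Derived formulae -/

section Formulae

variable {L : FirstOrder.Language.{0, 0}}

/-! The first claim rests on a dichotomy for a single structure `A` with `m` and `n` fixed,
`exists_marking_or_treeMap`. Take a normal spanning forest of the Gaifman graph: adjacent elements
are comparable, so every tuple lies on one branch. If some branch has at least `(m+1)^n` vertices,
the non-root vertices of `m^{<n+1}` can be laid along it in lexicographic order. Otherwise the
height is bounded, and `treeEmb_or_map` applies to the forest with a root added: either `m^{<n+1}`
embeds for the prefix order, or there is a monotone map to a tree of height `n` whose fibres are
bounded in terms of `m` and `n`.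

In the first two cases a `Marking` arises, from which one transduction, depending only on the
signature and `n`, produces the incidence structure of `m^{<n+1}`
(`exists_transduction_of_marking`). Parent edges of the forest are parameters on the tuples of `A`;
a child of a marked vertex is recognised by levels and reachability. In the last case a `TreeMap`
arises. Collecting the elements mapped to ancestors of a vertex gives a tree decomposition of height
at most `n` and bounded width, and `A_in` is recovered from a tree of height `n`
(`exists_transduction_of_treeMap`). If `T_{n+1}` is not below `C`, the marking transduction misses
some `m` on all of `C`, so every member of `C` falls into the last case with one common bound.

For strictness, suppose `T_{n+1}` is obtained from `T_n`. Formulae see a coloured tree of height `n`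
only through types that count the subtrees of children up to a threshold (`exists_threshold`). Call
a step to a child frequent if at least three siblings carry subtrees of its type. If the element
representing a parent sits below a frequent vertex and the one representing its child does not, the
former can be moved to a sibling subtree, giving a second parent (`exists_exchange`). So the longest
prefix ending in a frequent step can only grow from parent to child. Only boundedly many elements
share this prefix, so with large branching some child makes it strictly longer; `n` such steps do
not fit into height `n`.

Covering then follows: `D ⊏ T_{n+1}` says that `T_{n+1}` is not below `D`, so the first claim puts
`D` below `T_n`. Transitivity of `⊑` is not needed. -/

/-- Renaming of the free variables. -/
def MSO.rename : {n n' : ℕ} → (Fin n → Fin n') → MSO L n → MSO L n'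
  | _, _, _, .falsum => .falsum
  | _, _, f, .sub X Y => .sub (f X) (f Y)
  | _, _, f, .rel R Z => .rel R fun i => f (Z i)
  | _, _, f, .imp φ ψ => .imp (φ.rename f) (ψ.rename f)
  | _, n', f, .all φ => .all (φ.rename (Fin.snoc (fun i => (f i).castSucc) (Fin.last n')))

theorem MSO.realize_rename (A : FinStr L) {n : ℕ} (φ : MSO L n) :
    ∀ {n' : ℕ} (f : Fin n → Fin n') (v : Fin n' → Set A),
      (φ.rename f).Realize A v ↔ φ.Realize A (fun i => v (f i)) := by
  induction φ with
  | falsum => intros; rfl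
  | sub X Y => intros; rfl
  | rel R Z => intros; rfl
  | imp φ ψ hφ hψ => intro n' f v; simp only [MSO.rename, MSO.Realize, hφ, hψ]
  | all φ h =>
    intro n' f v
    simp only [MSO.rename, MSO.Realize, h]
    refine forall_congr' fun X => iff_of_eq (congrArg _ (funext fun i => ?_))
    refine Fin.lastCases ?_ (fun i => ?_) i <;> simp

/-- Negation. -/
def MSO.not {n : ℕ} (φ : MSO L n) : MSO L n := .imp φ .falsum

/-- Conjunction. -/
def MSO.and {n : ℕ} (φ ψ : MSO L n) : MSO L n := .not (.imp φ (.not ψ))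

/-- Existential set quantification. -/
def MSO.ex {n : ℕ} (φ : MSO L (n + 1)) : MSO L n := .not (.all (.not φ))

variable (A : FinStr L) {n : ℕ} (v : Fin n → Set A)

theorem MSO.realize_imp (φ ψ : MSO L n) :
    (MSO.imp φ ψ).Realize A v ↔ (φ.Realize A v → ψ.Realize A v) := Iff.rfl

theorem MSO.realize_all (φ : MSO L (n + 1)) :
    (MSO.all φ).Realize A v ↔ ∀ X, φ.Realize A (Fin.snoc v X) := Iff.rfl

theorem MSO.realize_sub (i j : Fin n) : (MSO.sub i j : MSO L n).Realize A v ↔ v i ⊆ v j := Iff.rfl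

theorem MSO.realize_not (φ : MSO L n) : φ.not.Realize A v ↔ ¬ φ.Realize A v := Iff.rfl

theorem MSO.realize_and (φ ψ : MSO L n) :
    (φ.and ψ).Realize A v ↔ φ.Realize A v ∧ ψ.Realize A v := by
  simp only [MSO.and, MSO.realize_not, MSO.realize_imp]; tauto

theorem MSO.realize_ex (φ : MSO L (n + 1)) :
    φ.ex.Realize A v ↔ ∃ X, φ.Realize A (Fin.snoc v X) := by
  simp only [MSO.ex, MSO.realize_not, MSO.realize_all, not_forall, not_not]

/-- The set `X` is empty. -/
def MSO.isEmpty (X : Fin n) : MSO L n := .all (.sub X.castSucc (Fin.last n))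

theorem MSO.realize_isEmpty (X : Fin n) : (MSO.isEmpty X).Realize A v ↔ v X = ∅ := by
  simp only [MSO.isEmpty, MSO.realize_all, MSO.realize_sub, Fin.snoc_castSucc, Fin.snoc_last]
  exact ⟨fun h => Set.subset_empty_iff.1 (h ∅), fun h Y => h ▸ Set.empty_subset Y⟩

/-- The set `X` is a singleton. -/
def MSO.sing (X : Fin n) : MSO L n :=
  .and (.not (.isEmpty X)) (.all (.imp (.sub (Fin.last n) X.castSucc)
    (.imp (.not (.isEmpty (Fin.last n))) (.sub X.castSucc (Fin.last n)))))

theorem MSO.realize_sing (X : Fin n) : (MSO.sing X).Realize A v ↔ ∃ x, v X = {x} := by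
  simp only [MSO.sing, MSO.realize_and, MSO.realize_not, MSO.realize_isEmpty, MSO.realize_all,
    MSO.realize_imp, MSO.realize_sub, Fin.snoc_castSucc, Fin.snoc_last]
  constructor
  · rintro ⟨h, h'⟩
    obtain ⟨x, hx⟩ := Set.nonempty_iff_ne_empty.2 h
    exact ⟨x, (h' {x} (by simpa using hx) (by simp)).antisymm (by simpa using hx)⟩
  · rintro ⟨x, hx⟩
    rw [hx]
    exact ⟨by simp, fun Y hY hY' => by
      rcases Set.subset_singleton_iff_eq.1 hY with h | h
      · exact absurd h hY'
      · exact h.ge⟩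

/-- Existential quantification over elements. -/
def MSO.exElt (φ : MSO L (n + 1)) : MSO L n := .ex (.and (.sing (Fin.last n)) φ)

theorem MSO.realize_exElt (φ : MSO L (n + 1)) :
    φ.exElt.Realize A v ↔ ∃ x, φ.Realize A (Fin.snoc v {x}) := by
  simp only [MSO.exElt, MSO.realize_ex, MSO.realize_and, MSO.realize_sing, Fin.snoc_last]
  constructor
  · rintro ⟨_, ⟨x, rfl⟩, h⟩; exact ⟨x, h⟩
  · rintro ⟨x, h⟩; exact ⟨_, ⟨x, rfl⟩, h⟩

/-- Universal quantification over elements. -/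
def MSO.allElt (φ : MSO L (n + 1)) : MSO L n := .not (.exElt (.not φ))

theorem MSO.realize_allElt (φ : MSO L (n + 1)) :
    φ.allElt.Realize A v ↔ ∀ x, φ.Realize A (Fin.snoc v {x}) := by
  simp only [MSO.allElt, MSO.realize_exElt, MSO.realize_not, not_exists, not_not]

end Formulae

/-! ### Definable relations -/

section Definable

variable {L : FirstOrder.Language.{0, 0}} {ι : Type*} (M : ι → FinStr L)

/-- A unary relation that is uniformly definable in the structures `M i`. -/
def Def1 (P : ∀ i, M i → Prop) : Prop :=
  ∃ φ : MSO L 1, ∀ i x, φ.Realize (M i) ![{x}] ↔ P i x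

/-- A binary relation that is uniformly definable in the structures `M i`. -/
def Def2 (S : ∀ i, M i → M i → Prop) : Prop :=
  ∃ φ : MSO L 2, ∀ i x y, φ.Realize (M i) ![{x}, {y}] ↔ S i x y

variable {M} {P P' : ∀ i, M i → Prop} {S S' : ∀ i, M i → M i → Prop}

theorem Def1.not (h : Def1 M P) : Def1 M fun i x => ¬ P i x := by
  obtain ⟨φ, hφ⟩ := h
  exact ⟨φ.not, fun i x => by rw [MSO.realize_not, hφ]⟩

theorem Def1.and (h : Def1 M P) (h' : Def1 M P') : Def1 M fun i x => P i x ∧ P' i x := by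
  obtain ⟨φ, hφ⟩ := h
  obtain ⟨ψ, hψ⟩ := h'
  exact ⟨φ.and ψ, fun i x => by rw [MSO.realize_and, hφ, hψ]⟩

theorem Def1.or (h : Def1 M P) (h' : Def1 M P') : Def1 M fun i x => P i x ∨ P' i x := by
  simpa only [not_and_or, not_not] using (h.not.and h'.not).not

theorem Def1.false : Def1 M fun _ _ => False := ⟨.falsum, fun _ _ => Iff.rfl⟩

theorem Def2.not (h : Def2 M S) : Def2 M fun i x y => ¬ S i x y := by
  obtain ⟨φ, hφ⟩ := h
  exact ⟨φ.not, fun i x y => by rw [MSO.realize_not, hφ]⟩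

theorem Def2.and (h : Def2 M S) (h' : Def2 M S') : Def2 M fun i x y => S i x y ∧ S' i x y := by
  obtain ⟨φ, hφ⟩ := h
  obtain ⟨ψ, hψ⟩ := h'
  exact ⟨φ.and ψ, fun i x y => by rw [MSO.realize_and, hφ, hψ]⟩

theorem Def2.or (h : Def2 M S) (h' : Def2 M S') : Def2 M fun i x y => S i x y ∨ S' i x y := by
  simpa only [not_and_or, not_not] using (h.not.and h'.not).not

theorem Def2.false : Def2 M fun _ _ _ => False := ⟨.falsum, fun _ _ _ => Iff.rfl⟩

theorem Def1.exists {κ : Type*} [Finite κ] {P : κ → ∀ i, M i → Prop} (h : ∀ c, Def1 M (P c)) :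
    Def1 M fun i x => ∃ c, P c i x := by
  classical
  have := Fintype.ofFinite κ
  suffices H : ∀ s : Finset κ, Def1 M fun i x => ∃ c ∈ s, P c i x by simpa using H Finset.univ
  intro s
  induction s using Finset.induction_on with
  | empty => simpa using Def1.false
  | insert a s _ ih => simpa using (h a).or ih

theorem Def2.exists {κ : Type*} [Finite κ] {S : κ → ∀ i, M i → M i → Prop}
    (h : ∀ c, Def2 M (S c)) : Def2 M fun i x y => ∃ c, S c i x y := by
  classical
  have := Fintype.ofFinite κ
  suffices H : ∀ s : Finset κ, Def2 M fun i x y => ∃ c ∈ s, S c i x y by simpa using H Finset.univ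
  intro s
  induction s using Finset.induction_on with
  | empty => simpa using Def2.false
  | insert a s _ ih => simpa using (h a).or ih

theorem Def1.const_and (p : Prop) (h : Def1 M P) : Def1 M fun i x => p ∧ P i x := by
  by_cases hp : p
  · simpa [hp] using h
  · simpa [hp] using Def1.false

theorem Def2.const_and (p : Prop) (h : Def2 M S) : Def2 M fun i x y => p ∧ S i x y := by
  by_cases hp : p
  · simpa [hp] using h
  · simpa [hp] using Def2.false

theorem Def2.congr (h : Def2 M S) (H : ∀ i x y, S i x y ↔ S' i x y) : Def2 M S' := by
  obtain ⟨φ, hφ⟩ := h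
  exact ⟨φ, fun i x y => (hφ i x y).trans (H i x y)⟩

theorem Def1.fst (h : Def1 M P) : Def2 M fun i x _ => P i x := by
  obtain ⟨φ, hφ⟩ := h
  refine ⟨φ.rename ![0], fun i x y => ?_⟩
  rw [MSO.realize_rename]
  refine Iff.trans (iff_of_eq (congrArg _ (funext fun j => ?_))) (hφ i x)
  fin_cases j; rfl

theorem Def2.swap (h : Def2 M S) : Def2 M fun i x y => S i y x := by
  obtain ⟨φ, hφ⟩ := h
  refine ⟨φ.rename ![1, 0], fun i x y => ?_⟩
  rw [MSO.realize_rename]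
  refine Iff.trans (iff_of_eq (congrArg _ (funext fun j => ?_))) (hφ i y x)
  fin_cases j <;> rfl

theorem Def1.snd (h : Def1 M P) : Def2 M fun i _ y => P i y := h.fst.swap

theorem Def2.comp (h : Def2 M S) (h' : Def2 M S') :
    Def2 M fun i x y => ∃ z, S i x z ∧ S' i z y := by
  obtain ⟨φ, hφ⟩ := h
  obtain ⟨ψ, hψ⟩ := h'
  refine ⟨.exElt (.and (φ.rename ![0, 2]) (ψ.rename ![2, 1])), fun i x y => ?_⟩
  rw [MSO.realize_exElt]
  refine exists_congr fun z => ?_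
  rw [MSO.realize_and, MSO.realize_rename, MSO.realize_rename, ← hφ, ← hψ]
  refine and_congr (iff_of_eq (congrArg _ (funext fun j => ?_)))
    (iff_of_eq (congrArg _ (funext fun j => ?_))) <;> fin_cases j <;> rfl

/-- The set quantifier is what makes reachability definable: `y` is reached from `x` exactly when it
lies in every set that contains the successors of `x` and is closed under `S`. -/
theorem Def2.transGen (h : Def2 M S) : Def2 M fun i x y => Relation.TransGen (S i) x y := by
  obtain ⟨φ, hφ⟩ := h
  refine ⟨.all (.imp (.allElt (.imp (φ.rename ![0, 3]) (.sub 3 2)))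
    (.imp (.allElt (.allElt (.imp (.sub 3 2) (.imp (φ.rename ![3, 4]) (.sub 4 2)))))
      (.sub 1 2))), fun i x y => ?_⟩
  have e1 (X : Set (M i)) (w : M i) :
      (fun j => (Fin.snoc (Fin.snoc ![{x}, {y}] X : Fin 3 → Set (M i)) {w} : Fin 4 → Set (M i))
        ((![0, 3] : Fin 2 → Fin 4) j)) = ![{x}, {w}] := by
    funext j; fin_cases j <;> rfl
  have e2 (X : Set (M i)) (w w' : M i) :
      (fun j => (Fin.snoc (Fin.snoc (Fin.snoc ![{x}, {y}] X : Fin 3 → Set (M i)) {w} :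
        Fin 4 → Set (M i)) {w'} : Fin 5 → Set (M i))
        ((![3, 4] : Fin 2 → Fin 5) j)) = ![{w}, {w'}] := by
    funext j; fin_cases j <;> rfl
  have key : ∀ X : Set (M i), ((MSO.imp (.allElt (.imp (φ.rename ![0, 3]) (.sub 3 2)))
      (.imp (.allElt (.allElt (.imp (.sub 3 2) (.imp (φ.rename ![3, 4]) (.sub 4 2)))))
      (.sub 1 2))).Realize (M i) (Fin.snoc ![{x}, {y}] X : Fin 3 → Set (M i)) ↔
      ((∀ w, S i x w → w ∈ X) → (∀ w w', w ∈ X → S i w w' → w' ∈ X) → y ∈ X)) := by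
    intro X
    simp only [MSO.realize_imp, MSO.realize_allElt, MSO.realize_rename, e1, e2, hφ]
    refine imp_congr (forall_congr' fun w => imp_congr Iff.rfl ?_)
      (imp_congr (forall_congr' fun w => forall_congr' fun w' => imp_congr ?_
        (imp_congr Iff.rfl ?_)) ?_)
    · exact Set.singleton_subset_iff (a := w) (s := X)
    · exact Set.singleton_subset_iff (a := w) (s := X)
    · exact Set.singleton_subset_iff (a := w') (s := X)
    · exact Set.singleton_subset_iff (a := y) (s := X)
  rw [MSO.realize_all]
  simp only [key]
  constructor
  · intro H
    exact H {w | Relation.TransGen (S i) x w} (fun w hw => .single hw)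
      fun w w' hw hw' => hw.tail hw'
  · intro H X h1 h2
    clear key e1 e2
    induction H with
    | single h => exact h1 _ h
    | tail _ h ih => exact h2 _ _ ih h

end Definable

/-! ### Definable relations in copies of expansions -/

section Copies

variable {L : FirstOrder.Language.{0, 0}} [L.IsRelational] {k m : ℕ}

/-- The structures to which the definition scheme of a transduction is applied. -/
def copyExpand (L : FirstOrder.Language.{0, 0}) [L.IsRelational] (k m : ℕ) :
    (Σ B : FinStr L, Fin m → Set B) → FinStr ((L.sum (colourLang m)).sum (copyLang k)) :=
  fun i => copy k (expand i.1 i.2)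

/-- A unary relation on copies. -/
def CDef1 (P : ∀ (B : FinStr L) (_ : Fin m → Set B), B × Fin k → Prop) : Prop :=
  Def1 (copyExpand L k m) fun i x => P i.1 i.2 x

/-- A binary relation on copies. -/
def CDef2 (S : ∀ (B : FinStr L) (_ : Fin m → Set B), B × Fin k → B × Fin k → Prop) : Prop :=
  Def2 (copyExpand L k m) fun i x y => S i.1 i.2 x y

theorem cdef1_colour (q : Fin m) : CDef1 (L := L) (k := k) fun _ Q x => x.1 ∈ Q q := by
  refine ⟨.rel (Sum.inl (Sum.inr (ColourRel.Q q))) fun _ : Fin 1 => 0, fun i x => ?_⟩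
  constructor
  · rintro ⟨a, ha, c, -, h⟩
    have : a 0 = x := ha 0
    subst this
    exact h
  · intro h
    exact ⟨fun _ => x, fun _ => rfl, x.2, fun _ => rfl, h⟩

theorem cdef1_copy (hk : 2 ≤ k) (c : Fin k) :
    CDef1 (L := L) (m := m) fun _ _ x => x.2 = c := by
  refine ⟨.rel (Sum.inr (CopyRel.P hk c)) fun _ : Fin 1 => 0, fun i x => ?_⟩
  constructor
  · rintro ⟨a, ha, h⟩
    have : a 0 = x := ha 0
    subst this
    exact h
  · intro h
    exact ⟨fun _ => x, fun _ => rfl, h⟩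

theorem cdef2_sim (hk : 2 ≤ k) : CDef2 (L := L) (k := k) (m := m) fun _ _ x y => x.1 = y.1 := by
  refine ⟨.rel (Sum.inr (CopyRel.sim hk)) id, fun i x y => ?_⟩
  constructor
  · rintro ⟨a, ha, h⟩
    have h0 : a 0 = x := ha 0
    have h1 : a 1 = y := ha 1
    subst h0 h1
    exact h
  · intro h
    exact ⟨![x, y], fun j => by fin_cases j <;> rfl, h⟩

/-- Copying keeps a relation only inside a single copy; composing it with `∼` makes the copy numbers
irrelevant. -/
theorem cdef2_rel (hk : 2 ≤ k) (R : L.Relations 2) : CDef2 (L := L) (k := k) (m := m)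
    fun _ _ x y => FirstOrder.Language.Structure.RelMap R ![x.1, y.1] := by
  have h : CDef2 (L := L) (k := k) (m := m)
      fun _ _ x y => x.2 = y.2 ∧ FirstOrder.Language.Structure.RelMap R ![x.1, y.1] := by
    refine ⟨.rel (Sum.inl (Sum.inl R)) id, fun i x y => ?_⟩
    constructor
    · rintro ⟨a, ha, c, hc, h⟩
      have h0 : a 0 = x := ha 0
      have h1 : a 1 = y := ha 1
      subst h0 h1
      refine ⟨(hc 0).trans (hc 1).symm, ?_⟩
      have e : (![(a 0).1, (a 1).1] : Fin 2 → i.1) = fun j => (a j).1 := by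
        funext j; fin_cases j <;> rfl
      rw [e]
      exact h
    · rintro ⟨hc, h⟩
      refine ⟨![x, y], fun j => by fin_cases j <;> rfl, x.2, fun j => ?_, ?_⟩
      · fin_cases j
        · rfl
        · exact hc.symm
      · have e : (![x.1, y.1] : Fin 2 → i.1) = fun j => ((![x, y] : Fin 2 → i.1 × Fin k) j).1 := by
          funext j; fin_cases j <;> rfl
        rw [e] at h
        exact h
  refine (Def2.comp h (cdef2_sim hk)).congr fun i x y => ⟨?_, fun h => ⟨(y.1, x.2), ⟨rfl, h⟩, rfl⟩⟩
  rintro ⟨z, ⟨-, hz⟩, hzy⟩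
  rw [← hzy]; exact hz

theorem CDef2.comp_base {S S' : ∀ (B : FinStr L) (_ : Fin m → Set B), B → B → Prop}
    (h : CDef2 (k := k) fun B Q x y => S B Q x.1 y.1)
    (h' : CDef2 (k := k) fun B Q x y => S' B Q x.1 y.1) :
    CDef2 (k := k) fun B Q x y => ∃ z, S B Q x.1 z ∧ S' B Q z y.1 := by
  exact (Def2.comp h h').congr fun i x y => ⟨fun ⟨z, hz⟩ => ⟨z.1, hz⟩, fun ⟨z, hz⟩ => ⟨(z, x.2), hz⟩⟩

theorem CDef2.transGen_base {S : ∀ (B : FinStr L) (_ : Fin m → Set B), B → B → Prop}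
    (h : CDef2 (k := k) fun B Q x y => S B Q x.1 y.1) :
    CDef2 (k := k) fun B Q x y => Relation.TransGen (S B Q) x.1 y.1 := by
  refine (Def2.transGen h).congr fun i x y => ⟨fun h => h.lift (fun x : i.1 × Fin k => x.1) fun _ _ h => h,
    fun h => ?_⟩
  obtain ⟨y, c⟩ := y
  dsimp only at h
  induction h generalizing c with
  | single h => exact .single h
  | tail _ h ih => exact (ih x.2).tail h

/-- A transduction to incidence structures, given by definable relations. -/
theorem exists_transduction {L' : FirstOrder.Language.{0, 0}} (hk : 1 ≤ k)
    {δ : ∀ (B : FinStr L) (_ : Fin m → Set B), B × Fin k → Prop} (hδ : CDef1 δ)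
    {PR : ∀ {r : ℕ} (_ : L'.Relations r) (B : FinStr L) (_ : Fin m → Set B), B × Fin k → Prop}
    (hPR : ∀ {r : ℕ} (R : L'.Relations r), CDef1 (PR R))
    {IN : ∀ (_ : ℕ) (B : FinStr L) (_ : Fin m → Set B), B × Fin k → B × Fin k → Prop}
    (hIN : ∀ i, CDef2 (IN i)) :
    ∃ τ : Transduction L (incLang L'), ∀ (B : FinStr L) (Q : Fin m → Set B)
      (A : FinStr (incLang L')) (e : A ≃ {x : B × Fin k // δ B Q x}),
      (∀ {r : ℕ} (R : L'.Relations r) (x : Fin 1 → A),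
        FirstOrder.Language.Structure.RelMap (L := incLang L') (IncRel.P R) x ↔
          PR R B Q (e (x 0)).1) →
      (∀ (i : ℕ) (hi : ∃ r, i < r ∧ Nonempty (L'.Relations r)) (x : Fin 2 → A),
        FirstOrder.Language.Structure.RelMap (L := incLang L') (IncRel.inc i hi) x ↔
          IN i B Q (e (x 0)).1 (e (x 1)).1) →
      A ∈ τ.image B := by
  obtain ⟨δ', hδ⟩ := hδ
  choose PR' hPR using @hPR
  choose IN' hIN using hIN
  let phi : {r : ℕ} → (incLang L').Relations r →
      MSO ((L.sum (colourLang m)).sum (copyLang k)) r := fun {r} R =>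
    match r, R with
    | _, .P R => PR' R
    | _, .inc i _ => IN' i
  -- The formula `χ` is a tautology, so the transduction is defined for all parameters.
  refine ⟨⟨k, hk, m, ⟨.imp .falsum .falsum, δ', phi⟩⟩, fun B Q A e h1 h2 => ⟨Q, id, ?_⟩⟩
  have hd (x : B × Fin k) : MSO.RealizeElts (copy k (expand B Q)) δ' (fun _ => x) ↔ δ B Q x := by
    refine Iff.trans (iff_of_eq (congrArg (MSO.Realize _ _) (funext fun j => ?_))) (hδ ⟨B, Q⟩ x)
    fin_cases j; rfl
  refine ⟨⟨e.trans (Equiv.subtypeEquivRight fun x => (hd x).symm), fun f => isEmptyElim f,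
    fun {r} R x => ?_⟩⟩
  cases R with
  | P R =>
    refine Iff.trans ?_ (h1 R x).symm
    refine Iff.trans (iff_of_eq (congrArg (MSO.Realize (copy k (expand B Q)) (PR' R))
      (funext fun j => ?_))) (hPR R ⟨B, Q⟩ (e (x 0)).1)
    fin_cases j; rfl
  | inc i hi =>
    refine Iff.trans ?_ (h2 i hi x).symm
    refine Iff.trans (iff_of_eq (congrArg (MSO.Realize (copy k (expand B Q)) (IN' i))
      (funext fun j => ?_))) (hIN i ⟨B, Q⟩ (e (x 0)).1 (e (x 1)).1)
    fin_cases j <;> rfl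

end Copies

end MSOTrans

/-! ### Bounded-fibre maps into trees: tree decompositions and interpretation in complete trees. -/

namespace MSOTrans

open FirstOrder

/-! ### Maps into trees -/

/-- A map of `A` to the vertices of `m^{<n}` with fibres of size at most `K`, such that every tuple
is mapped to ancestors of a single vertex. -/
structure TreeMap {L : FirstOrder.Language.{0, 0}} (A : FinStr L) (m n K : ℕ)
    (h : A → List (Fin m)) : Prop where
  length_lt : ∀ a, (h a).length < n
  fibre : ∀ u, {a | h a = u}.ncard ≤ K
  chain : ∀ (k : ℕ) (R : L.Relations k) (c : Fin k → A),
    FirstOrder.Language.Structure.RelMap R c → ∃ v : List (Fin m), v.length < n ∧ ∀ i, h (c i) <+: v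

section TreeMap

variable {L : FirstOrder.Language.{0, 0}} {A : FinStr L} {m n K : ℕ} {h : A → List (Fin m)}

/-- Among the prefixes of `v` at most `n` have length less than `n`, and each is the image of at
most `K` elements. -/
theorem TreeMap.ncard_prefix_le (H : TreeMap A m n K h) (v : List (Fin m)) :
    {a | h a <+: v}.ncard ≤ n * K := by
  classical
  have := Fintype.ofFinite A
  have h1 : {a | h a <+: v} ⊆
      ((Finset.range n).biUnion fun j => Finset.univ.filter fun a => h a = v.take j : Finset A) := by
    intro a ha
    simp only [Finset.coe_biUnion, Set.mem_iUnion, Finset.coe_filter, Finset.mem_univ, true_and,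
      Set.mem_ofPred_eq, Finset.mem_coe, Finset.mem_range]
    exact ⟨(h a).length, H.length_lt a, List.prefix_iff_eq_take.1 ha⟩
  refine (Set.ncard_le_ncard h1 (Finset.finite_toSet _)).trans ?_
  rw [Set.ncard_coe_finset]
  refine (Finset.card_biUnion_le_card_mul _ _ K fun j _ => ?_).trans (by simp)
  have := H.fibre (v.take j)
  rwa [← Set.ncard_coe_finset, Finset.coe_filter_univ]

/-- The tree decomposition given by a map to a tree. -/
def TreeMap.decomposition (H : TreeMap A m n K h) : TreeDecomposition A where
  D := Fin m
  T := {v | v.length < n}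
  finite := List.finite_length_lt (Fin m) n
  prefix_closed x y hxy := by
    simp only [Set.mem_ofPred_eq, List.length_append] at *
    omega
  U v := {a | h a <+: v}
  -- The bags containing `a` are those at the vertices above which `h a` lies as an ancestor, a
  -- subtree rooted at `h a`; every vertex of it is reached from `h a` by adding letters one at a
  -- time.
  connected a := by
    have key : ∀ (s : List (Fin m)) (hs : (h a ++ s).length < n),
        ((seqGraph (Fin m)).induce {v | v.length < n ∧ h a <+: v}).Reachable
          ⟨h a, H.length_lt a, List.prefix_rfl⟩ ⟨h a ++ s, hs, List.prefix_append _ _⟩ := by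
      intro s
      induction s using List.reverseRecOn with
      | nil => intro hs; simp
      | append_singleton s d ih =>
        intro hs
        have hs' : (h a ++ s).length < n := by
          simp only [List.length_append, List.length_singleton] at *; omega
        refine (ih hs').trans (SimpleGraph.Adj.reachable ?_)
        exact Or.inl ⟨d, by simp⟩
    have key' : ∀ v, ((seqGraph (Fin m)).induce
        {v | v.length < n ∧ h a <+: v}).Reachable
          ⟨h a, H.length_lt a, List.prefix_rfl⟩ v := by
      rintro ⟨v, hv, s, rfl⟩
      exact key s hv
    exact { preconnected := fun v w => (key' v).symm.trans (key' w)
            nonempty := ⟨⟨h a, H.length_lt a, List.prefix_rfl⟩⟩ }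
  covers k R c hc := H.chain k R c hc

theorem TreeMap.twd_le (H : TreeMap A m n K h) : twd n A ≤ ((n * K : ℕ) : EReal) := by
  refine (iInf₂_le H.decomposition fun _ hv => hv).trans (iSup₂_le fun v _ => ?_)
  have h1 : (((H.decomposition.U v).ncard : ℕ) : EReal) ≤ ((n * K : ℕ) : EReal) := by
    exact_mod_cast H.ncard_prefix_le v
  refine le_trans ?_ h1
  have := EReal.sub_le_sub (le_refl (((H.decomposition.U v).ncard : ℕ) : EReal)) zero_le_one
  simpa using this

/-- Numbering each fibre separately makes `a` recoverable from the pair `(h a, s a)`; the slot will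
serve as the number of a copy. -/
theorem TreeMap.exists_slot (H : TreeMap A m n K h) :
    ∃ s : A → Fin K, ∀ a b, h a = h b → s a = s b → a = b := by
  have key (u : List (Fin m)) : Nonempty ({a | h a = u} ↪ Fin K) := by
    have := Fintype.ofFinite {a | h a = u}
    refine Function.Embedding.nonempty_of_card_le ?_
    rw [Fintype.card_fin, ← Nat.card_eq_fintype_card]
    exact H.fibre u
  have f := fun u => (key u).some
  refine ⟨fun a => f (h a) ⟨a, rfl⟩, fun a b hab hs => ?_⟩
  have aux : ∀ u, ∀ hu : h b = u, f u ⟨b, hu⟩ = f (h b) ⟨b, rfl⟩ := by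
    rintro _ rfl; rfl
  dsimp only at hs
  rw [← aux (h a) hab.symm] at hs
  exact congrArg Subtype.val ((f (h a)).injective hs)

end TreeMap

/-! ### Interpreting incidence structures in trees -/

section Ancestors

theorem graph_arity (i : ℕ) (hi : i < 2) :
    ∃ r, i < r ∧ Nonempty (FirstOrder.Language.graph.Relations r) :=
  ⟨2, hi, ⟨FirstOrder.Language.adj⟩⟩

/-- In the incidence structure of a tree, `x` is the parent of `y`. -/
def par (B : FinStr (incLang FirstOrder.Language.graph)) (x y : B) : Prop :=
  ∃ e, FirstOrder.Language.Structure.RelMap (L := incLang FirstOrder.Language.graph)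
      (IncRel.inc 0 (graph_arity 0 (by simp))) ![x, e] ∧
    FirstOrder.Language.Structure.RelMap (L := incLang FirstOrder.Language.graph)
      (IncRel.inc 1 (graph_arity 1 (by simp))) ![y, e]

/-- In the incidence structure of a tree, `x` is the `j`-th ancestor of `y`. -/
def anc (B : FinStr (incLang FirstOrder.Language.graph)) : ℕ → B → B → Prop
  | 0, x, y => x = y
  | j + 1, x, y => ∃ z, par B x z ∧ anc B j z y

theorem cdef2_anc {k m : ℕ} (hk : 2 ≤ k) (j : ℕ) :
    CDef2 (k := k) (m := m) fun B _ x y => anc B j x.1 y.1 := by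
  induction j with
  | zero => exact cdef2_sim hk
  | succ j ih =>
    have h := CDef2.comp_base (S := fun B (_ : Fin m → Set B) => par B)
      (S' := fun B _ => anc B j) (k := k) ?_ ih
    · exact h
    · exact CDef2.comp_base (S := fun B (_ : Fin m → Set B) x e =>
        FirstOrder.Language.Structure.RelMap (L := incLang FirstOrder.Language.graph)
          (IncRel.inc 0 (graph_arity 0 (by simp))) ![x, e])
        (S' := fun B _ e y =>
        FirstOrder.Language.Structure.RelMap (L := incLang FirstOrder.Language.graph)
          (IncRel.inc 1 (graph_arity 1 (by simp))) ![y, e]) (cdef2_rel hk _)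
        (Def2.swap (cdef2_rel (L := incLang FirstOrder.Language.graph) hk
          (IncRel.inc 1 (graph_arity 1 (by simp)))))

variable {m n : ℕ}

theorem par_completeTree (u : completeTree m n) (z : incidence (completeTree m n)) :
    par (incidence (completeTree m n)) (Sum.inl u) z ↔
      ∃ w : completeTree m n, z = Sum.inl w ∧ ∃ d, w.1 = u.1 ++ [d] := by
  constructor
  · rintro ⟨e, ⟨c, hc, h0, h1⟩, ⟨c', hc', h0', h1'⟩⟩
    obtain ⟨⟨k, c⟩, R, hR⟩ := c
    cases R
    have e1 : c' = ⟨⟨2, c⟩, _, hR⟩ := Sum.inr.inj (h1'.symm.trans h1)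
    subst e1
    refine ⟨_, h0', ?_⟩
    have e2 : u = c 0 := Sum.inl.inj h0
    rw [e2]
    exact hR
  · rintro ⟨w, rfl, hd⟩
    have hR : FirstOrder.Language.Structure.RelMap (L := FirstOrder.Language.graph)
      FirstOrder.Language.adj ![u, w] := hd
    exact ⟨Sum.inr ⟨⟨2, ![u, w]⟩, _, hR⟩, ⟨_, Nat.zero_lt_two, rfl, rfl⟩,
      ⟨_, Nat.one_lt_two, rfl, rfl⟩⟩

theorem anc_completeTree (j : ℕ) (u w : completeTree m n) :
    anc (incidence (completeTree m n)) j (Sum.inl u) (Sum.inl w) ↔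
      u.1 <+: w.1 ∧ w.1.length = u.1.length + j := by
  induction j generalizing u with
  | zero =>
    constructor
    · intro h
      have : u = w := Sum.inl.inj h
      subst this; simp
    · rintro ⟨h1, h2⟩
      exact congrArg Sum.inl (Subtype.ext (h1.eq_of_length h2.symm))
  | succ j ih =>
    constructor
    · rintro ⟨z, hz, hz'⟩
      obtain ⟨w', rfl, d, hd⟩ := (par_completeTree u z).1 hz
      obtain ⟨h1, h2⟩ := (ih w').1 hz'
      rw [hd] at h1 h2
      exact ⟨(List.prefix_append _ _).trans h1, by simp at h2; omega⟩
    · rintro ⟨⟨s, hs⟩, h2⟩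
      obtain _ | ⟨d, s⟩ := s
      · have := congrArg List.length hs; simp at this; omega
      · have hl : (u.1 ++ [d]).length < n := by
          have h3 := congrArg List.length hs
          have h4 := w.2
          simp at h3 ⊢; omega
        refine ⟨Sum.inl ⟨u.1 ++ [d], hl⟩, (par_completeTree _ _).2 ⟨_, rfl, d, rfl⟩, ?_⟩
        refine (ih _).2 ⟨⟨s, by simpa using hs⟩, ?_⟩
        simp only [List.length_append, List.length_singleton]
        omega

end Ancestors

theorem exists_arity_bound (L : FirstOrder.Language.{0, 0}) [Finite (Σ k, L.Relations k)] :
    ∃ r, ∀ k, Nonempty (L.Relations k) → k ≤ r := by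
  obtain ⟨r, hr⟩ := (Set.finite_range fun R : (Σ k, L.Relations k) => R.1).bddAbove
  exact ⟨r, fun k ⟨R⟩ => hr ⟨⟨k, R⟩, rfl⟩⟩

/-- An element is coded by its image vertex in the copy given by its slot. A tuple `c` is coded by a
vertex `v c` below the images of all its entries, in a copy whose index records the arity and, for
every coordinate, the distance from `v c` up to the image of the entry together with its slot. Thus
`in_i` becomes "`j`-th ancestor in a given slot", and the number of copies depends only on `n`, `K`
and the arities. -/
theorem exists_transduction_of_treeMap (L : FirstOrder.Language.{0, 0}) [L.IsRelational]
    [Finite (Σ k, L.Relations k)] (n K : ℕ) :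
    ∃ τ : Transduction (incLang FirstOrder.Language.graph) (incLang L),
      ∀ (A : FinStr L) (m : ℕ) (h : A → List (Fin m)), TreeMap A m n K h →
        incidence A ∈ τ.image (incidence (completeTree m n)) := by
  obtain ⟨r, hr⟩ := exists_arity_bound L
  -- The summand `Fin 2` is padding: it forces at least two copies, so that the copy predicates and
  -- `∼` are present.
  let C := Fin K ⊕ ((Fin (r + 1) × (Fin r → Option (Fin n × Fin K))) ⊕ Fin 2)
  let k := Fintype.card C
  have hk : 2 ≤ k := by simp [k, C]; omega
  let eC : C ≃ Fin k := Fintype.equivFin C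
  -- In each copy, one parameter for the domain and one for each predicate `P_R`.
  let Pm := C ⊕ (C × Σ k, L.Relations k)
  let eP : Pm ≃ Fin (Nat.card Pm) := Finite.equivFin Pm
  have hcopy (κ : C) : CDef1 (L := incLang FirstOrder.Language.graph) (m := Nat.card Pm)
      fun _ _ x => x.2 = eC κ := cdef1_copy hk _
  obtain ⟨τ, hτ⟩ := exists_transduction (L := incLang FirstOrder.Language.graph) (L' := L) (k := k)
    (m := Nat.card Pm) (one_le_two.trans hk)
    (δ := fun B Q x => ∃ κ, x.2 = eC κ ∧ x.1 ∈ Q (eP (Sum.inl κ)))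
    (Def1.exists fun κ => (hcopy κ).and (cdef1_colour _))
    (PR := fun R B Q x => ∃ κ, x.2 = eC κ ∧ x.1 ∈ Q (eP (Sum.inr (κ, ⟨_, R⟩))))
    (fun R => Def1.exists fun κ => (hcopy κ).and (cdef1_colour _))
    (IN := fun i B Q x y => ∃ (s : Fin K) (q : Fin (r + 1) × (Fin r → Option (Fin n × Fin K)))
      (j : Fin n), (∃ h : i < r, q.2 ⟨i, h⟩ = some (j, s)) ∧
        (x.2 = eC (Sum.inl s) ∧ y.2 = eC (Sum.inr (Sum.inl q))) ∧ anc B j x.1 y.1)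
    (fun i => Def2.exists fun s => Def2.exists fun q => Def2.exists fun j => Def2.const_and _
      (((hcopy _).fst.and (hcopy _).snd).and (cdef2_anc hk _)))
  refine ⟨τ, fun A m h H => ?_⟩
  obtain ⟨s, hs⟩ := H.exists_slot
  have hv (c : Tuples A) : ∃ v : List (Fin m), v.length < n ∧ ∀ i, h (c.1.2 i) <+: v := by
    obtain ⟨R, hR⟩ := c.2
    exact H.chain _ R _ hR
  choose v hvn hvc using hv
  have har (c : Tuples A) : c.1.1 ≤ r := hr _ ⟨c.2.choose⟩
  let code : Tuples A → Fin (r + 1) × (Fin r → Option (Fin n × Fin K)) := fun c =>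
    (⟨c.1.1, Nat.lt_succ_of_le (har c)⟩, fun i => if hi : i.1 < c.1.1 then
      some (⟨(v c).length - (h (c.1.2 ⟨i, hi⟩)).length, (Nat.sub_le _ _).trans_lt (hvn c)⟩,
        s (c.1.2 ⟨i, hi⟩)) else none)
  have hcode (c : Tuples A) (i : ℕ) (hi : i < c.1.1) : (code c).2 ⟨i, hi.trans_le (har c)⟩ =
      some (⟨(v c).length - (h (c.1.2 ⟨i, hi⟩)).length, (Nat.sub_le _ _).trans_lt (hvn c)⟩,
        s (c.1.2 ⟨i, hi⟩)) := dif_pos hi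
  let enc : incidence A → incidence (completeTree m n) × Fin k := Sum.elim
    (fun a => (Sum.inl ⟨h a, H.length_lt a⟩, eC (Sum.inl (s a))))
    (fun c => (Sum.inl ⟨v c, hvn c⟩, eC (Sum.inr (Sum.inl (code c)))))
  -- An ancestor of `v c` is determined by its distance from `v c`, and then the slot singles out
  -- the entry.
  have hpre (c : Tuples A) (i : ℕ) (hi : i < c.1.1) (a : A) (h1 : h a <+: v c)
      (h2 : (v c).length - (h a).length = (v c).length - (h (c.1.2 ⟨i, hi⟩)).length)
      (h3 : s a = s (c.1.2 ⟨i, hi⟩)) : a = c.1.2 ⟨i, hi⟩ := by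
    refine hs _ _ ?_ h3
    have h4 := hvc c ⟨i, hi⟩
    have h5 := h1.length_le
    have h6 := h4.length_le
    exact (List.prefix_of_prefix_length_le h1 h4 (by omega)).eq_of_length (by omega)
  have hinj : Function.Injective enc := by
    rintro (a | c) (b | d) hab
    · obtain ⟨h1, h2⟩ := Prod.mk.inj hab
      have h1 := congrArg Subtype.val (Sum.inl.inj h1)
      have h2 := Sum.inl.inj (eC.injective h2)
      exact congrArg _ (hs _ _ h1 h2)
    · have h2 := eC.injective (Prod.mk.inj hab).2
      simp at h2
    · have h2 := eC.injective (Prod.mk.inj hab).2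
      simp at h2
    · obtain ⟨h1, h2⟩ := Prod.mk.inj hab
      have h1 : v c = v d := congrArg Subtype.val (Sum.inl.inj h1)
      have h2 := Sum.inl.inj (Sum.inr.inj (eC.injective h2))
      refine congrArg _ (Subtype.ext ?_)
      have h3 : c.1.1 = d.1.1 := congrArg (fun q => q.1.1) h2
      have h4 : ∀ i hi, c.1.2 ⟨i, hi⟩ = d.1.2 ⟨i, h3 ▸ hi⟩ := by
        intro i hi
        have h5 := (hcode c i hi).symm.trans ((congrFun (congrArg Prod.snd h2) _).trans
          (hcode d i (h3 ▸ hi)))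
        simp only [Option.some.injEq, Prod.mk.injEq, Fin.mk.injEq] at h5
        refine hpre d i (h3 ▸ hi) _ (h1 ▸ hvc c _) ?_ h5.2
        rw [← h1]; rw [h5.1, h1]
      rcases c with ⟨⟨kc, c⟩, hc⟩
      rcases d with ⟨⟨kd, d⟩, hd⟩
      dsimp only at h3
      subst h3
      simp only [Sigma.mk.injEq, heq_eq_eq, true_and]
      exact funext fun i => h4 i.1 i.2
  let Q : Fin (Nat.card Pm) → Set (incidence (completeTree m n)) := fun p => match eP.symm p with
    | Sum.inl κ => {b | ∃ y, enc y = (b, eC κ)}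
    | Sum.inr (κ, R) => {b | ∃ y, enc y = (b, eC κ) ∧
        FirstOrder.Language.Structure.RelMap (L := incLang L) (IncRel.P R.2) ![y]}
  have hQ1 (κ : C) (b : incidence (completeTree m n)) :
      b ∈ Q (eP (Sum.inl κ)) ↔ ∃ y, enc y = (b, eC κ) := by
    simp [Q]
  have hQ2 (κ : C) (R : Σ k, L.Relations k) (b : incidence (completeTree m n)) :
      b ∈ Q (eP (Sum.inr (κ, R))) ↔ ∃ y, enc y = (b, eC κ) ∧
        FirstOrder.Language.Structure.RelMap (L := incLang L) (IncRel.P R.2) ![y] := by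
    simp [Q]
  have hdom (x : incidence (completeTree m n) × Fin k) :
      (∃ y, enc y = x) ↔ ∃ κ, x.2 = eC κ ∧ x.1 ∈ Q (eP (Sum.inl κ)) := by
    constructor
    · rintro ⟨y, rfl⟩
      exact ⟨eC.symm (enc y).2, by simp, (hQ1 _ _).2 ⟨y, by simp⟩⟩
    · rintro ⟨κ, h1, h2⟩
      obtain ⟨y, hy⟩ := (hQ1 _ _).1 h2
      exact ⟨y, hy.trans (Prod.ext rfl h1.symm)⟩
  refine hτ _ Q (incidence A) ((Equiv.ofInjective enc hinj).trans (Equiv.subtypeEquivRight hdom))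
    (fun R x => ?_) (fun i hi x => ?_)
  · change _ ↔ ∃ κ, (enc (x 0)).2 = eC κ ∧ (enc (x 0)).1 ∈ Q (eP (Sum.inr (κ, ⟨_, R⟩)))
    have hx : x = ![x 0] := by funext j; fin_cases j; rfl
    constructor
    · intro hR
      refine ⟨eC.symm (enc (x 0)).2, by simp, (hQ2 _ _ _).2 ⟨x 0, by simp, ?_⟩⟩
      rw [← hx]; exact hR
    · rintro ⟨κ, h1, h2⟩
      obtain ⟨y, hy, hR⟩ := (hQ2 _ _ _).1 h2
      have : y = x 0 := hinj (hy.trans (Prod.ext rfl h1.symm))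
      rw [hx, ← this]; exact hR
  · change _ ↔ ∃ (s : Fin K) (q : Fin (r + 1) × (Fin r → Option (Fin n × Fin K)))
      (j : Fin n), (∃ h : i < r, q.2 ⟨i, h⟩ = some (j, s)) ∧
        ((enc (x 0)).2 = eC (Sum.inl s) ∧ (enc (x 1)).2 = eC (Sum.inr (Sum.inl q))) ∧
          anc _ j (enc (x 0)).1 (enc (x 1)).1
    constructor
    · rintro ⟨c, hc, h0, h1⟩
      rw [h0, h1]
      refine ⟨_, _, _, ⟨hc.trans_le (har c), hcode c i hc⟩, ⟨rfl, rfl⟩, ?_⟩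
      refine (anc_completeTree _ _ _).2 ⟨hvc c _, ?_⟩
      have := (hvc c ⟨i, hc⟩).length_le
      simp only
      omega
    · rintro ⟨t, q, j, ⟨hi', hq⟩, ⟨h1, h2⟩, h3⟩
      rcases hx0 : x 0 with a | c
      swap
      · rw [hx0] at h1
        have := eC.injective h1
        simp at this
      rcases hx1 : x 1 with a' | c
      · rw [hx1] at h2
        have := eC.injective h2
        simp at this
      rw [hx0] at h1 h3
      rw [hx1] at h2 h3
      have h1 : s a = t := Sum.inl.inj (eC.injective h1)
      have h2 : code c = q := Sum.inl.inj (Sum.inr.inj (eC.injective h2))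
      obtain ⟨h4, h5⟩ := (anc_completeTree _ _ _).1 h3
      dsimp only at h4 h5
      subst h2
      by_cases hic : i < c.1.1
      · have h6 := (hcode c i hic).symm.trans hq
        simp only [Option.some.injEq, Prod.mk.injEq] at h6
        have h7 := congrArg Fin.val h6.1
        dsimp only at h7
        refine ⟨c, hic, ?_, hx1⟩
        rw [hx0]
        refine congrArg _ (hpre c i hic a h4 ?_ (h1.trans h6.2.symm))
        omega
      · have : (code c).2 ⟨i, hi'⟩ = none := dif_neg hic
        rw [this] at hq
        cases hq

end MSOTrans

/-! ### The dichotomy: a marked complete tree, or a bounded-fibre map to a tree of height `n`. -/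

namespace MSOTrans

open FirstOrder

/-! ### Normal spanning forests -/

section Forest

variable {α : Type*} {adj : α → α → Prop} {p : α → List α}

/-- A rooted spanning forest; `p a` is the path from a root to `a`. -/
def IsForest (adj : α → α → Prop) (p : α → List α) : Prop :=
  ∀ a, p a = [a] ∨ ∃ b, adj b a ∧ p a = p b ++ [a]

/-- The relation between a vertex of a forest and its children. -/
def IsChild (p : α → List α) (b a : α) : Prop := p a = p b ++ [a]

theorem IsForest.exists_append (hp : IsForest adj p) (a : α) : ∃ q, p a = q ++ [a] := by
  rcases hp a with h | ⟨b, -, h⟩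
  · exact ⟨[], h⟩
  · exact ⟨_, h⟩

theorem IsForest.ne_nil (hp : IsForest adj p) (a : α) : p a ≠ [] := by
  obtain ⟨q, hq⟩ := hp.exists_append a
  simp [hq]

theorem IsForest.eq_of_append (hp : IsForest adj p) {a b : α} {q : List α} (h : p a = q ++ [b]) :
    a = b := by
  obtain ⟨q', hq⟩ := hp.exists_append a
  rw [hq] at h
  exact List.singleton_inj.1 (List.append_inj' h rfl).2

theorem IsForest.injective (hp : IsForest adj p) : Function.Injective p := fun a b h => by
  obtain ⟨q, hq⟩ := hp.exists_append b
  exact hp.eq_of_append (h.trans hq)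

theorem IsForest.adj_of_isChild (hp : IsForest adj p) {a b : α} (h : IsChild p b a) : adj b a := by
  rcases hp a with h' | ⟨c, hc, h'⟩
  · have : [] = p b := (List.append_inj' (h'.symm.trans h : [] ++ [a] = _) rfl).1
    exact absurd this.symm (hp.ne_nil b)
  · have := (List.append_inj' (h'.symm.trans h) rfl).1
    rwa [← hp.injective this]

/-- Passing from a vertex to its parent deletes the last entry of its path, so every nonempty prefix
is met as the path of its own last vertex. The length of paths supplies the well-foundedness. -/
theorem IsForest.eq_of_prefix (hp : IsForest adj p) {a b : α} {q : List α}
    (h : q ++ [b] <+: p a) : p b = q ++ [b] := by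
  obtain ⟨N, hN⟩ : ∃ N, (p a).length ≤ N := ⟨_, le_rfl⟩
  induction N generalizing a with
  | zero =>
    have := h.length_le
    simp at this; omega
  | succ N ih =>
    rcases hp a with h' | ⟨c, -, h'⟩
    · rw [h'] at h
      have h1 := h.length_le
      obtain rfl : q = [] := by
        simpa using h1
      obtain rfl : b = a := by simpa using h
      exact h'
    · have h2 := h
      rw [h', List.prefix_concat_iff] at h2
      rcases h2 with h2 | h2
      · rw [← h'] at h2
        obtain rfl := hp.eq_of_append h2.symm
        exact h2.symm
      · refine ih h2 ?_
        rw [h'] at hN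
        simpa using hN

theorem IsForest.prefix_of_mem (hp : IsForest adj p) {a b : α} (h : b ∈ p a) : p b <+: p a := by
  obtain ⟨s, t, hst⟩ := List.append_of_mem h
  have h' : s ++ [b] <+: p a := ⟨t, by simp [hst]⟩
  rwa [hp.eq_of_prefix h']

/-- If the end of a path already occurred earlier, its own path would be a proper prefix of itself.
This bounds the length of paths by the number of vertices. -/
theorem IsForest.nodup (hp : IsForest adj p) (a : α) : (p a).Nodup := by
  obtain ⟨N, hN⟩ : ∃ N, (p a).length ≤ N := ⟨_, le_rfl⟩
  induction N generalizing a with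
  | zero => exact absurd (List.length_eq_zero_iff.1 (Nat.le_zero.1 hN)) (hp.ne_nil a)
  | succ N ih =>
    rcases hp a with h | ⟨b, -, h⟩
    · simp [h]
    · have hl : (p b).length + 1 = (p a).length := by simp [h]
      rw [h, List.nodup_append]
      refine ⟨ih b (by omega), by simp, ?_⟩
      rintro x hx y hy rfl
      rw [List.mem_singleton] at hy
      subst hy
      have := (hp.prefix_of_mem hx).length_le
      omega

theorem IsForest.transGen_iff (hp : IsForest adj p) {a b : α} :
    Relation.TransGen (IsChild p) a b ↔ p a <+: p b ∧ a ≠ b := by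
  constructor
  · intro h
    suffices H : p a <+: p b ∧ (p a).length < (p b).length from
      ⟨H.1, fun hab => by rw [hab] at H; exact lt_irrefl _ H.2⟩
    induction h with
    | single h => rw [h]; simp
    | tail _ h ih => rw [h]; exact ⟨ih.1.trans (List.prefix_append _ _), by simp; omega⟩
  · rintro ⟨h, hne⟩
    obtain ⟨N, hN⟩ : ∃ N, (p b).length ≤ N := ⟨_, le_rfl⟩
    induction N generalizing b with
    | zero => exact absurd (List.length_eq_zero_iff.1 (Nat.le_zero.1 hN)) (hp.ne_nil b)
    | succ N ih =>
      obtain ⟨q, hq⟩ := hp.exists_append a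
      rcases hp b with h' | ⟨c, -, h'⟩
      · rw [h', hq] at h
        have h1 := h.length_le
        obtain rfl : q = [] := by simpa using h1
        exact absurd (by simpa using h) hne
      · have h2 := h
        rw [h', List.prefix_concat_iff] at h2
        rcases h2 with h2 | h2
        · exact absurd (hp.injective (h2.trans h'.symm)) hne
        · by_cases hac : a = c
          · subst hac; exact .single h'
          · exact (ih h2 hac (by rw [h'] at hN; simpa using hN)).tail h'

/-- Every finite graph has a normal spanning forest. -/
theorem exists_normal_forest [Finite α] (adj : α → α → Prop) (hsymm : ∀ a b, adj a b → adj b a) :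
    ∃ p : α → List α, IsForest adj p ∧ ∀ a b, adj a b → p a <+: p b ∨ p b <+: p a := by
  classical
  have := Fintype.ofFinite α
  -- A forest maximising the sum of all depths is normal; the sum is bounded because paths do not
  -- repeat vertices.
  let s : Set ℕ := {N | ∃ p : α → List α, IsForest adj p ∧ ∑ a, (p a).length = N}
  have hne : s.Nonempty := ⟨_, fun a => [a], fun a => Or.inl rfl, rfl⟩
  have hbdd : BddAbove s := by
    refine ⟨∑ _a : α, Fintype.card α, ?_⟩
    rintro _ ⟨p, hp, rfl⟩
    exact Finset.sum_le_sum fun a _ => (hp.nodup a).length_le_card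
  obtain ⟨p, hp, hsum⟩ := Nat.sSup_mem hne hbdd
  have hmax : ∀ p', IsForest adj p' → ∑ a, (p' a).length ≤ ∑ a, (p a).length := fun p' hp' =>
    hsum ▸ le_csSup hbdd ⟨p', hp', rfl⟩
  suffices key : ∀ a b, adj a b → (p b).length ≤ (p a).length → p b <+: p a by
    refine ⟨p, hp, fun a b hab => ?_⟩
    rcases le_total (p b).length (p a).length with h | h
    · exact Or.inr (key a b hab h)
    · exact Or.inl (key b a (hsymm _ _ hab) h)
  intro a b hab hle
  by_contra hba
  -- Reattach the subtree of `b` below `a`. No cycle arises because `b` is not an ancestor of `a`,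
  -- and the whole subtree moves strictly deeper because `b` was not deeper than `a`, contradicting
  -- maximality.
  let p' : α → List α := fun x =>
    if p b <+: p x then p a ++ b :: (p x).drop (p b).length else p x
  have h1 : ∀ x s, p x = p b ++ s → p' x = p a ++ b :: s := fun x s hx => by
    simp [p', hx]
  have h2 : ∀ x, ¬ p b <+: p x → p' x = p x := fun x hx => by simp [p', hx]
  have hlt : ∑ x, (p x).length < ∑ x, (p' x).length := by
    refine Finset.sum_lt_sum (fun x _ => ?_) ⟨b, Finset.mem_univ _, ?_⟩
    · by_cases hx : p b <+: p x
      · obtain ⟨s, hs⟩ := hx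
        rw [h1 x s hs.symm, ← hs]
        simp; omega
      · rw [h2 x hx]
    · rw [h1 b [] (by simp)]
      simp; omega
  refine absurd (hmax p' fun x => ?_) (not_le.2 hlt)
  by_cases hx : p b <+: p x
  · obtain ⟨s, hs⟩ := hx
    induction s using List.reverseRecOn with
    | nil =>
      have : b = x := hp.injective (by simpa using hs)
      subst this
      refine Or.inr ⟨a, hab, ?_⟩
      rw [h1 b [] (by simp), h2 a hba]
    | append_singleton s y _ =>
      rw [← List.append_assoc] at hs
      have hxy : x = y := hp.eq_of_append hs.symm
      subst hxy
      rcases hp x with h | ⟨c, hc, h⟩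
      · have : p b ++ s = [] := (List.append_inj' (hs.trans h : _ = [] ++ [x]) rfl).1
        exact absurd (List.append_eq_nil_iff.1 this).1 (hp.ne_nil b)
      · have h3 : p b ++ s = p c := (List.append_inj' (hs.trans h) rfl).1
        refine Or.inr ⟨c, hc, ?_⟩
        rw [h1 x (s ++ [x]) (by rw [← hs, List.append_assoc]), h1 c s h3.symm]
        simp
  · rw [h2 x hx]
    rcases hp x with h | ⟨c, hc, h⟩
    · exact Or.inl h
    · refine Or.inr ⟨c, hc, ?_⟩
      rw [h2 c fun h' => hx (h ▸ h'.trans (List.prefix_append _ _)), h]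

end Forest

/-! ### Embeddings of complete trees into tree domains -/

section Dichotomy

variable {D : Type*} {T : Set (List D)}

/-- The tree `m^{<h}` embeds into the part of `T` above `v`. -/
def TreeEmb (T : Set (List D)) (m h : ℕ) (v : List D) : Prop :=
  ∃ φ : List (Fin m) → List D, (∀ l, l.length < h → φ l ∈ T ∧ v <+: φ l) ∧
    ∀ l l', l.length < h → l'.length < h → (φ l <+: φ l' ↔ l <+: l')

/-- The size of the fibres in `treeEmb_or_map`. -/
def fibreBound (m : ℕ) : ℕ → ℕ
  | 0 => 1
  | j + 1 => (m + 1) * fibreBound m j + 1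

theorem TreeEmb.mono {m h : ℕ} {v w : List D} (hvw : v <+: w) (H : TreeEmb T m h w) :
    TreeEmb T m h v := by
  obtain ⟨φ, h1, h2⟩ := H
  exact ⟨φ, fun l hl => ⟨(h1 l hl).1, hvw.trans (h1 l hl).2⟩, h2⟩

/-- Subtrees at distinct children are incomparable, so the `m` embeddings can be joined with `v` as
their common root. -/
theorem TreeEmb.of_children {m h : ℕ} {v : List D} (hv : v ∈ T) (b : Fin m → D)
    (hb : Function.Injective b) (H : ∀ d, TreeEmb T m h (v ++ [b d])) : TreeEmb T m (h + 1) v := by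
  choose φ h1 h2 using H
  refine ⟨fun l => l.casesOn v fun d l => φ d l, ?_, ?_⟩
  · rintro (_ | ⟨d, l⟩) hl
    · exact ⟨hv, List.prefix_rfl⟩
    · have := h1 d l (by simpa using hl)
      exact ⟨this.1, (List.prefix_append _ _).trans this.2⟩
  · rintro (_ | ⟨d, l⟩) (_ | ⟨d', l'⟩) hl hl'
    · simp
    · have := h1 d' l' (by simpa using hl')
      simpa using (List.prefix_append _ _).trans this.2
    · have := (h1 d l (by simpa using hl)).2.length_le
      simp only [List.prefix_nil, reduceCtorEq, iff_false]
      intro h3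
      have h3 := h3.length_le
      simp at this; omega
    · have h3 := h1 d l (by simpa using hl)
      have h4 := h1 d' l' (by simpa using hl')
      rw [List.cons_prefix_cons]
      constructor
      · intro h5
        have h6 := (List.prefix_of_prefix_length_le (h3.2.trans h5) h4.2 (by simp)).eq_of_length
          (by simp)
        have h7 : d = d' := hb (by simpa using h6)
        subst h7
        exact ⟨rfl, (h2 d l l' (by simpa using hl) (by simpa using hl')).1 h5⟩
      · rintro ⟨rfl, h5⟩
        exact (h2 d l l' (by simpa using hl) (by simpa using hl')).2 h5

theorem treeEmb_or_map (hfin : T.Finite) (hT : ∀ x y, x ++ y ∈ T → x ∈ T) (m j : ℕ) :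
    ∀ (v : List D) (h : ℕ), v ∈ T → (∀ x ∈ T, v <+: x → x.length ≤ v.length + j) →
      TreeEmb T m h v ∨ ∃ g : List D → List D, (∀ x ∈ T, v <+: x → (g x).length + 1 < h) ∧
        (∀ x y, x ∈ T → y ∈ T → v <+: x → x <+: y → g x <+: g y) ∧
        ∀ u, {x | x ∈ T ∧ v <+: x ∧ g x = u}.ncard ≤ fibreBound m j := by
  classical
  induction j with
  | zero =>
    intro v h hv hj
    -- For `h = 0` and `h = 1` the tree to be embedded is empty or a single vertex, so only `h ≥ 2`
    -- has content.
    rcases h with _ | _ | h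
    · exact Or.inl ⟨fun _ => v, fun l hl => absurd hl (Nat.not_lt_zero _),
        fun l _ hl => absurd hl (Nat.not_lt_zero _)⟩
    · refine Or.inl ⟨fun _ => v, fun l _ => ⟨hv, List.prefix_rfl⟩, fun l l' hl hl' => ?_⟩
      simp only [zero_add, Nat.lt_one_iff, List.length_eq_zero_iff] at hl hl'
      simp [hl, hl']
    · refine Or.inr ⟨fun _ => [], fun _ _ _ => by simp, fun _ _ _ _ _ _ => List.prefix_rfl,
        fun u => ?_⟩
      refine (Set.ncard_le_ncard (t := {v}) ?_ (Set.finite_singleton v)).trans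
        (Set.ncard_singleton v).le
      rintro x ⟨hx, hvx, -⟩
      exact (hvx.eq_of_length_le (hj x hx hvx)).symm
  | succ j ih =>
    intro v h hv hj
    rcases h with _ | _ | h
    · exact Or.inl ⟨fun _ => v, fun l hl => absurd hl (Nat.not_lt_zero _),
        fun l _ hl => absurd hl (Nat.not_lt_zero _)⟩
    · refine Or.inl ⟨fun _ => v, fun l _ => ⟨hv, List.prefix_rfl⟩, fun l l' hl hl' => ?_⟩
      simp only [zero_add, Nat.lt_one_iff, List.length_eq_zero_iff] at hl hl'
      simp [hl, hl']
    by_cases hE : TreeEmb T m (h + 2) v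
    · exact Or.inl hE
    refine Or.inr ?_
    have hj' (b : D) : ∀ x ∈ T, v ++ [b] <+: x → x.length ≤ (v ++ [b]).length + j := by
      intro x hx hbx
      have := hj x hx ((List.prefix_append _ _).trans hbx)
      simp; omega
    let bad : Set D := {b | v ++ [b] ∈ T ∧ TreeEmb T m (h + 1) (v ++ [b])}
    have hbadfin : bad.Finite := by
      refine (hfin.preimage (f := fun b => v ++ [b]) ?_).subset fun b hb => hb.1
      intro b _ c _ hbc
      simpa using hbc
    have hbad : bad.ncard < m := by
      by_contra hcon
      have := hbadfin.fintype
      obtain ⟨f⟩ : Nonempty (Fin m ↪ bad) := by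
        refine Function.Embedding.nonempty_of_card_le ?_
        rw [Fintype.card_fin, ← Nat.card_eq_fintype_card]
        exact not_lt.1 hcon
      exact hE (TreeEmb.of_children hv (fun d => (f d).1)
        (Subtype.val_injective.comp f.injective) fun d => (f d).2.2)
    have h1 (b : D) : ∃ g : List D → List D, v ++ [b] ∈ T →
        (∀ x ∈ T, v ++ [b] <+: x → (g x).length + 1 < h + 2) ∧
        (∀ x y, x ∈ T → y ∈ T → v ++ [b] <+: x → x <+: y → g x <+: g y) ∧
        ∀ u, {x | x ∈ T ∧ v ++ [b] <+: x ∧ g x = u}.ncard ≤ fibreBound m j := by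
      by_cases hb : v ++ [b] ∈ T
      · rcases ih (v ++ [b]) (h + 2) hb (hj' b) with h' | ⟨g, hg⟩
        · exact absurd (h'.mono (List.prefix_append _ _)) hE
        · exact ⟨g, fun _ => hg⟩
      · exact ⟨id, fun h => absurd h hb⟩
    have h2 (b : D) : ∃ g : List D → List D, v ++ [b] ∈ T → b ∉ bad →
        (∀ x ∈ T, v ++ [b] <+: x → (g x).length + 1 < h + 1) ∧
        (∀ x y, x ∈ T → y ∈ T → v ++ [b] <+: x → x <+: y → g x <+: g y) ∧
        ∀ u, {x | x ∈ T ∧ v ++ [b] <+: x ∧ g x = u}.ncard ≤ fibreBound m j := by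
      by_cases hb : v ++ [b] ∈ T
      · rcases ih (v ++ [b]) (h + 1) hb (hj' b) with h' | ⟨g, hg⟩
        · exact ⟨id, fun _ h => absurd ⟨hb, h'⟩ h⟩
        · exact ⟨g, fun _ _ => hg⟩
      · exact ⟨id, fun h => absurd h hb⟩
    choose g1 hg1 using h1
    choose g2 hg2 using h2
    -- The first letter of `x` beyond `v` names the child whose subtree contains `x`; `v` itself
    -- goes to the root.
    let g : List D → List D := fun x => match (x.drop v.length).head? with
      | none => []
      | some b => if b ∈ bad then g1 b x else b :: g2 b x
    have gnil : g v = [] := by simp [g]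
    have gbad (b : D) (s : List D) (hb : b ∈ bad) : g (v ++ b :: s) = g1 b (v ++ b :: s) := by
      simp [g, hb]
    have ggood (b : D) (s : List D) (hb : b ∉ bad) :
        g (v ++ b :: s) = b :: g2 b (v ++ b :: s) := by
      simp [g, hb]
    have hTb (b : D) (s : List D) (hb : v ++ b :: s ∈ T) : v ++ [b] ∈ T :=
      hT _ s (by simpa using hb)
    have hpre (b : D) (s : List D) : v ++ [b] <+: v ++ b :: s := ⟨s, by simp⟩
    refine ⟨g, ?_, ?_, fun u => ?_⟩
    · rintro x hx ⟨s, rfl⟩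
      rcases s with _ | ⟨b, s⟩
      · simp [gnil]
      · by_cases hb : b ∈ bad
        · rw [gbad b s hb]
          exact (hg1 b (hTb b s hx)).1 _ hx (hpre b s)
        · rw [ggood b s hb]
          have := (hg2 b (hTb b s hx) hb).1 _ hx (hpre b s)
          simpa using this
    · rintro x y hx hy ⟨s, rfl⟩ ⟨t, rfl⟩
      rcases s with _ | ⟨b, s⟩
      · simp [gnil]
      · have e : v ++ b :: s ++ t = v ++ b :: (s ++ t) := by simp
        have hp : v ++ b :: s <+: v ++ b :: (s ++ t) := ⟨t, by simp⟩
        rw [e] at hy ⊢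
        by_cases hb : b ∈ bad
        · rw [gbad b s hb, gbad b _ hb]
          exact (hg1 b (hTb b s hx)).2.1 _ _ hx hy (hpre b s) hp
        · rw [ggood b s hb, ggood b _ hb, List.cons_prefix_cons]
          exact ⟨rfl, (hg2 b (hTb b s hx) hb).2.1 _ _ hx hy (hpre b s) hp⟩
    -- `F` is the contribution of good children to the fibre over `u`: the first letter of `u` names
    -- the only possible child, so it is empty for `u = []`. `G` collects the bad children.
    · let F : Set (List D) := match u with
        | [] => ∅
        | b :: u' => {x | (v ++ [b] ∈ T ∧ b ∉ bad) ∧ x ∈ T ∧ v ++ [b] <+: x ∧ g2 b x = u'}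
      have hF : F.ncard ≤ fibreBound m j := by
        rcases u with _ | ⟨b, u'⟩
        · simp [F]
        · by_cases hb : v ++ [b] ∈ T ∧ b ∉ bad
          · simpa [F, hb] using (hg2 b hb.1 hb.2).2.2 u'
          · have : F = ∅ := Set.eq_empty_of_forall_notMem fun x hx => hb hx.1
            rw [this, Set.ncard_empty]; exact Nat.zero_le _
      let G : Set (List D) :=
        ⋃ b ∈ hbadfin.toFinset, {x | x ∈ T ∧ v ++ [b] <+: x ∧ g1 b x = u}
      have hG : G.ncard ≤ m * fibreBound m j := by
        refine (Finset.set_ncard_biUnion_le _ _).trans ?_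
        refine (Finset.sum_le_card_nsmul _ _ (fibreBound m j) fun b hb => ?_).trans ?_
        · exact (hg1 b ((hbadfin.mem_toFinset).1 hb).1).2.2 u
        · rw [smul_eq_mul, ← Set.ncard_eq_toFinset_card bad hbadfin]
          exact Nat.mul_le_mul_right _ hbad.le
      have hsub : {x | x ∈ T ∧ v <+: x ∧ g x = u} ⊆ {v} ∪ (G ∪ F) := by
        rintro x ⟨hx, ⟨s, rfl⟩, hu⟩
        rcases s with _ | ⟨b, s⟩
        · left; simp
        · right
          by_cases hb : b ∈ bad
          · left
            rw [gbad b s hb] at hu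
            simp only [G, Set.mem_iUnion]
            exact ⟨b, hbadfin.mem_toFinset.2 hb, hx, hpre b s, hu⟩
          · right
            rw [ggood b s hb] at hu
            subst hu
            exact ⟨⟨hTb b s hx, hb⟩, hx, hpre b s, rfl⟩
      have hGF : ({v} ∪ (G ∪ F) : Set (List D)).Finite := by
        refine (Set.finite_singleton v).union (Set.Finite.union ?_ ?_)
        · refine hfin.subset fun x hx => ?_
          simp only [G, Set.mem_iUnion] at hx
          obtain ⟨b, -, hx, -⟩ := hx
          exact hx
        · refine hfin.subset fun x hx => ?_
          rcases u with _ | ⟨b, u'⟩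
          · exact absurd hx (Set.notMem_empty x)
          · exact hx.2.1
      refine (Set.ncard_le_ncard hsub hGF).trans ((Set.ncard_union_le _ _).trans ?_)
      have := Set.ncard_union_le G F
      rw [Set.ncard_singleton, fibreBound]
      have e : (m + 1) * fibreBound m j = m * fibreBound m j + fibreBound m j := by ring
      omega

end Dichotomy

/-! ### Lexicographic positions -/

section Position

variable {m : ℕ}

/-- The position of a sequence of length at most `h` in the lexicographic order. -/
def lexPos (m : ℕ) : ℕ → List (Fin m) → ℕ
  | 0, _ => 0
  | _ + 1, [] => 0
  | h + 1, d :: l => (d.1 + 1) * (m + 1) ^ h + lexPos m h l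

theorem lexPos_lt (h : ℕ) (l : List (Fin m)) : lexPos m h l < (m + 1) ^ h := by
  induction h generalizing l with
  | zero => simp [lexPos]
  | succ h ih =>
    rcases l with _ | ⟨d, l⟩
    · simp [lexPos]
    · have h1 := Nat.mul_le_mul_right ((m + 1) ^ h) (show d.1 + 1 ≤ m from d.2)
      have := ih l
      simp only [lexPos, pow_succ]
      nlinarith

theorem eq_of_mul_add_lt {B a b c d : ℕ} (hb : b < B) (hd : d < B)
    (h1 : a * B + b = c * B + d) : a = c ∧ b = d := by
  rcases lt_trichotomy a c with h | h | h
  · have := Nat.mul_le_mul_right B (show a + 1 ≤ c from h)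
    rw [add_mul] at this; omega
  · subst h; exact ⟨rfl, by omega⟩
  · have := Nat.mul_le_mul_right B (show c + 1 ≤ a from h)
    rw [add_mul] at this; omega

theorem lexPos_inj {h : ℕ} {l l' : List (Fin m)} (hl : l.length ≤ h) (hl' : l'.length ≤ h)
    (e : lexPos m h l = lexPos m h l') : l = l' := by
  induction h generalizing l l' with
  | zero =>
    rw [List.length_eq_zero_iff.1 (Nat.le_zero.1 hl), List.length_eq_zero_iff.1 (Nat.le_zero.1 hl')]
  | succ h ih =>
    have hpos : 0 < (m + 1) ^ h := by positivity
    rcases l with _ | ⟨d, l⟩ <;> rcases l' with _ | ⟨d', l'⟩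
    · rfl
    · have := Nat.mul_pos (Nat.succ_pos d'.1) hpos
      simp only [lexPos, Nat.succ_eq_add_one] at e this; omega
    · have := Nat.mul_pos (Nat.succ_pos d.1) hpos
      simp only [lexPos, Nat.succ_eq_add_one] at e this; omega
    · obtain ⟨h1, h2⟩ := eq_of_mul_add_lt (lexPos_lt h l) (lexPos_lt h l') e
      rw [ih (by simpa using hl) (by simpa using hl') h2, Fin.ext (Nat.succ.inj h1)]

theorem lexPos_lt_append {h : ℕ} {l : List (Fin m)} (hl : l.length + 1 ≤ h) (d : Fin m) :
    lexPos m h l < lexPos m h (l ++ [d]) := by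
  induction h generalizing l with
  | zero => omega
  | succ h ih =>
    rcases l with _ | ⟨c, l⟩
    · have hpos : 0 < (m + 1) ^ h := by positivity
      have := Nat.mul_pos (Nat.succ_pos d.1) hpos
      simp only [List.nil_append, lexPos, Nat.succ_eq_add_one] at this ⊢; omega
    · have := ih (l := l) (by simpa using hl)
      simpa [lexPos] using this

/-- Only proper extensions of `l` lie strictly between `l` and its child `l ++ [d]` in the
lexicographic order, namely parts of the subtrees of earlier children. -/
theorem length_lt_of_lexPos {h : ℕ} {l z : List (Fin m)} (hl : l.length + 1 ≤ h) (d : Fin m)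
    (h1 : lexPos m h l < lexPos m h z) (h2 : lexPos m h z < lexPos m h (l ++ [d])) :
    l.length < z.length := by
  induction h generalizing l z with
  | zero => omega
  | succ h ih =>
    rcases z with _ | ⟨e, z⟩
    · simp [lexPos] at h1
    rcases l with _ | ⟨c, l⟩
    · simp
    · have b1 := lexPos_lt h z
      have b2 := lexPos_lt h (l ++ [d])
      simp only [lexPos, List.cons_append] at h1 h2
      rcases lt_trichotomy e.1 c.1 with hec | hec | hec
      · have := Nat.mul_le_mul_right ((m + 1) ^ h) (show e.1 + 1 + 1 ≤ c.1 + 1 by omega)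
        rw [add_mul (e.1 + 1)] at this; omega
      · rw [hec] at h1 h2
        have := ih (l := l) (z := z) (by simpa using hl) (by omega) (by omega)
        simpa using this
      · have := Nat.mul_le_mul_right ((m + 1) ^ h) (show c.1 + 1 + 1 ≤ e.1 + 1 by omega)
        rw [add_mul (c.1 + 1)] at this; omega

end Position

/-! ### Markings -/

section Marking

/-- An embedding of the vertices of `m^{<n+1}` other than the root, such that the parent of a vertex
can be found by looking for the closest vertex of a smaller level. -/
structure Marking {α : Type*} (S : α → α → Prop) (m n : ℕ) (φ : List (Fin m) → α) : Prop where
  inj : ∀ l l', l ≠ [] → l' ≠ [] → l.length ≤ n → l'.length ≤ n → φ l = φ l' → l = l'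
  transGen : ∀ l d, l ≠ [] → l.length + 1 ≤ n → Relation.TransGen S (φ l) (φ (l ++ [d]))
  length_lt : ∀ l d z, l ≠ [] → l.length + 1 ≤ n → z ≠ [] → z.length ≤ n →
    Relation.TransGen S (φ l) (φ z) → Relation.TransGen S (φ z) (φ (l ++ [d])) →
    l.length < z.length

variable {α : Type*} {adj : α → α → Prop} {p : α → List α} {m n : ℕ}

/-- All sequences of length at most `n` fit on a path with `(m+1)^n` vertices, each at its
lexicographic position. Reachability between them is then the linear lexicographic order rather than
the tree order, but levels still allow parents to be found. -/
theorem IsForest.marking_of_path (hp : IsForest adj p) {a : α} (ha : (m + 1) ^ n ≤ (p a).length) :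
    ∃ φ : List (Fin m) → α, Marking (IsChild p) m n φ := by
  have hlt (l : List (Fin m)) : lexPos m n l < (p a).length := (lexPos_lt n l).trans_le ha
  let φ : List (Fin m) → α := fun l => (p a)[lexPos m n l]'(hlt l)
  have hφ (l : List (Fin m)) : p (φ l) = (p a).take (lexPos m n l + 1) := by
    have h1 : (p a).take (lexPos m n l) ++ [φ l] = (p a).take (lexPos m n l + 1) := by
      simp [φ]
    rw [← h1]
    refine hp.eq_of_prefix (a := a) ?_
    rw [h1]; exact List.take_prefix _ _
  have hlen (l : List (Fin m)) : (p (φ l)).length = lexPos m n l + 1 := by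
    rw [hφ, List.length_take]
    have := hlt l
    omega
  have key (l l' : List (Fin m)) : Relation.TransGen (IsChild p) (φ l) (φ l') ↔
      lexPos m n l < lexPos m n l' := by
    rw [hp.transGen_iff]
    constructor
    · rintro ⟨h1, h2⟩
      have h3 := h1.length_le
      rw [hlen, hlen] at h3
      refine lt_of_le_of_ne (by omega) fun h4 => h2 (hp.injective ?_)
      rw [hφ, hφ, h4]
    · intro h
      refine ⟨?_, fun h' => ?_⟩
      · rw [hφ, hφ]
        exact List.take_prefix_take_left (by omega)
      · have := congrArg (fun x => (p x).length) h'
        simp only [hlen] at this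
        omega
  refine ⟨φ, ⟨fun l l' _ _ hl hl' h => lexPos_inj hl hl' ?_, fun l d _ hl => (key _ _).2
    (lexPos_lt_append hl d), fun l d z _ hl _ _ h1 h2 => length_lt_of_lexPos hl d ((key _ _).1 h1)
      ((key _ _).1 h2)⟩⟩
  have := congrArg (fun x => (p x).length) h
  simp only [hlen] at this
  omega

/-- The tree domain of a forest with an additional root. -/
def forestDomain (p : α → List α) : Set (List α) := insert [] (Set.range p)

theorem IsForest.forestDomain_closed (hp : IsForest adj p) (x y : List α)
    (h : x ++ y ∈ forestDomain p) : x ∈ forestDomain p := by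
  induction x using List.reverseRecOn with
  | nil => exact Or.inl rfl
  | append_singleton x b _ =>
    rcases h with h | ⟨a, h⟩
    · simp at h
    · exact Or.inr ⟨b, hp.eq_of_prefix (a := a) ⟨y, h.symm⟩⟩

/-- Only the root of the embedded tree can hit the added vertex `[]`, since anything mapped there
would have to be a prefix of the root. This is why a `Marking` ignores the root. Reachability
between marked vertices is here the proper prefix order, so the level condition is immediate. -/
theorem IsForest.marking_of_treeEmb [Nonempty α] (hp : IsForest adj p)
    (h : TreeEmb (forestDomain p) m (n + 1) []) :
    ∃ φ : List (Fin m) → α, Marking (IsChild p) m n φ := by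
  obtain ⟨f, h1, h2⟩ := h
  have h3 (l : List (Fin m)) : ∃ a, l ≠ [] → l.length ≤ n → p a = f l := by
    by_cases hl : l ≠ [] ∧ l.length ≤ n
    · rcases (h1 l (Nat.lt_succ_of_le hl.2)).1 with h | ⟨a, ha⟩
      · refine absurd ((h2 l [] (Nat.lt_succ_of_le hl.2) (by simp)).1 ?_) (by simpa using hl.1)
        rw [h]; simp
      · exact ⟨a, fun _ _ => ha⟩
    · exact ⟨Classical.arbitrary α, fun h h' => absurd ⟨h, h'⟩ hl⟩
  choose φ hφ using h3
  have inj : ∀ l l', l ≠ [] → l' ≠ [] → l.length ≤ n → l'.length ≤ n → φ l = φ l' → l = l' := by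
    intro l l' hl hl' hn hn' h
    have h4 : f l = f l' := by rw [← hφ l hl hn, ← hφ l' hl' hn', h]
    have h5 := (h2 l l' (by omega) (by omega)).1 (by rw [h4])
    have h6 := (h2 l' l (by omega) (by omega)).1 (by rw [h4])
    exact h5.eq_of_length_le h6.length_le
  have key : ∀ l l', l ≠ [] → l' ≠ [] → l.length ≤ n → l'.length ≤ n →
      (Relation.TransGen (IsChild p) (φ l) (φ l') ↔ l <+: l' ∧ l ≠ l') := by
    intro l l' hl hl' hn hn'
    rw [hp.transGen_iff, hφ l hl hn, hφ l' hl' hn', h2 l l' (by omega) (by omega)]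
    refine and_congr Iff.rfl (not_congr ⟨inj l l' hl hl' hn hn', fun h => by rw [h]⟩)
  refine ⟨φ, ⟨inj, fun l d hl hn => ?_, fun l d z hl hn hz hzn h _ => ?_⟩⟩
  · refine (key _ _ hl (by simp) (by omega) (by simpa using hn)).2 ⟨List.prefix_append _ _, ?_⟩
    simp
  · obtain ⟨h3, h4⟩ := (key _ _ hl hz (by omega) hzn).1 h
    refine lt_of_le_of_ne h3.length_le fun h5 => h4 (h3.eq_of_length h5)

end Marking

/-! ### The dichotomy for structures -/

section Gaifman

variable {L : FirstOrder.Language.{0, 0}} {A : FinStr L}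

/-- Two elements belong to a common tuple. -/
def gaifman (A : FinStr L) (a b : A) : Prop :=
  ∃ (c : Tuples A) (i j : Fin c.1.1), c.1.2 i = a ∧ c.1.2 j = b

theorem exists_prefix_of_comparable {β : Type*} {k : ℕ} (f : Fin k → List β) (hk : 0 < k)
    (h : ∀ i j, f i <+: f j ∨ f j <+: f i) : ∃ j, ∀ i, f i <+: f j := by
  have : Nonempty (Fin k) := ⟨⟨0, hk⟩⟩
  obtain ⟨j, hj⟩ := Finite.exists_max fun i => (f i).length
  refine ⟨j, fun i => (h i j).elim id fun h' => ?_⟩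
  rw [h'.eq_of_length_le (hj i)]

/-- A structure is either mapped to a tree of height `n`, or `m^{<n+1}` can be marked in it. -/
theorem exists_marking_or_treeMap [Nonempty A] (m n : ℕ) :
    (∃ (S : A → A → Prop) (φ : List (Fin m) → A), (∀ a b, S a b → gaifman A a b) ∧
      (∀ a b c, S a c → S b c → a = b) ∧ Marking S m n φ) ∨
    ∃ (m' : ℕ) (h : A → List (Fin m')), TreeMap A m' n (fibreBound m ((m + 1) ^ n)) h := by
  obtain ⟨p, hp, hnormal⟩ := exists_normal_forest (gaifman A)
    fun a b ⟨c, i, j, h1, h2⟩ => ⟨c, j, i, h2, h1⟩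
  have huniq : ∀ a b c, IsChild p a c → IsChild p b c → a = b := fun a b c h1 h2 =>
    hp.injective (List.append_inj' (h1.symm.trans h2) rfl).1
  -- The bound plays two roles: a path this long accommodates a marking, and without one the forest
  -- has bounded height.
  by_cases hpath : ∃ a, (m + 1) ^ n ≤ (p a).length
  · obtain ⟨a, ha⟩ := hpath
    obtain ⟨φ, hφ⟩ := hp.marking_of_path ha
    exact Or.inl ⟨_, φ, fun _ _ => hp.adj_of_isChild, huniq, hφ⟩
  · push Not at hpath
    have hfin : (forestDomain p).Finite := (Set.finite_range p).insert _
    rcases treeEmb_or_map hfin hp.forestDomain_closed m ((m + 1) ^ n) [] (n + 1) (Or.inl rfl)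
      (fun x hx _ => by
        rcases hx with rfl | ⟨a, rfl⟩
        · simp
        · simpa using (hpath a).le) with h | ⟨g, h1, h2, h3⟩
    · obtain ⟨φ, hφ⟩ := hp.marking_of_treeEmb h
      exact Or.inl ⟨_, φ, fun _ _ => hp.adj_of_isChild, huniq, hφ⟩
    · right
      have hmem (a : A) : p a ∈ forestDomain p := Or.inr ⟨a, rfl⟩
      -- `g` uses elements of `A` as letters, which are renumbered. The branching is not controlled,
      -- only the height and the fibres.
      let e : A ≃ Fin (Nat.card A) := Finite.equivFin A
      have hlen (a : A) : ((g (p a)).map e).length < n := by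
        simpa using h1 _ (hmem a) List.nil_prefix
      refine ⟨Nat.card A, fun a => (g (p a)).map e, hlen, fun u => ?_, fun k R c hc => ?_⟩
      · refine le_trans ?_ (h3 (u.map e.symm))
        refine Set.ncard_le_ncard_of_injOn p ?_ hp.injective.injOn
          (hfin.subset fun x hx => hx.1)
        intro a ha
        have ha : (g (p a)).map e = u := ha
        exact ⟨hmem a, List.nil_prefix, by rw [← ha]; simp⟩
      · rcases Nat.eq_zero_or_pos k with rfl | hk
        · exact ⟨[], by simpa using (Nat.zero_le _).trans_lt (hlen (Classical.arbitrary A)),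
            fun i => i.elim0⟩
        -- The entries of a tuple are pairwise adjacent, hence lie on one branch of the normal
        -- forest; the deepest is below all others, and `g` is monotone.
        · obtain ⟨j, hj⟩ := exists_prefix_of_comparable (fun i => p (c i)) hk
            fun i j => hnormal _ _ ⟨⟨⟨k, c⟩, R, hc⟩, i, j, rfl, rfl⟩
          exact ⟨_, hlen (c j), fun i => (h2 _ _ (hmem _) (hmem _) List.nil_prefix (hj i)).map e⟩

end Gaifman

end MSOTrans

/-! ### Producing complete trees from structures with a marking. -/

namespace MSOTrans

open FirstOrder

/-! ### The incidence structures of complete trees -/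

section CompleteTree

variable {m n : ℕ}

theorem arity_eq_two (c : Tuples (completeTree m n)) : c.1.1 = 2 := by
  obtain ⟨⟨k, c⟩, R, hR⟩ := c
  cases R; rfl

/-- The endpoints of an edge. -/
def edgeEnd (c : Tuples (completeTree m n)) (i : Fin 2) : completeTree m n :=
  c.1.2 (Fin.cast (arity_eq_two c).symm i)

theorem edgeEnd_one (c : Tuples (completeTree m n)) :
    ∃ d, (edgeEnd c 1).1 = (edgeEnd c 0).1 ++ [d] := by
  obtain ⟨⟨k, c⟩, R, hR⟩ := c
  cases R
  exact hR

/-- The lower end of an edge determines its upper end, so edges can be identified with non-root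
vertices. -/
theorem edgeEnd_one_injective :
    Function.Injective fun c : Tuples (completeTree m n) => edgeEnd c 1 := by
  intro c c' h
  obtain ⟨d, hd⟩ := edgeEnd_one c
  obtain ⟨d', hd'⟩ := edgeEnd_one c'
  dsimp only at h
  rw [h, hd'] at hd
  have h0 : edgeEnd c' 0 = edgeEnd c 0 := Subtype.ext (List.append_inj' hd rfl).1
  obtain ⟨⟨k, c⟩, R, hR⟩ := c
  obtain ⟨⟨k', c'⟩, R', hR'⟩ := c'
  cases R
  cases R'
  refine Subtype.ext (Sigma.ext rfl (heq_of_eq (funext fun i => ?_)))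
  fin_cases i
  · exact h0.symm
  · exact h

theorem exists_edge {w : completeTree m n} (hw : w.1 ≠ []) :
    ∃ c : Tuples (completeTree m n), edgeEnd c 1 = w := by
  obtain ⟨w, hn⟩ := w
  induction w using List.reverseRecOn with
  | nil => exact absurd rfl hw
  | append_singleton u d _ =>
    have hu : u.length < n := by simp at hn; omega
    have hR : FirstOrder.Language.Structure.RelMap (L := FirstOrder.Language.graph)
      FirstOrder.Language.adj (![⟨u, hu⟩, ⟨u ++ [d], hn⟩] : Fin 2 → completeTree m n) := ⟨d, rfl⟩
    exact ⟨⟨⟨2, _⟩, _, hR⟩, rfl⟩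

theorem relMap_inc {i : ℕ} (hi' : i < 2)
    (hi : ∃ r, i < r ∧ Nonempty (FirstOrder.Language.graph.Relations r))
    (x : Fin 2 → incidence (completeTree m n)) :
    FirstOrder.Language.Structure.RelMap (L := incLang FirstOrder.Language.graph)
      (IncRel.inc i hi) x ↔ ∃ c, x 0 = Sum.inl (edgeEnd c ⟨i, hi'⟩) ∧ x 1 = Sum.inr c := by
  constructor
  · rintro ⟨c, _, h0, h1⟩
    exact ⟨c, h0, h1⟩
  · rintro ⟨c, h0, h1⟩
    exact ⟨c, by rw [arity_eq_two]; exact hi', h0, h1⟩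

theorem relMap_P (x : Fin 1 → incidence (completeTree m n)) :
    FirstOrder.Language.Structure.RelMap (L := incLang FirstOrder.Language.graph)
      (IncRel.P FirstOrder.Language.adj) x ↔ ∃ c, x 0 = Sum.inr c := by
  constructor
  · rintro ⟨c, h, h0⟩
    exact ⟨_, h0⟩
  · rintro ⟨⟨⟨k, c⟩, R, hR⟩, h0⟩
    cases R
    exact ⟨c, hR, h0⟩

end CompleteTree

/-! ### Interpreting trees in structures with a marking -/

section Uniqueness

variable {α : Type*} {S : α → α → Prop}

/-- With unique parents, the strict ancestors of a vertex form a chain. -/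
theorem transGen_total (hS : ∀ a b c, S a c → S b c → a = b) {a b c : α}
    (ha : Relation.TransGen S a c) (hb : Relation.TransGen S b c) :
    a = b ∨ Relation.TransGen S a b ∨ Relation.TransGen S b a := by
  induction ha with
  | single h =>
    obtain ⟨d, hd, hdc⟩ := Relation.TransGen.tail'_iff.1 hb
    obtain rfl := hS _ _ _ hdc h
    rcases Relation.reflTransGen_iff_eq_or_transGen.1 hd with h | h
    · exact Or.inl h
    · exact Or.inr (Or.inr h)
  | tail h1 h2 ih =>
    obtain ⟨d, hd, hdc⟩ := Relation.TransGen.tail'_iff.1 hb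
    obtain rfl := hS _ _ _ hdc h2
    rcases Relation.reflTransGen_iff_eq_or_transGen.1 hd with h | h
    · exact Or.inr (Or.inl (h ▸ h1))
    · exact ih h

/-- Let `u` be the true parent of `w` and `v` a candidate on the same level. Both precede `w`, so
they are comparable. If `v` comes before `u`, then `u` is a marked vertex of forbidden level in
between; if `u` comes before `v`, the level condition of the marking puts `v` on a deeper level than
`u`. Hence `u = v`. -/
theorem Marking.child_iff {m n : ℕ} {φ : List (Fin m) → α} (hS : ∀ a b c, S a c → S b c → a = b)
    (H : Marking S m n φ) {v w : List (Fin m)} (hv : v ≠ []) (hw : w ≠ []) (hvn : v.length ≤ n)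
    (hwn : w.length ≤ n) :
    (w.length = v.length + 1 ∧ Relation.TransGen S (φ v) (φ w) ∧ ¬ ∃ z, (Relation.TransGen S (φ v) z ∧
      ∃ l, l ≠ [] ∧ l.length ≤ v.length ∧ φ l = z) ∧ Relation.TransGen S z (φ w)) ↔
    ∃ d, w = v ++ [d] := by
  constructor
  · rintro ⟨hl, h1, h2⟩
    induction w using List.reverseRecOn with
    | nil => exact absurd rfl hw
    | append_singleton u d _ =>
      have hl' : u.length = v.length := by simpa using hl
      have hn : u.length + 1 ≤ n := by simpa using hwn
      have hu : u ≠ [] := by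
        rw [← List.length_pos_iff] at *; omega
      rcases transGen_total hS h1 (H.transGen u d hu hn) with h | h | h
      · exact ⟨d, by rw [H.inj v u hv hu hvn (by omega) h]⟩
      · exact absurd ⟨φ u, ⟨h, u, hu, hl'.le, rfl⟩, H.transGen u d hu hn⟩ h2
      · have := H.length_lt u d v hu hn hv hvn h h1
        omega
  · rintro ⟨d, rfl⟩
    have hn : v.length + 1 ≤ n := by simpa using hwn
    refine ⟨by simp, H.transGen v d hv hn, ?_⟩
    rintro ⟨_, ⟨h1, l, hl, hlv, rfl⟩, h2⟩
    have := H.length_lt v d l hv hn hl (by omega) h1 h2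
    omega

end Uniqueness

section MarkingTransduction

variable {L : FirstOrder.Language.{0, 0}}

/-- The positions in tuples. -/
abbrev Coord (L : FirstOrder.Language.{0, 0}) : Type :=
  {i : ℕ // ∃ r, i < r ∧ Nonempty (L.Relations r)}

instance [Finite (Σ k, L.Relations k)] : Finite (Coord L) := by
  obtain ⟨r, hr⟩ := exists_arity_bound L
  exact Finite.of_injective (fun i : Coord L => (⟨i.1, by
    obtain ⟨k, h1, h2⟩ := i.2
    exact h1.trans_le (hr k h2)⟩ : Fin r)) fun i j h => Subtype.ext (Fin.mk.inj h)

/-- The parameters of the transduction: labels of tuples, levels of vertices, and the root. -/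
abbrev MarkParam (L : FirstOrder.Language.{0, 0}) (n : ℕ) : Type :=
  (Coord L × Coord L) ⊕ (Fin (n + 1) ⊕ Unit)

/-- The relation coded by the labels of tuples. -/
def labelRel (B : FinStr (incLang L)) (Q : Coord L × Coord L → Set B) (x y : B) : Prop :=
  ∃ (i j : Coord L) (e : B), (FirstOrder.Language.Structure.RelMap (L := incLang L)
    (IncRel.inc i.1 i.2) ![x, e] ∧ e ∈ Q (i, j)) ∧
    FirstOrder.Language.Structure.RelMap (L := incLang L) (IncRel.inc j.1 j.2) ![y, e]

/-- The relation between a marked vertex and its children. -/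
def markChild {α : Type*} (S : α → α → Prop) {n : ℕ} (lev : Fin (n + 1) → Set α) (x y : α) : Prop :=
  ∃ i : Fin n, (x ∈ lev i.castSucc ∧ y ∈ lev i.succ) ∧ Relation.TransGen S x y ∧
    ¬ ∃ z, (Relation.TransGen S x z ∧ ∃ j : Fin (n + 1), j.1 ≤ i.1 ∧ z ∈ lev j) ∧
      Relation.TransGen S z y

theorem cdef2_labelRel [L.IsRelational] [Finite (Σ k, L.Relations k)] {k p : ℕ} (hk : 2 ≤ k) (e : Coord L × Coord L → Fin p) :
    CDef2 (L := incLang L) (k := k) (m := p) fun B Q x y => labelRel B (fun c => Q (e c)) x.1 y.1 :=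
  Def2.exists fun i => Def2.exists fun j => CDef2.comp_base
    (S := fun _ Q x z => FirstOrder.Language.Structure.RelMap (L := incLang L)
      (IncRel.inc i.1 i.2) ![x, z] ∧ z ∈ Q (e (i, j)))
    (S' := fun _ _ z y => FirstOrder.Language.Structure.RelMap (L := incLang L)
      (IncRel.inc j.1 j.2) ![y, z])
    ((cdef2_rel hk _).and (cdef1_colour _).snd)
    (Def2.swap (cdef2_rel (L := incLang L) hk (IncRel.inc j.1 j.2)))

theorem cdef2_markChild {k p n : ℕ} (e : Fin (n + 1) → Fin p)
    {S : ∀ (B : FinStr (incLang L)) (_ : Fin p → Set B), B → B → Prop}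
    (hS : CDef2 (k := k) fun B Q x y => S B Q x.1 y.1) :
    CDef2 (L := incLang L) (k := k) (m := p)
      fun B Q x y => markChild (S B Q) (fun i => Q (e i)) x.1 y.1 :=
  Def2.exists fun i => ((cdef1_colour _).fst.and (cdef1_colour _).snd).and
    ((CDef2.transGen_base hS).and (Def2.not (CDef2.comp_base
      (S := fun B Q x z => Relation.TransGen (S B Q) x z ∧
        ∃ j : Fin (n + 1), j.1 ≤ i.1 ∧ z ∈ Q (e j))
      (S' := fun B Q z y => Relation.TransGen (S B Q) z y)
      ((CDef2.transGen_base hS).and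
        (Def1.snd (Def1.exists fun _ => Def1.const_and _ (cdef1_colour _))))
      (CDef2.transGen_base hS))))

/-- Three copies: non-root vertices live in copy `0`, edges, coded by their lower ends, in copy `1`,
and the root alone in copy `2`. The root is separate because a marking says nothing about `φ []`,
which may coincide with another marked element. The levels are parameters; edges leaving the root
are those whose lower end has level one, and the other upper ends are found by `Marking.child_iff`.
-/
theorem exists_transduction_of_marking (L : FirstOrder.Language.{0, 0}) [L.IsRelational]
    [Finite (Σ k, L.Relations k)] (n : ℕ) :
    ∃ τ : Transduction (incLang L) (incLang FirstOrder.Language.graph),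
      ∀ (A : FinStr L) (m : ℕ) (S : incidence A → incidence A → Prop)
        (φ : List (Fin m) → incidence A),
        (∀ x y, S x y → ∃ a b, x = Sum.inl a ∧ y = Sum.inl b ∧ gaifman A a b) →
        (∀ a b c, S a c → S b c → a = b) → Marking S m n φ →
        incidence (completeTree m (n + 1)) ∈ τ.image (incidence A) := by
  let Pm := MarkParam L n
  let eP : Pm ≃ Fin (Nat.card Pm) := Finite.equivFin Pm
  let eT : Coord L × Coord L → Fin (Nat.card Pm) := fun c => eP (Sum.inl c)
  let eL : Fin (n + 1) → Fin (Nat.card Pm) := fun i => eP (Sum.inr (Sum.inl i))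
  let eR : Fin (Nat.card Pm) := eP (Sum.inr (Sum.inr ()))
  have hk : 2 ≤ 3 := by omega
  have hcopy (c : Fin 3) : CDef1 (L := incLang L) (m := Nat.card Pm)
      fun _ _ x => x.2 = c := cdef1_copy hk _
  have hlev : CDef1 (L := incLang L) (k := 3) fun _ Q x => ∃ i, x.1 ∈ Q (eL i) :=
    Def1.exists fun i => cdef1_colour _
  obtain ⟨τ, hτ⟩ := exists_transduction (L := incLang L) (L' := FirstOrder.Language.graph) (k := 3)
    (m := Nat.card Pm) (by omega)
    (δ := fun B Q x => ((x.2 = 0 ∨ x.2 = 1) ∧ ∃ i, x.1 ∈ Q (eL i)) ∨ (x.2 = 2 ∧ x.1 ∈ Q eR))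
    ((((hcopy 0).or (hcopy 1)).and hlev).or ((hcopy 2).and (cdef1_colour _)))
    (PR := fun _ _ _ x => x.2 = 1) (fun _ => hcopy 1)
    (IN := fun i B Q x y => (i = 0 ∧ y.2 = 1 ∧ ((x.2 = 0 ∧
        markChild (labelRel B fun c => Q (eT c)) (fun i => Q (eL i)) x.1 y.1) ∨
        (x.2 = 2 ∧ ∃ i : Fin (n + 1), i.1 = 1 ∧ y.1 ∈ Q (eL i)))) ∨
      (i = 1 ∧ y.2 = 1 ∧ x.2 = 0 ∧ x.1 = y.1))
    (fun i => Def2.or (Def2.const_and _ ((hcopy 1).snd.and (Def2.or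
        ((hcopy 0).fst.and (cdef2_markChild eL (cdef2_labelRel hk eT)))
        ((hcopy 2).fst.and (Def1.snd (Def1.exists fun i =>
          Def1.const_and _ (cdef1_colour _)))))))
      (Def2.const_and _ ((hcopy 1).snd.and ((hcopy 0).fst.and (cdef2_sim hk)))))
  refine ⟨τ, fun A m S φ hSg hSu H => ?_⟩
  let lev : Fin (n + 1) → Set (incidence A) := fun i =>
    {x | ∃ l : List (Fin m), l ≠ [] ∧ l.length = i.1 ∧ φ l = x}
  -- A tuple gets label `(i, j)` if its entries `i` and `j` are related by `S`. Every related pair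
  -- shares a tuple, so these labels code `S` exactly; this is where having tuples as elements is
  -- used.
  let Q : Fin (Nat.card Pm) → Set (incidence A) := fun q => match eP.symm q with
    | Sum.inl (i, j) => {x | ∃ (c : Tuples A) (hi : i.1 < c.1.1) (hj : j.1 < c.1.1), x = Sum.inr c ∧
        S (Sum.inl (c.1.2 ⟨i, hi⟩)) (Sum.inl (c.1.2 ⟨j, hj⟩))}
    | Sum.inr (Sum.inl i) => lev i
    | Sum.inr (Sum.inr _) => {φ []}
  have hQL (i : Fin (n + 1)) : Q (eL i) = lev i := by simp [Q, eL]
  have hQR : Q eR = {φ []} := by simp [Q, eR]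
  have hQT (i j : Coord L) (x : incidence A) : x ∈ Q (eT (i, j)) ↔ ∃ (c : Tuples A)
      (hi : i.1 < c.1.1) (hj : j.1 < c.1.1), x = Sum.inr c ∧
        S (Sum.inl (c.1.2 ⟨i, hi⟩)) (Sum.inl (c.1.2 ⟨j, hj⟩)) := by
    simp only [Q, eT, Equiv.symm_apply_apply]; rfl
  have hS : (labelRel (incidence A) fun c => Q (eT c)) = S := by
    funext x y
    refine propext ⟨?_, fun h => ?_⟩
    · rintro ⟨i, j, e, ⟨⟨c1, h1, hx, hc1⟩, he⟩, ⟨c2, h2, hy, hc2⟩⟩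
      obtain ⟨c, hi, hj, rfl, hS⟩ := (hQT i j e).1 he
      obtain rfl : c = c1 := Sum.inr.inj hc1
      obtain rfl : c = c2 := Sum.inr.inj hc2
      have hx : x = _ := hx
      have hy : y = _ := hy
      rw [hx, hy]; exact hS
    · obtain ⟨a, b, rfl, rfl, c, i, j, rfl, rfl⟩ := hSg x y h
      have hc : Nonempty (L.Relations c.1.1) := ⟨c.2.choose⟩
      exact ⟨⟨i.1, _, i.2, hc⟩, ⟨j.1, _, j.2, hc⟩, Sum.inr c, ⟨⟨c, i.2, rfl, rfl⟩,
        (hQT _ _ _).2 ⟨c, i.2, j.2, rfl, h⟩⟩, ⟨c, j.2, rfl, rfl⟩⟩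
  have hlevφ {l : List (Fin m)} (hl : l ≠ []) (hn : l.length ≤ n) (i : Fin (n + 1)) :
      φ l ∈ lev i ↔ l.length = i.1 := by
    constructor
    · rintro ⟨l', hl', hli, h⟩
      rw [← H.inj l' l hl' hl (by omega) hn h, hli]
    · exact fun h => ⟨l, hl, h, rfl⟩
  have hchild {v w : List (Fin m)} (hv : v ≠ []) (hw : w ≠ []) (hvn : v.length ≤ n)
      (hwn : w.length ≤ n) : markChild S lev (φ v) (φ w) ↔ ∃ d, w = v ++ [d] := by
    have hlow (i : ℕ) (hi : i < n) (z : incidence A) : (∃ j : Fin (n + 1), j.1 ≤ i ∧ z ∈ lev j) ↔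
        ∃ l, l ≠ [] ∧ l.length ≤ i ∧ φ l = z := by
      constructor
      · rintro ⟨j, hj, l, hl, hlj, h⟩
        exact ⟨l, hl, by omega, h⟩
      · rintro ⟨l, hl, hli, h⟩
        exact ⟨⟨l.length, by omega⟩, hli, l, hl, rfl, h⟩
    rw [← H.child_iff hSu hv hw hvn hwn]
    constructor
    · rintro ⟨i, ⟨h1, h2⟩, h3, h4⟩
      rw [hlevφ hv hvn] at h1
      rw [hlevφ hw hwn] at h2
      simp only [hlow i.1 i.2] at h4
      rw [Fin.val_castSucc] at h1
      rw [Fin.val_succ] at h2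
      rw [h1]
      exact ⟨h2, h3, h4⟩
    · rintro ⟨h1, h2, h3⟩
      refine ⟨⟨v.length, by omega⟩, ⟨(hlevφ hv hvn _).2 rfl, (hlevφ hw hwn _).2 h1⟩, h2, ?_⟩
      simp only [hlow v.length (by omega)]
      exact h3
  have hlen (v : completeTree m (n + 1)) : v.1.length ≤ n := Nat.lt_succ_iff.1 v.2
  have hne (c : Tuples (completeTree m (n + 1))) : (edgeEnd c 1).1 ≠ [] := by
    obtain ⟨d, hd⟩ := edgeEnd_one c
    rw [hd]; simp
  let enc : incidence (completeTree m (n + 1)) → incidence A × Fin 3 := Sum.elim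
    (fun v => if v.1 = [] then (φ [], 2) else (φ v.1, 0)) (fun c => (φ (edgeEnd c 1).1, 1))
  have encr (c) : enc (Sum.inr c) = (φ (edgeEnd c 1).1, 1) := rfl
  have encl0 (v : completeTree m (n + 1)) (hv : v.1 = []) : enc (Sum.inl v) = (φ [], 2) := if_pos hv
  have encl (v : completeTree m (n + 1)) (hv : v.1 ≠ []) : enc (Sum.inl v) = (φ v.1, 0) := if_neg hv
  have hinj : Function.Injective enc := by
    rintro (v | c) (w | d) h
    · by_cases hv : v.1 = [] <;> by_cases hw : w.1 = []
      · exact congrArg _ (Subtype.ext (hv.trans hw.symm))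
      · rw [encl0 v hv, encl w hw] at h; simp at h
      · rw [encl v hv, encl0 w hw] at h; simp at h
      · rw [encl v hv, encl w hw] at h
        exact congrArg _ (Subtype.ext (H.inj _ _ hv hw (hlen v) (hlen w) (Prod.mk.inj h).1))
    · by_cases hv : v.1 = []
      · rw [encl0 v hv, encr] at h; simp at h
      · rw [encl v hv, encr] at h; simp at h
    · by_cases hw : w.1 = []
      · rw [encl0 w hw, encr] at h; simp at h
      · rw [encl w hw, encr] at h; simp at h
    · rw [encr, encr] at h
      exact congrArg _ (edgeEnd_one_injective (Subtype.ext
        (H.inj _ _ (hne c) (hne d) (hlen _) (hlen _) (Prod.mk.inj h).1)))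
  have hdom (x : incidence A × Fin 3) : (∃ y, enc y = x) ↔
      ((x.2 = 0 ∨ x.2 = 1) ∧ ∃ i, x.1 ∈ Q (eL i)) ∨ (x.2 = 2 ∧ x.1 ∈ Q eR) := by
    simp only [hQL, hQR]
    constructor
    · rintro ⟨v | c, rfl⟩
      · by_cases hv : v.1 = []
        · rw [encl0 v hv]; exact Or.inr ⟨rfl, rfl⟩
        · rw [encl v hv]
          exact Or.inl ⟨Or.inl rfl, ⟨v.1.length, v.2⟩, (hlevφ hv (hlen v) _).2 rfl⟩
      · rw [encr]
        exact Or.inl ⟨Or.inr rfl, ⟨_, (edgeEnd c 1).2⟩, (hlevφ (hne c) (hlen _) _).2 rfl⟩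
    · obtain ⟨x, c⟩ := x
      rintro (⟨hc, i, l, hl, hli, rfl⟩ | ⟨rfl, hx⟩)
      · let v : completeTree m (n + 1) := ⟨l, by rw [hli]; exact i.2⟩
        rcases hc with rfl | rfl
        · exact ⟨Sum.inl v, encl v hl⟩
        · obtain ⟨c, hc⟩ := exists_edge (w := v) hl
          exact ⟨Sum.inr c, by rw [encr, hc]⟩
      · have hx : x = φ [] := hx
        subst hx
        exact ⟨Sum.inl ⟨[], Nat.succ_pos n⟩, encl0 _ rfl⟩
  refine hτ _ Q _ ((Equiv.ofInjective enc hinj).trans (Equiv.subtypeEquivRight hdom))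
    (fun {r} R x => ?_) (fun i hi x => ?_)
  · cases R
    rw [relMap_P]
    change _ ↔ (enc (x 0)).2 = 1
    rcases hx : x 0 with v | c
    · by_cases hv : v.1 = []
      · rw [encl0 v hv]; simp
      · rw [encl v hv]; simp
    · rw [encr]; exact ⟨fun _ => rfl, fun _ => ⟨c, rfl⟩⟩
  · have hi' : i < 2 := by
      obtain ⟨r, hr, ⟨R⟩⟩ := hi
      cases R; exact hr
    rw [relMap_inc hi']
    change _ ↔ (i = 0 ∧ (enc (x 1)).2 = 1 ∧ (((enc (x 0)).2 = 0 ∧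
        markChild (labelRel _ fun c => Q (eT c)) (fun i => Q (eL i)) (enc (x 0)).1 (enc (x 1)).1) ∨
        ((enc (x 0)).2 = 2 ∧ ∃ i : Fin (n + 1), i.1 = 1 ∧ (enc (x 1)).1 ∈ Q (eL i)))) ∨
      (i = 1 ∧ (enc (x 1)).2 = 1 ∧ (enc (x 0)).2 = 0 ∧ (enc (x 0)).1 = (enc (x 1)).1)
    simp only [hQL, hS]
    rcases hx1 : x 1 with w | c
    · have h1 : (enc (Sum.inl w)).2 ≠ 1 := by
        by_cases hw : w.1 = []
        · rw [encl0 w hw]; simp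
        · rw [encl w hw]; simp
      simp [h1]
    rw [encr]
    obtain ⟨d, hd⟩ := edgeEnd_one c
    rcases hx0 : x 0 with v | c'
    swap
    · rw [encr]; simp
    have hsucc : (∃ i : Fin (n + 1), i.1 = 1 ∧ φ (edgeEnd c 1).1 ∈ lev i) ↔
        (edgeEnd c 0).1 = [] := by
      simp only [hlevφ (hne c) (hlen _)]
      rw [hd]
      constructor
      · rintro ⟨i, h1, h2⟩
        rw [h1] at h2; simpa using h2
      · intro h
        have := (edgeEnd c 1).2
        rw [hd, h] at this
        exact ⟨⟨1, this⟩, rfl, by simp [h]⟩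
    have hl : (∃ c', (Sum.inl v : completeTree m (n + 1) ⊕ Tuples (completeTree m (n + 1))) =
        Sum.inl (edgeEnd c' ⟨i, hi'⟩) ∧ (Sum.inr c : completeTree m (n + 1) ⊕
          Tuples (completeTree m (n + 1))) = Sum.inr c') ↔ v = edgeEnd c ⟨i, hi'⟩ := by
      constructor
      · rintro ⟨c', h1, h2⟩
        rw [Sum.inr.inj h2]; exact Sum.inl.inj h1
      · rintro h; exact ⟨c, congrArg _ h, rfl⟩
    refine Iff.trans hl ?_
    obtain rfl | rfl : i = 0 ∨ i = 1 := by omega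
    · by_cases hv : v.1 = []
      · rw [encl0 v hv]
        simp only [hsucc]
        simp only [true_and, zero_ne_one, false_and, or_false]
        constructor
        · intro h
          exact Or.inr (by rw [← hv, h]; rfl)
        · rintro (⟨h, -⟩ | h)
          · simp at h
          · exact Subtype.ext (hv.trans h.symm)
      · rw [encl v hv]
        simp only [hchild hv (hne c) (hlen v) (hlen _)]
        simp only [true_and, zero_ne_one, false_and, or_false]
        constructor
        · intro h
          exact Or.inl ⟨d, by rw [hd, h]; rfl⟩
        · rintro (⟨d', h⟩ | ⟨h, -⟩)
          · rw [hd] at h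
            exact Subtype.ext (List.append_inj' h rfl).1.symm
          · simp at h
    · by_cases hv : v.1 = []
      · rw [encl0 v hv]
        simp only [one_ne_zero, false_and, false_or]
        constructor
        · intro h
          exact absurd (by rw [← hv, h]; rfl) (hne c)
        · rintro ⟨-, -, h, -⟩
          simp at h
      · rw [encl v hv]
        simp only [one_ne_zero, false_and, true_and, false_or]
        constructor
        · intro h
          rw [h]; rfl
        · intro h
          exact Subtype.ext (H.inj _ _ hv (hne c) (hlen v) (hlen _) h)

end MarkingTransduction

end MSOTrans

/-! ### Types of labelled trees that count children up to a threshold. -/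

namespace MSOTrans

/-! ### Counting fibres up to a threshold -/

section Threshold

variable {I I' S S' : Type*} [Finite I] [Finite I']

theorem card_fibre_comp [Fintype S] [DecidableEq S'] (f : I → S) (G : S → S') (t : S') :
    Nat.card {i // G (f i) = t} = ∑ s with G s = t, Nat.card {i // f i = s} := by
  classical
  have := Fintype.ofFinite I
  rw [Nat.subtype_card (Finset.univ.filter fun i => G (f i) = t) (by simp)]
  rw [Finset.card_eq_sum_card_fiberwise (f := f) (t := Finset.univ.filter fun s => G s = t)
    (by intro i; simp)]
  refine Finset.sum_congr rfl fun s hs => ?_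
  rw [Nat.subtype_card (Finset.univ.filter fun i => f i = s) (by simp)]
  congr 1
  ext i
  simp only [Finset.mem_filter, Finset.mem_univ, true_and] at hs ⊢
  exact ⟨fun h => h.2, fun h => ⟨by rw [h, hs], h⟩⟩

/-- A fibre of `G ∘ f` is a union of fibres of `f`, and truncated summands determine the truncated
sum. -/
theorem min_card_fibre_comp [Finite S] {M M' : ℕ} (hM : M ≤ M') (f : I → S) (f' : I' → S)
    (h : ∀ s, min M' (Nat.card {i // f i = s}) = min M' (Nat.card {i // f' i = s})) (G : S → S')
    (t : S') : min M (Nat.card {i // G (f i) = t}) = min M (Nat.card {i // G (f' i) = t}) := by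
  classical
  have := Fintype.ofFinite S
  rw [card_fibre_comp f, card_fibre_comp f']
  induction (Finset.univ.filter fun s => G s = t) using Finset.induction_on with
  | empty => rfl
  | insert a s ha ih =>
    rw [Finset.sum_insert ha, Finset.sum_insert ha]
    have := h a
    omega

/-- If the two sets differ in size, both have more than `M * Nat.card S` elements, so some colour
`s0` is used more than `M` times. In the second set every other colour gets its number of uses cut
off at `M`, and `s0` absorbs the rest, which still exceeds `M`. -/
theorem exists_fibres_of_min_card_eq [Finite S] {M M' : ℕ} (hM : M * Nat.card S + 1 ≤ M')
    (h : min M' (Nat.card I) = min M' (Nat.card I')) (ρ : I → S) :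
    ∃ ρ' : I' → S, (∀ i', ∃ i, ρ i = ρ' i') ∧
      ∀ s, min M (Nat.card {i // ρ i = s}) = min M (Nat.card {i // ρ' i = s}) := by
  classical
  have := Fintype.ofFinite I
  have := Fintype.ofFinite I'
  have := Fintype.ofFinite S
  by_cases hI : Nat.card I = Nat.card I'
  · obtain ⟨e⟩ : Nonempty (I' ≃ I) := Finite.card_eq.1 hI.symm
    exact ⟨ρ ∘ e, fun i' => ⟨e i', rfl⟩, fun s => congrArg _ (Nat.card_congr
      (e.subtypeEquiv fun _ => Iff.rfl).symm)⟩
  have h1 : M' ≤ Nat.card I := by omega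
  have h2 : M' ≤ Nat.card I' := by omega
  let c : S → ℕ := fun s => Nat.card {i // ρ i = s}
  obtain ⟨s0, hs0⟩ : ∃ s0, M < c s0 := by
    obtain ⟨s0, hs0⟩ := Fintype.exists_lt_card_fiber_of_mul_lt_card (f := ρ) (n := M) (by
      rw [← Nat.card_eq_fintype_card, ← Nat.card_eq_fintype_card, mul_comm]; omega)
    refine ⟨s0, ?_⟩
    simp only [c]
    rwa [Nat.subtype_card (Finset.univ.filter fun i => ρ i = s0) (by simp)]
  have hsum : ∑ s ∈ Finset.univ.erase s0, min M (c s) + M ≤ M * Nat.card S := by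
    have h3 : ∑ s ∈ Finset.univ.erase s0, min M (c s) ≤ (Finset.univ.erase s0).card * M :=
      Finset.sum_le_card_nsmul _ _ M fun s _ => min_le_left _ _
    have h4 : (Finset.univ.erase s0).card + 1 = Nat.card S := by
      rw [Finset.card_erase_add_one (Finset.mem_univ s0), Nat.card_eq_fintype_card,
        Finset.card_univ]
    rw [← h4, mul_add, mul_one, mul_comm M]
    omega
  let g : S → ℕ := fun s => if s = s0 then
    Nat.card I' - ∑ s ∈ Finset.univ.erase s0, min M (c s) else min M (c s)
  have hg0 : g s0 = Nat.card I' - ∑ s ∈ Finset.univ.erase s0, min M (c s) := if_pos rfl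
  have hg (s : S) (hs : s ≠ s0) : g s = min M (c s) := if_neg hs
  have hgsum : ∑ s, g s = Nat.card I' := by
    rw [← Finset.add_sum_erase _ _ (Finset.mem_univ s0), hg0,
      Finset.sum_congr rfl fun s hs => hg s (Finset.ne_of_mem_erase hs)]
    omega
  obtain ⟨e⟩ : Nonempty (I' ≃ Σ s, Fin (g s)) := Finite.card_eq.1 (by
    rw [← hgsum, Nat.card_eq_fintype_card]; simp)
  have hcard (s : S) : Nat.card {i // (e i).1 = s} = g s := by
    rw [Nat.card_congr (e.subtypeEquiv (p := fun i => (e i).1 = s) (q := fun x => x.1 = s)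
      fun _ => Iff.rfl), Nat.card_congr (Equiv.sigmaSubtype s)]
    simp
  refine ⟨fun i => (e i).1, fun i' => ?_, fun s => ?_⟩
  · have hpos : 0 < c (e i').1 := by
      by_cases hs : (e i').1 = s0
      · rw [hs]; omega
      · have h3 := (e i').2.2
        have h4 := hg _ hs
        omega
    obtain ⟨⟨i, hi⟩⟩ := (Nat.card_pos_iff.1 hpos).1
    exact ⟨i, hi⟩
  · rw [hcard]
    by_cases hs : s = s0
    · subst hs
      rw [hg0]
      change min M (c s) = _
      omega
    · rw [hg s hs]
      change min M (c s) = _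
      omega

/-- The one-fibre statement is applied in each fibre of `f` and the resulting colourings are glued.
-/
theorem exists_refinement [Finite S] [Finite S'] {M M' : ℕ} (hM : M * Nat.card S' + 1 ≤ M')
    (f : I → S) (f' : I' → S)
    (h : ∀ s, min M' (Nat.card {i // f i = s}) = min M' (Nat.card {i // f' i = s})) (ρ : I → S') :
    ∃ ρ' : I' → S', (∀ i', ∃ i, f i = f' i' ∧ ρ i = ρ' i') ∧
      ∀ s, min M (Nat.card {i // ρ i = s}) = min M (Nat.card {i // ρ' i = s}) := by
  choose r hr1 hr2 using fun s =>
    exists_fibres_of_min_card_eq hM (h s) fun i : {i // f i = s} => ρ i.1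
  let ρ' : I' → S' := fun i' => r (f' i') ⟨i', rfl⟩
  have hρ' (s : S) (i' : I') (hi : f' i' = s) : ρ' i' = r s ⟨i', hi⟩ := by subst hi; rfl
  refine ⟨ρ', fun i' => ?_, ?_⟩
  · obtain ⟨i, hi⟩ := hr1 _ ⟨i', rfl⟩
    exact ⟨i.1, i.2, hi⟩
  · refine min_card_fibre_comp le_rfl (fun i => (f i, ρ i)) (fun i => (f' i, ρ' i)) ?_ Prod.snd
    rintro ⟨s, t⟩
    have e1 : {i // (f i, ρ i) = (s, t)} ≃ {i : {i // f i = s} // ρ i.1 = t} :=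
      { toFun := fun i => ⟨⟨i.1, (Prod.mk.inj i.2).1⟩, (Prod.mk.inj i.2).2⟩
        invFun := fun i => ⟨i.1.1, Prod.ext i.1.2 i.2⟩
        left_inv := fun _ => rfl
        right_inv := fun _ => rfl }
    have e2 : {i // (f' i, ρ' i) = (s, t)} ≃ {i : {i // f' i = s} // r s i = t} :=
      { toFun := fun i => ⟨⟨i.1, (Prod.mk.inj i.2).1⟩,
          (hρ' s _ _).symm.trans (Prod.mk.inj i.2).2⟩
        invFun := fun i => ⟨i.1.1, Prod.ext i.1.2 ((hρ' s _ i.1.2).trans i.2)⟩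
        left_inv := fun _ => rfl
        right_inv := fun _ => rfl }
    rw [Nat.card_congr e1, Nat.card_congr e2]
    exact hr2 s t

end Threshold

/-! ### Threshold types of labelled trees -/

section Types

/-- The types of trees of height `h` with labels from `C`, for the threshold `M`. -/
def Ty (M : ℕ) (C : Type) : ℕ → Type
  | 0 => PUnit
  | h + 1 => C × (Ty M C h → Fin (M + 1))

instance Ty.finite (M : ℕ) (C : Type) [Finite C] : ∀ h, Finite (Ty M C h)
  | 0 => inferInstanceAs (Finite PUnit)
  | h + 1 => by
    have := Ty.finite M C h
    exact inferInstanceAs (Finite (C × (Ty M C h → Fin (M + 1))))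

variable {m : ℕ} {C C' X : Type}

/-- The type of a labelled tree. -/
noncomputable def ty (M : ℕ) : (h : ℕ) → (List (Fin m) → C) → Ty M C h
  | 0, _ => PUnit.unit
  | h + 1, c => (c [], fun t => ⟨min M (Nat.card {d // ty M h (fun l => c (d :: l)) = t}),
      Nat.lt_succ_of_le (min_le_left _ _)⟩)

theorem ty_succ_eq_iff {M h : ℕ} {c c' : List (Fin m) → C} :
    ty M (h + 1) c = ty M (h + 1) c' ↔ c [] = c' [] ∧
      ∀ t, min M (Nat.card {d // ty M h (fun l => c (d :: l)) = t}) =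
        min M (Nat.card {d // ty M h (fun l => c' (d :: l)) = t}) := by
  constructor
  · intro H
    obtain ⟨h1, h2⟩ := Prod.mk.inj H
    exact ⟨h1, fun t => congrArg Fin.val (congrFun h2 t)⟩
  · rintro ⟨h1, h2⟩
    exact Prod.ext h1 (funext fun t => Fin.ext (h2 t))

theorem ty_ext {M h : ℕ} {c c' : List (Fin m) → C} (H : ∀ l, l.length < h → c l = c' l) :
    ty M h c = ty M h c' := by
  induction h generalizing c c' with
  | zero => rfl
  | succ h ih =>
    have h1 (d : Fin m) : ty M h (fun l => c (d :: l)) = ty M h (fun l => c' (d :: l)) :=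
      ih fun l hl => H _ (by simpa using hl)
    exact ty_succ_eq_iff.2 ⟨H [] (by simp), fun t => by simp only [h1]⟩

/-- By induction, the type of a relabelled subtree is a function of its type, so the counts for the
new types are sums of old counts. -/
theorem ty_map [Finite C] {M M' h : ℕ} (hM : M ≤ M') (f : C → C') {c c' : List (Fin m) → C}
    (H : ty M' h c = ty M' h c') : ty M h (fun l => f (c l)) = ty M h (fun l => f (c' l)) := by
  induction h generalizing c c' with
  | zero => rfl
  | succ h ih =>
    classical
    obtain ⟨h1, h2⟩ := ty_succ_eq_iff.1 H
    -- Defined through a chosen labelling of type `t`, the choice being irrelevant by induction;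
    -- `none` is for types realised by no labelling.
    let G : Ty M' C h → Option (Ty M C' h) := fun t =>
      if ht : ∃ b : List (Fin m) → C, ty M' h b = t then
        some (ty M h fun l => f (ht.choose l)) else none
    have hG (b : List (Fin m) → C) : G (ty M' h b) = some (ty M h fun l => f (b l)) := by
      have ht : ∃ b' : List (Fin m) → C, ty M' h b' = ty M' h b := ⟨b, rfl⟩
      rw [show G (ty M' h b) = some (ty M h fun l => f (ht.choose l)) from dif_pos ht]
      exact congrArg some (ih ht.choose_spec)
    refine ty_succ_eq_iff.2 ⟨by rw [h1], fun t => ?_⟩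
    have := min_card_fibre_comp hM _ _ h2 G (some t)
    simpa only [hG, Option.some.injEq] using this

theorem ty_mono [Finite C] {M M' h : ℕ} (hM : M ≤ M') {c c' : List (Fin m) → C}
    (H : ty M' h c = ty M' h c') : ty M h c = ty M h c' := ty_map hM id H

/-- The back-and-forth property of threshold types. -/
theorem exists_ty_extension (C X : Type) [Finite C] [Finite X] (M h : ℕ) :
    ∃ M0, ∀ M', M0 ≤ M' → ∀ (m : ℕ) (c c' : List (Fin m) → C), ty M' h c = ty M' h c' →
      ∀ x : List (Fin m) → X, ∃ x' : List (Fin m) → X,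
        ty M h (fun l => (c l, x l)) = ty M h (fun l => (c' l, x' l)) := by
  induction h with
  | zero => exact ⟨0, fun _ _ _ _ _ _ x => ⟨x, rfl⟩⟩
  | succ h ih =>
    obtain ⟨M0, hM0⟩ := ih
    -- The second bound lets the colouring of children by their new types be copied; the first lets
    -- the extension be copied inside each child's subtree.
    refine ⟨max M0 (M * Nat.card (Ty M (C × X) h) + 1), fun M' hM' m c c' H x => ?_⟩
    obtain ⟨h1, h2⟩ := ty_succ_eq_iff.1 H
    obtain ⟨ρ, hρ, hcard⟩ := exists_refinement ((le_max_right _ _).trans hM') _ _ h2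
      fun d => ty M h fun l => (c (d :: l), x (d :: l))
    have key (d' : Fin m) : ∃ x' : List (Fin m) → X,
        ty M h (fun l => (c' (d' :: l), x' l)) = ρ d' := by
      obtain ⟨d, hd, hdρ⟩ := hρ d'
      obtain ⟨x', hx'⟩ := hM0 M' ((le_max_left _ _).trans hM') m _ _ hd fun l => x (d :: l)
      exact ⟨x', hx'.symm.trans hdρ⟩
    choose x' hx' using key
    refine ⟨fun l => l.casesOn (x []) fun d l => x' d l, ty_succ_eq_iff.2 ⟨?_, fun t => ?_⟩⟩
    · exact Prod.ext h1 rfl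
    · simp only [hx']
      exact hcard t

/-- Each ancestor of `p` sees a change below `p` only through the type of one child, so the change
remains invisible up to the root. -/
theorem ty_congr_of_prefix {M : ℕ} {c c' : List (Fin m) → C} (p : List (Fin m)) (h : ℕ)
    (H : ∀ l, ¬ p <+: l → c l = c' l)
    (H' : ty M h (fun l => c (p ++ l)) = ty M h (fun l => c' (p ++ l))) :
    ty M (p.length + h) c = ty M (p.length + h) c' := by
  induction p generalizing c c' with
  | nil =>
    rw [List.length_nil, Nat.zero_add]
    exact H'
  | cons d p ih =>
    rw [List.length_cons, Nat.add_right_comm]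
    have key (e : Fin m) : ty M (p.length + h) (fun l => c (e :: l)) =
        ty M (p.length + h) (fun l => c' (e :: l)) := by
      by_cases hed : e = d
      · subst hed
        exact ih (fun l hl => H _ fun h' => hl (List.cons_prefix_cons.1 h').2) H'
      · exact congrArg _ (funext fun l => H _ fun h' => hed (List.cons_prefix_cons.1 h').1.symm)
    exact ty_succ_eq_iff.2 ⟨H [] (by simp), fun t => by simp only [key]⟩

theorem exists_child_of_ty_eq {M h : ℕ} (hM : 1 ≤ M) {c c' : List (Fin m) → C}
    (H : ty M (h + 1) c = ty M (h + 1) c') (d : Fin m) :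
    ∃ d', ty M h (fun l => c (d :: l)) = ty M h (fun l => c' (d' :: l)) := by
  have h1 := (ty_succ_eq_iff.1 H).2 (ty M h fun l => c (d :: l))
  have h2 : 0 < Nat.card {d' // ty M h (fun l => c (d' :: l)) = ty M h fun l => c (d :: l)} :=
    Nat.card_pos_iff.2 ⟨⟨⟨d, rfl⟩⟩, inferInstance⟩
  have h3 : 0 < Nat.card {d' // ty M h (fun l => c' (d' :: l)) = ty M h fun l => c (d :: l)} := by
    omega
  obtain ⟨⟨d', hd'⟩⟩ := (Nat.card_pos_iff.1 h3).1
  exact ⟨d', hd'.symm⟩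

theorem exists_node_of_ty_eq {M h : ℕ} (hM : 1 ≤ M) (p : C → Prop) {c c' : List (Fin m) → C}
    (H : ty M h c = ty M h c') (hp : ∃ l : List (Fin m), l.length < h ∧ p (c l)) :
    ∃ l : List (Fin m), l.length < h ∧ p (c' l) := by
  obtain ⟨l, hl, hpl⟩ := hp
  induction h generalizing c c' l with
  | zero => omega
  | succ h ih =>
    rcases l with _ | ⟨d, l⟩
    · exact ⟨[], hl, (ty_succ_eq_iff.1 H).1 ▸ hpl⟩
    · obtain ⟨d', hd'⟩ := exists_child_of_ty_eq hM H d
      obtain ⟨l', hl', hp'⟩ := ih hd' l (by simpa using hl) hpl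
      exact ⟨d' :: l', by simpa using hl', hp'⟩

/-- Threshold `1` already records which child types occur, and the type of a nonempty subtree
includes the label of its root. -/
theorem exists_edge_of_ty_eq {M h : ℕ} (hM : 1 ≤ M) (r : C → C → Prop) {c c' : List (Fin m) → C}
    (H : ty M h c = ty M h c')
    (hr : ∃ (l : List (Fin m)) (d : Fin m), l.length + 1 < h ∧ r (c l) (c (l ++ [d]))) :
    ∃ (l : List (Fin m)) (d : Fin m), l.length + 1 < h ∧ r (c' l) (c' (l ++ [d])) := by
  obtain ⟨l, d, hl, hrl⟩ := hr
  induction h generalizing c c' l with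
  | zero => omega
  | succ h ih =>
    rcases l with _ | ⟨e, l⟩
    · obtain ⟨d', hd'⟩ := exists_child_of_ty_eq hM H d
      obtain ⟨h, rfl⟩ : ∃ h', h = h' + 1 := ⟨h - 1, by simp at hl; omega⟩
      refine ⟨[], d', hl, ?_⟩
      have h1 := (ty_succ_eq_iff.1 H).1
      have h2 := (ty_succ_eq_iff.1 hd').1
      rw [← h1]
      exact h2 ▸ hrl
    · obtain ⟨e', he'⟩ := exists_child_of_ty_eq hM H e
      obtain ⟨l', d', hl', hr'⟩ := ih he' l (by simpa using hl) hrl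
      exact ⟨e' :: l', d', by simpa using hl', hr'⟩

end Types

end MSOTrans

/-! ### Formulae over trees depend only on threshold types; exchanging sibling subtrees. -/

namespace MSOTrans

open FirstOrder

/-! ### Labels of the vertices of a tree -/

section Labels

variable {m n k p : ℕ}

/-- The vertex of the tree at which an element of its incidence structure is placed; an edge is
placed at its lower end. -/
def loc : incidence (completeTree m n) → List (Fin m)
  | Sum.inl v => v.1
  | Sum.inr c => (edgeEnd c 1).1

/-- The element is an edge. -/
def isEdge : incidence (completeTree m n) → Bool
  | Sum.inl _ => false
  | Sum.inr _ => true

theorem loc_length (x : incidence (completeTree m n)) : (loc x).length < n := by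
  rcases x with v | c
  · exact v.2
  · exact (edgeEnd c 1).2

theorem eq_of_loc_eq {x y : incidence (completeTree m n)} (h : loc x = loc y)
    (h' : isEdge x = isEdge y) : x = y := by
  rcases x with v | c <;> rcases y with w | d
  · exact congrArg _ (Subtype.ext h)
  · cases h'
  · cases h'
  · exact congrArg _ (edgeEnd_one_injective (Subtype.ext h))

theorem exists_loc_eq {l : List (Fin m)} (hl : l.length < n) (b : Bool) (hb : b = true → l ≠ []) :
    ∃ x : incidence (completeTree m n), loc x = l ∧ isEdge x = b := by
  cases b
  · exact ⟨Sum.inl ⟨l, hl⟩, rfl, rfl⟩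
  · obtain ⟨c, hc⟩ := exists_edge (w := (⟨l, hl⟩ : completeTree m n)) (hb rfl)
    exact ⟨Sum.inr c, congrArg Subtype.val hc, rfl⟩

/-- The label of a vertex that is given by the parameters. -/
def colourLabel (Q : Fin p → Set (incidence (completeTree m n))) (l : List (Fin m)) :
    Fin p → Bool → Prop :=
  fun q b => ∃ x, loc x = l ∧ isEdge x = b ∧ x ∈ Q q

/-- The label of a vertex that is given by a set. -/
def setLabel (X : Set (incidence (completeTree m n) × Fin k)) (l : List (Fin m)) :
    Bool × Fin k → Prop :=
  fun b => ∃ x, loc x = l ∧ isEdge x = b.1 ∧ (x, b.2) ∈ X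

/-- The labels of the vertices. -/
abbrev Label (p k s : ℕ) : Type := (Fin p → Bool → Prop) × (Fin s → Bool × Fin k → Prop)

/-- The label of a vertex that is given by the parameters and the values of the set variables. -/
def label {s : ℕ} (Q : Fin p → Set (incidence (completeTree m n)))
    (v : Fin s → Set (incidence (completeTree m n) × Fin k)) (l : List (Fin m)) : Label p k s :=
  (colourLabel Q l, fun i => setLabel (v i) l)

theorem setLabel_loc (X : Set (incidence (completeTree m n) × Fin k))
    (x : incidence (completeTree m n)) (j : Fin k) :
    setLabel X (loc x) (isEdge x, j) ↔ (x, j) ∈ X := by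
  constructor
  · rintro ⟨y, h1, h2, h3⟩
    rwa [eq_of_loc_eq h1 h2] at h3
  · exact fun h => ⟨x, rfl, rfl, h⟩

theorem colourLabel_loc (Q : Fin p → Set (incidence (completeTree m n)))
    (x : incidence (completeTree m n)) (q : Fin p) :
    colourLabel Q (loc x) q (isEdge x) ↔ x ∈ Q q := by
  constructor
  · rintro ⟨y, h1, h2, h3⟩
    rwa [eq_of_loc_eq h1 h2] at h3
  · exact fun h => ⟨x, rfl, rfl, h⟩

/-- The set with given labels. -/
theorem setLabel_ofLabel (Y : List (Fin m) → Bool × Fin k → Prop) {l : List (Fin m)}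
    (hl : l.length < n) (hY : ∀ j, Y [] (true, j) → False) :
    setLabel (n := n) {x | Y (loc x.1) (isEdge x.1, x.2)} l = Y l := by
  funext ⟨b, j⟩
  refine propext ⟨?_, fun h => ?_⟩
  · rintro ⟨x, rfl, rfl, h⟩
    exact h
  · obtain ⟨x, rfl, rfl⟩ := exists_loc_eq hl b (by rintro rfl rfl; exact hY j h)
    exact ⟨x, rfl, rfl, h⟩

/-- The root has no incoming edge, so no edge is placed there. -/
theorem setLabel_nil_true (X : Set (incidence (completeTree m n) × Fin k)) (j : Fin k) :
    ¬ setLabel X [] (true, j) := by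
  rintro ⟨v | c, h1, h2, -⟩
  · cases h2
  · obtain ⟨d, hd⟩ := edgeEnd_one c
    have h1 : (edgeEnd c 1).1 = [] := h1
    rw [hd] at h1
    simp at h1

end Labels

/-! ### Types determine the satisfied formulae -/

section Invariance

variable {m n k p : ℕ}

/-- The structure obtained from a tree with parameters. -/
abbrev treeCopy (k : ℕ) (Q : Fin p → Set (incidence (completeTree m n))) :
    FinStr (((incLang FirstOrder.Language.graph).sum (colourLang p)).sum (copyLang k)) :=
  copy k (expand (incidence (completeTree m n)) Q)

theorem realize_rel_base {s j : ℕ} (R : (incLang FirstOrder.Language.graph).Relations j)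
    (Z : Fin j → Fin s) (Q : Fin p → Set (incidence (completeTree m n)))
    (v : Fin s → Set (incidence (completeTree m n) × Fin k)) :
    (MSO.rel (Sum.inl (Sum.inl R)) Z).Realize (treeCopy k Q) v ↔
      ∃ a : Fin j → incidence (completeTree m n) × Fin k, (∀ i, a i ∈ v (Z i)) ∧
        ∃ c : Fin k, (∀ i, (a i).2 = c) ∧
          FirstOrder.Language.Structure.RelMap R fun i => (a i).1 := Iff.rfl

/-- With edges placed at their lower ends, only `in_0` connects different vertices, and these are a
parent and its child. Every other atomic formula inspects the label of one vertex. -/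
theorem realize_rel_node_or_edge (n : ℕ) {s j : ℕ}
    (R : (((incLang FirstOrder.Language.graph).sum (colourLang p)).sum (copyLang k)).Relations j)
    (Z : Fin j → Fin s) :
    (∃ P : Label p k s → Prop, ∀ (m : ℕ) (Q : Fin p → Set (incidence (completeTree m n)))
      (v : Fin s → Set (incidence (completeTree m n) × Fin k)),
      (MSO.rel R Z).Realize (treeCopy k Q) v ↔
        ∃ l : List (Fin m), l.length < n ∧ P (label Q v l)) ∨
    (∃ P : Label p k s → Label p k s → Prop, ∀ (m : ℕ)
      (Q : Fin p → Set (incidence (completeTree m n)))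
      (v : Fin s → Set (incidence (completeTree m n) × Fin k)),
      (MSO.rel R Z).Realize (treeCopy k Q) v ↔
        ∃ (l : List (Fin m)) (d : Fin m), l.length + 1 < n ∧
          P (label Q v l) (label Q v (l ++ [d]))) := by
  rcases R with (R | R) | R
  · cases R with
    | P R =>
      cases R
      left
      refine ⟨fun c => ∃ j, c.2 (Z 0) (true, j),
        fun m Q v => (realize_rel_base _ _ _ _).trans ⟨?_, ?_⟩⟩
      · rintro ⟨a, ha, j, -, h⟩
        obtain ⟨c, hc⟩ := (relMap_P _).1 h
        refine ⟨loc (a 0).1, loc_length _, (a 0).2, (a 0).1, rfl, ?_, ha 0⟩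
        rw [hc]; rfl
      · rintro ⟨l, -, j, v' | c, -, h, hx⟩
        · cases h
        · exact ⟨fun _ => (Sum.inr c, j), fun i => by rw [Subsingleton.elim i 0]; exact hx, j,
            fun _ => rfl, (relMap_P _).2 ⟨c, rfl⟩⟩
    | inc i hi =>
      have hi' : i < 2 := by
        obtain ⟨r, hr, ⟨R⟩⟩ := hi
        cases R; exact hr
      obtain rfl | rfl : i = 0 ∨ i = 1 := by omega
      · right
        refine ⟨fun c c' => ∃ j, c.2 (Z 0) (false, j) ∧ c'.2 (Z 1) (true, j),
          fun m Q v => (realize_rel_base _ _ _ _).trans ⟨?_, ?_⟩⟩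
        · rintro ⟨a, ha, j, hj, h⟩
          obtain ⟨c, h0, h1⟩ := (relMap_inc hi' hi _).1 h
          obtain ⟨d, hd⟩ := edgeEnd_one c
          refine ⟨(edgeEnd c 0).1, d, ?_, j, ⟨(a 0).1, ?_, ?_, ?_⟩, ⟨(a 1).1, ?_, ?_, ?_⟩⟩
          · have := (edgeEnd c 1).2
            rw [hd] at this
            simpa using this
          · rw [h0]; rfl
          · rw [h0]; rfl
          · rw [← hj 0]; exact ha 0
          · rw [h1]; exact hd
          · rw [h1]; rfl
          · rw [← hj 1]; exact ha 1
        · rintro ⟨l, d, hl, j, ⟨x, hx1, hx2, hx3⟩, ⟨y, hy1, hy2, hy3⟩⟩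
          rcases x with u | c
          swap
          · cases hx2
          rcases y with u' | c
          · cases hy2
          refine ⟨![(Sum.inl u, j), (Sum.inr c, j)], ?_, j, ?_, (relMap_inc hi' hi _).2 ⟨c, ?_, rfl⟩⟩
          · intro i; fin_cases i
            · exact hx3
            · exact hy3
          · intro i; fin_cases i <;> rfl
          · obtain ⟨d', hd⟩ := edgeEnd_one c
            have hy1 : (edgeEnd c 1).1 = _ := hy1
            have hx1 : u.1 = _ := hx1
            rw [hd, ← hx1] at hy1
            exact congrArg Sum.inl (Subtype.ext (List.append_inj' hy1 rfl).1.symm)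
      · left
        refine ⟨fun c => ∃ j, c.2 (Z 0) (false, j) ∧ c.2 (Z 1) (true, j),
          fun m Q v => (realize_rel_base _ _ _ _).trans ⟨?_, ?_⟩⟩
        · rintro ⟨a, ha, j, hj, h⟩
          obtain ⟨c, h0, h1⟩ := (relMap_inc hi' hi _).1 h
          refine ⟨(edgeEnd c 1).1, (edgeEnd c 1).2, j, ⟨(a 0).1, ?_, ?_, ?_⟩, ⟨(a 1).1, ?_, ?_, ?_⟩⟩
          · rw [h0]; rfl
          · rw [h0]; rfl
          · rw [← hj 0]; exact ha 0
          · rw [h1]; rfl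
          · rw [h1]; rfl
          · rw [← hj 1]; exact ha 1
        · rintro ⟨l, hl, j, ⟨x, hx1, hx2, hx3⟩, ⟨y, hy1, hy2, hy3⟩⟩
          rcases x with u | c
          swap
          · cases hx2
          rcases y with u' | c
          · cases hy2
          refine ⟨![(Sum.inl u, j), (Sum.inr c, j)], ?_, j, ?_, (relMap_inc hi' hi _).2 ⟨c, ?_, rfl⟩⟩
          · intro i; fin_cases i
            · exact hx3
            · exact hy3
          · intro i; fin_cases i <;> rfl
          · exact congrArg Sum.inl (Subtype.ext (hx1.trans hy1.symm))
  · cases R with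
    | Q q =>
      left
      refine ⟨fun c => ∃ b j, c.1 q b ∧ c.2 (Z 0) (b, j), fun m Q v => ⟨?_, ?_⟩⟩
      · rintro ⟨a, ha, j, -, h⟩
        exact ⟨loc (a 0).1, loc_length _, isEdge (a 0).1, (a 0).2, (colourLabel_loc _ _ _).2 h,
          (setLabel_loc _ _ _).2 (ha 0)⟩
      · rintro ⟨l, -, b, j, h, x, rfl, rfl, hx⟩
        exact ⟨fun _ => (x, j), fun i => by rw [Subsingleton.elim i 0]; exact hx, j,
            fun _ => rfl, (colourLabel_loc _ _ _).1 h⟩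
  · cases R with
    | P hk c =>
      left
      refine ⟨fun l => ∃ b, l.2 (Z 0) (b, c), fun m Q v => ⟨?_, ?_⟩⟩
      · rintro ⟨a, ha, h⟩
        refine ⟨loc (a 0).1, loc_length _, isEdge (a 0).1, (a 0).1, rfl, rfl, ?_⟩
        have h : (a 0).2 = c := h
        rw [← h]; exact ha 0
      · rintro ⟨l, -, b, x, rfl, rfl, hx⟩
        exact ⟨fun _ => (x, c), fun i => by rw [Subsingleton.elim i 0]; exact hx, rfl⟩
    | sim hk =>
      left
      refine ⟨fun c => ∃ b j j', c.2 (Z 0) (b, j) ∧ c.2 (Z 1) (b, j'), fun m Q v => ⟨?_, ?_⟩⟩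
      · rintro ⟨a, ha, h⟩
        have h : (a 0).1 = (a 1).1 := h
        refine ⟨loc (a 0).1, loc_length _, isEdge (a 0).1, (a 0).2, (a 1).2,
          (setLabel_loc _ _ _).2 (ha 0), ?_⟩
        rw [h]
        exact (setLabel_loc _ _ _).2 (ha 1)
      · rintro ⟨l, -, b, j, j', ⟨x, rfl, rfl, hx⟩, ⟨y, hy1, hy2, hy⟩⟩
        obtain rfl := eq_of_loc_eq hy1 hy2
        refine ⟨![(y, j), (y, j')], ?_, rfl⟩
        intro i; fin_cases i
        · exact hx
        · exact hy

theorem label_snoc {s : ℕ} (Q : Fin p → Set (incidence (completeTree m n)))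
    (v : Fin s → Set (incidence (completeTree m n) × Fin k))
    (X : Set (incidence (completeTree m n) × Fin k)) (l : List (Fin m)) :
    label Q (Fin.snoc v X : Fin (s + 1) → Set (incidence (completeTree m n) × Fin k)) l =
      ((label Q v l).1, Fin.snoc (label Q v l).2 (setLabel X l)) := by
  refine Prod.ext rfl (funext fun i => ?_)
  refine Fin.lastCases ?_ (fun i => ?_) i
  · simp [label]
  · simp [label]

/-- An Ehrenfeucht–Fraïssé argument by induction on the formula: atoms need threshold `1`, and a set
quantifier is answered by the back-and-forth property. The threshold does not depend on the
branching `m`, which the later counting requires. -/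
theorem exists_threshold (n : ℕ) {s : ℕ}
    (φ : MSO (((incLang FirstOrder.Language.graph).sum (colourLang p)).sum (copyLang k)) s) :
    ∃ M, ∀ (m : ℕ) (Q : Fin p → Set (incidence (completeTree m n)))
      (v v' : Fin s → Set (incidence (completeTree m n) × Fin k)),
      ty M n (label Q v) = ty M n (label Q v') →
        φ.Realize (treeCopy k Q) v → φ.Realize (treeCopy k Q) v' := by
  induction φ with
  | falsum => exact ⟨0, fun _ _ _ _ _ h => h⟩
  | sub X Y =>
    refine ⟨1, fun m Q v v' H h => ?_⟩
    by_contra hcon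
    obtain ⟨⟨x, j⟩, hx, hy⟩ := Set.not_subset.1 (show ¬ v' X ⊆ v' Y from hcon)
    obtain ⟨l, -, b, j, ⟨y, rfl, rfl, hyX⟩, hyY⟩ := exists_node_of_ty_eq le_rfl
      (fun c => ∃ b j, c.2 X (b, j) ∧ ¬ c.2 Y (b, j)) H.symm
      ⟨loc x, loc_length x, isEdge x, j, (setLabel_loc _ _ _).2 hx,
        fun h => hy ((setLabel_loc _ _ _).1 h)⟩
    exact hyY ((setLabel_loc _ _ _).2 (h hyX))
  | rel R Z =>
    refine ⟨1, fun m Q v v' H => ?_⟩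
    rcases realize_rel_node_or_edge n R Z with ⟨P, hP⟩ | ⟨P, hP⟩
    · rw [hP, hP]
      exact exists_node_of_ty_eq le_rfl P H
    · rw [hP, hP]
      exact exists_edge_of_ty_eq le_rfl P H
  | imp φ ψ hφ hψ =>
    obtain ⟨M, hM⟩ := hφ
    obtain ⟨M', hM'⟩ := hψ
    refine ⟨max M M', fun m Q v v' H h h' => ?_⟩
    exact hM' m Q v v' (ty_mono (le_max_right _ _) H)
      (h (hM m Q v' v (ty_mono (le_max_left _ _) H.symm) h'))
  | @all s φ hφ =>
    obtain ⟨M, hM⟩ := hφ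
    obtain ⟨M0, hM0⟩ := exists_ty_extension (Label p k s) (Bool × Fin k → Prop) M n
    refine ⟨M0, fun m Q v v' H h (X : Set (incidence (completeTree m n) × Fin k)) => ?_⟩
    obtain ⟨Y, hY⟩ := hM0 M0 le_rfl m _ _ H.symm (setLabel X)
    let X' : Set (incidence (completeTree m n) × Fin k) := {x | Y (loc x.1) (isEdge x.1, x.2)}
    refine hM m Q (Fin.snoc v X') (Fin.snoc v' X) ?_ (h X')
    -- Labels `Y` come from a set only if they place no edge at the root. Equality of types forces
    -- the root label of `Y` to agree with that of the genuine set `X`.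
    have hX' : ∀ l, l.length < n → setLabel X' l = Y l := by
      intro l hl
      refine setLabel_ofLabel Y hl fun j hj => ?_
      obtain ⟨n, rfl⟩ : ∃ n', n = n' + 1 := ⟨n - 1, by omega⟩
      have h1 := congrArg Prod.snd (ty_succ_eq_iff.1 hY).1
      dsimp only at h1
      rw [← h1] at hj
      exact setLabel_nil_true X j hj
    have h2 := ty_map le_rfl (fun c : Label p k s × (Bool × Fin k → Prop) =>
      ((c.1.1, Fin.snoc c.1.2 c.2) : Label p k (s + 1))) hY
    refine (ty_ext fun l hl => ?_).trans (h2.symm.trans (congrArg _ (funext fun l => ?_)))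
    · rw [label_snoc, hX' l hl]
    · rw [label_snoc]

end Invariance

/-! ### Exchanging subtrees of the same type -/

section Exchange

variable {m n k p : ℕ}

/-- The number of siblings of `q ++ [d]` whose subtrees have the same type is at least `3`. -/
def Frequent {C : Type} (M n : ℕ) (c : List (Fin m) → C) (q : List (Fin m)) (d : Fin m) : Prop :=
  3 ≤ Nat.card {e // ty M (n - q.length - 1) (fun l => c (q ++ e :: l)) =
    ty M (n - q.length - 1) (fun l => c (q ++ d :: l))}

/-- Among three siblings with equal types, one, `d'`, is neither `d` nor on the way to `z`. By
back-and-forth the set `{y}` can be imitated by a set `X` in the subtree at `d'`. Swapping `d` and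
`d'` shows that `({y}, {z})` and `(X, {z})` have the same type, so `φ` carries over. -/
theorem exists_exchange (n : ℕ)
    (φ : MSO (((incLang FirstOrder.Language.graph).sum (colourLang p)).sum (copyLang k)) 2) :
    ∃ M, ∀ (m : ℕ) (Q : Fin p → Set (incidence (completeTree m n)))
      (y z : incidence (completeTree m n) × Fin k) (q : List (Fin m)) (d : Fin m),
      Frequent M n (colourLabel Q) q d → q ++ [d] <+: loc y.1 → ¬ q ++ [d] <+: loc z.1 →
      φ.Realize (treeCopy k Q) ![{y}, {z}] →
        ∃ y', y' ≠ y ∧ φ.Realize (treeCopy k Q) ![{y'}, {z}] := by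
  -- The conjunct `sing 0` guarantees that the imitation `X` of `{y}` is again a singleton.
  obtain ⟨M, hM⟩ := exists_threshold n ((MSO.sing 0).and φ)
  choose M0 hM0 using exists_ty_extension (Fin p → Bool → Prop) (Bool × Fin k → Prop) M
  -- One threshold that suffices for subtrees of every height below `n`.
  let N := M + ∑ h ∈ Finset.range n, M0 h
  refine ⟨N, fun m Q y z q d hf hy hz hφ => ?_⟩
  obtain ⟨d', hd', hdd', hzd'⟩ : ∃ d', ty N (n - q.length - 1) (fun l => colourLabel Q (q ++ d' :: l)) =
      ty N (n - q.length - 1) (fun l => colourLabel Q (q ++ d :: l)) ∧ d' ≠ d ∧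
        ¬ q ++ [d'] <+: loc z.1 := by
    classical
    -- `e` is the letter leading from `q` towards `z`; if there is none, the default `d` is harmless
    -- because `d` is excluded anyway.
    let e : Fin m := if h : ∃ e, q ++ [e] <+: loc z.1 then h.choose else d
    have he : ∀ e', q ++ [e'] <+: loc z.1 → e' = e := by
      intro e' he'
      have h : ∃ e, q ++ [e] <+: loc z.1 := ⟨e', he'⟩
      have h1 : e = h.choose := dif_pos h
      have h2 := h.choose_spec
      rw [← h1] at h2
      have := (List.prefix_of_prefix_length_le he' h2 (by simp)).eq_of_length (by simp)
      simpa using this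
    unfold Frequent at hf
    rw [Nat.subtype_card (Finset.univ.filter fun e => ty N (n - q.length - 1)
      (fun l => colourLabel Q (q ++ e :: l)) = ty N (n - q.length - 1)
        (fun l => colourLabel Q (q ++ d :: l))) (by simp)] at hf
    obtain ⟨d', h1, h2⟩ := Finset.exists_mem_notMem_of_card_lt_card
      (lt_of_le_of_lt (Finset.card_le_two (a := d) (b := e)) hf)
    simp only [Finset.mem_filter, Finset.mem_univ, true_and, Finset.mem_insert,
      Finset.mem_singleton, not_or] at h1 h2
    exact ⟨d', h1, h2.1, fun h => h2.2 (he d' h)⟩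
  have hq : q.length + 1 < n := by
    refine lt_of_le_of_lt ?_ (loc_length y.1)
    simpa using hy.length_le
  obtain ⟨h, hh⟩ : ∃ h, n = q.length + (h + 1) := ⟨n - q.length - 1, by omega⟩
  have hh' : n - q.length - 1 = h := by omega
  rw [hh'] at hd'
  have hN : M0 h ≤ N := le_trans (Finset.single_le_sum (f := M0) (fun _ _ => Nat.zero_le _)
    (Finset.mem_range.2 (by omega))) (Nat.le_add_left _ _)
  obtain ⟨Y, hY⟩ := hM0 h N hN m _ _ hd'.symm fun l => setLabel {y} (q ++ d :: l)
  let X : Set (incidence (completeTree m n) × Fin k) :=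
    {x | ∃ l, loc x.1 = q ++ d' :: l ∧ Y l (isEdge x.1, x.2)}
  have hX1 (l : List (Fin m)) (hl : l.length < h) : setLabel X (q ++ d' :: l) = Y l := by
    funext ⟨b, j⟩
    refine propext ⟨?_, fun hb => ?_⟩
    · rintro ⟨x, h1, rfl, l', h2, h3⟩
      have : l = l' := by simpa using h1.symm.trans h2
      rwa [this]
    · obtain ⟨x, h1, rfl⟩ := exists_loc_eq (n := n) (l := q ++ d' :: l)
        (by simp; omega) b (fun _ => by simp)
      exact ⟨x, h1, rfl, l, h1, hb⟩
  have hX2 (l : List (Fin m)) (hl : ¬ q ++ [d'] <+: l) : setLabel X l = fun _ => False := by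
    funext b
    refine propext ⟨?_, False.elim⟩
    rintro ⟨x, rfl, -, l', h2, -⟩
    exact hl ⟨l', by simp [h2]⟩
  have hs (w : incidence (completeTree m n) × Fin k) {r l : List (Fin m)} (hw : ¬ r <+: loc w.1)
      (hl : r <+: l) : setLabel {w} l = fun _ => False := by
    funext b
    refine propext ⟨?_, False.elim⟩
    rintro ⟨x, rfl, -, h2⟩
    exact hw (by rw [← Set.mem_singleton_iff.1 h2]; exact hl)
  have hs' {l : List (Fin m)} (hl : ¬ q ++ [d] <+: l) : setLabel {y} l = fun _ => False := by
    funext b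
    refine propext ⟨?_, False.elim⟩
    rintro ⟨x, rfl, -, h2⟩
    exact hl (by rw [← Set.mem_singleton_iff.1 h2] at hy; exact hy)
  have hpre (e e' : Fin m) (l : List (Fin m)) : q ++ [e] <+: q ++ e' :: l ↔ e = e' := by
    rw [List.prefix_append_right_inj]; simp
  have hlab (A : Set (incidence (completeTree m n) × Fin k)) (l : List (Fin m)) :
      label Q ![A, {z}] l = (colourLabel Q l, ![setLabel A l, setLabel {z} l]) := by
    refine Prod.ext rfl (funext fun i => ?_)
    fin_cases i <;> rfl
  have hmain : ty M (q.length + (h + 1)) (label Q ![{y}, {z}]) =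
      ty M (q.length + (h + 1)) (label Q ![X, {z}]) := by
    refine ty_congr_of_prefix q (h + 1) (fun l hl => ?_) (ty_succ_eq_iff.2 ⟨?_, fun t => ?_⟩)
    · rw [hlab, hlab, hs' fun h' => hl ((List.prefix_append _ _).trans h'),
        hX2 l fun h' => hl ((List.prefix_append _ _).trans h')]
    · have hq' (e : Fin m) : ¬ q ++ [e] <+: q ++ [] := fun h' => by simpa using h'.length_le
      rw [hlab, hlab, hs' (hq' d), hX2 _ (hq' d')]
    -- Swapping `d` and `d'` matches the child subtrees type by type: the one marked by `y` with the
    -- one marked by `X`, and the two unmarked ones with each other.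
    · refine congrArg _ (Nat.card_congr (Equiv.subtypeEquiv (Equiv.swap d d') fun e => ?_))
      have key : ty M h (fun l => label Q ![X, {z}] (q ++ Equiv.swap d d' e :: l)) =
          ty M h (fun l => label Q ![{y}, {z}] (q ++ e :: l)) := by
        by_cases hed : e = d
        · subst hed
          rw [Equiv.swap_apply_left]
          have h1 := ty_map le_rfl
            (fun c : (Fin p → Bool → Prop) × (Bool × Fin k → Prop) =>
              ((c.1, ![c.2, fun _ => False]) : Label p k 2)) hY
          dsimp only at h1
          refine Eq.trans (ty_ext fun l hl => ?_) (h1.symm.trans (ty_ext fun l hl => ?_))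
          · rw [hlab, hX1 l hl, hs z hzd' ((hpre _ _ _).2 rfl)]
          · rw [hlab, hs z hz ((hpre _ _ _).2 rfl)]
        · by_cases hed' : e = d'
          · subst hed'
            rw [Equiv.swap_apply_right]
            have h1 := ty_map (Nat.le_add_right M _) (fun c : Fin p → Bool → Prop =>
              ((c, ![fun _ => False, fun _ => False]) : Label p k 2)) hd'
            refine Eq.trans (ty_ext fun l hl => ?_) (h1.symm.trans (ty_ext fun l hl => ?_))
            · rw [hlab, hX2 _ (fun h' => hed ((hpre _ _ _).1 h')), hs z hz ((hpre _ _ _).2 rfl)]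
            · rw [hlab, hs' (fun h' => hed ((hpre _ _ _).1 h').symm),
                hs z hzd' ((hpre _ _ _).2 rfl)]
          · rw [Equiv.swap_apply_of_ne_of_ne hed hed']
            refine congrArg _ (funext fun l => ?_)
            rw [hlab, hlab, hX2 _ (fun h' => hed' ((hpre _ _ _).1 h').symm),
              hs' (fun h' => hed ((hpre _ _ _).1 h').symm)]
      rw [key]
  rw [← hh] at hmain
  have h1 := hM m Q _ _ hmain ((MSO.realize_and _ _ _ _).2 ⟨(MSO.realize_sing _ _ _).2 ⟨y, rfl⟩, hφ⟩)
  obtain ⟨h2, h3⟩ := (MSO.realize_and _ _ _ _).1 h1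
  obtain ⟨y', hy'⟩ := (MSO.realize_sing _ _ _).1 h2
  have hy' : X = {y'} := hy'
  refine ⟨y', ?_, by rw [hy'] at h3; exact h3⟩
  rintro rfl
  have : y' ∈ X := by rw [hy']; rfl
  obtain ⟨l, hl, -⟩ := this
  rw [hl, hpre] at hy
  exact hdd' hy.symm

end Exchange

end MSOTrans

/-! ### Strictness by counting frequent prefixes, and the final assembly. -/

namespace MSOTrans

open FirstOrder

/-! ### Frequent prefixes -/

section Counting

/-- Each value is taken by at most two infrequent indices. -/
theorem ncard_infrequent_le {m : ℕ} {S : Type*} [Finite S] (f : Fin m → S) :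
    {d | ¬ 3 ≤ Nat.card {e // f e = f d}}.ncard ≤ 2 * Nat.card S := by
  classical
  have := Fintype.ofFinite S
  have h1 : {d | ¬ 3 ≤ Nat.card {e // f e = f d}} =
      ((Finset.univ.filter fun d => ¬ 3 ≤ Nat.card {e // f e = f d} : Finset (Fin m)) :
        Set (Fin m)) := by simp
  rw [h1, Set.ncard_coe_finset, Nat.card_eq_fintype_card]
  refine Finset.card_le_mul_card_image_of_maps_to (f := f) (fun _ _ => Finset.mem_univ _) 2
    fun s _ => ?_
  by_contra hcon
  obtain ⟨d, hd⟩ := Finset.card_pos.1 (Nat.zero_lt_of_lt (not_le.1 hcon))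
  simp only [Finset.mem_filter, Finset.mem_univ, true_and] at hd
  obtain ⟨hd1, rfl⟩ := hd
  refine hd1 ?_
  rw [Nat.subtype_card (Finset.univ.filter fun e => f e = f d) (by simp)]
  refine le_trans (Nat.succ_le_of_lt (not_le.1 hcon)) (Finset.card_le_card fun e he => ?_)
  simp only [Finset.mem_filter, Finset.mem_univ, true_and] at he ⊢
  exact he.2

/-- The number of sequences of length less than `n` over a set with `R` letters. -/
def seqBound (R : ℕ) : ℕ → ℕ
  | 0 => 0
  | n + 1 => 1 + R * seqBound R n

theorem ncard_lists_le {α : Type*} [Finite α] (R n : ℕ) : ∀ P : List α → Prop,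
    (∀ q, {d | P (q ++ [d])}.ncard ≤ R) →
      {s | s.length < n ∧ ∀ q d, q ++ [d] <+: s → P (q ++ [d])}.ncard ≤ seqBound R n := by
  classical
  have := Fintype.ofFinite α
  induction n with
  | zero => intro P _; simp
  | succ n ih =>
    intro P hP
    let A : α → Set (List α) := fun d =>
      {s | s.length < n ∧ ∀ q e, q ++ [e] <+: s → P (d :: (q ++ [e]))}
    have hA (d : α) : (A d).ncard ≤ seqBound R n := ih (fun s => P (d :: s)) fun q => hP (d :: q)
    have hAfin (d : α) : (A d).Finite := (List.finite_length_lt α n).subset fun s hs => hs.1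
    let D : Finset α := Finset.univ.filter fun d => P [d]
    have hD : D.card ≤ R := by
      have := hP []
      rwa [← Set.ncard_coe_finset, Finset.coe_filter_univ]
    have hsub : {s | s.length < n + 1 ∧ ∀ q d, q ++ [d] <+: s → P (q ++ [d])} ⊆
        {[]} ∪ ⋃ d ∈ D, List.cons d '' A d := by
      rintro (_ | ⟨d, s⟩) ⟨h1, h2⟩
      · left; rfl
      · right
        simp only [Set.mem_iUnion]
        refine ⟨d, by simpa [D] using h2 [] d (by simp), s, ⟨by simpa using h1, fun q e hq => ?_⟩, rfl⟩
        exact h2 (d :: q) e (by simpa using hq)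
    have hfin : (⋃ d ∈ D, List.cons d '' A d).Finite :=
      D.finite_toSet.biUnion fun d _ => (hAfin d).image _
    refine (Set.ncard_le_ncard hsub ((Set.finite_singleton _).union hfin)).trans
      ((Set.ncard_union_le _ _).trans ?_)
    rw [Set.ncard_singleton, seqBound]
    refine Nat.add_le_add_left ((Finset.set_ncard_biUnion_le _ _).trans
      ((Finset.sum_le_card_nsmul _ _ (seqBound R n) fun d _ => ?_).trans
        (Nat.mul_le_mul_right _ hD))) _
    exact (Set.ncard_image_le (hAfin d)).trans (hA d)

/-- `f` is the longest prefix of `l` with the property `P`. -/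
def IsLongestPrefix {α : Type*} (P : List α → Prop) (l f : List α) : Prop :=
  f <+: l ∧ P f ∧ ∀ f', f' <+: l → P f' → f' <+: f

theorem exists_longest_prefix {α : Type*} (P : List α → Prop) (hP : P []) (l : List α) :
    ∃ f, IsLongestPrefix P l f := by
  induction l using List.reverseRecOn with
  | nil => exact ⟨[], List.prefix_rfl, hP, fun f hf _ => hf⟩
  | append_singleton l d ih =>
    by_cases h : P (l ++ [d])
    · exact ⟨l ++ [d], List.prefix_rfl, h, fun f hf _ => hf⟩
    · obtain ⟨f, h1, h2, h3⟩ := ih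
      refine ⟨f, h1.trans (List.prefix_append _ _), h2, fun f' h4 h5 => ?_⟩
      rcases List.prefix_concat_iff.1 h4 with rfl | h6
      · exact absurd h5 h
      · exact h3 f' h6 h5

/-- Beyond the longest prefix with property `P` every further step violates `P`, so the
continuations form a tree with branching at most `R`. -/
theorem ncard_longest_prefix_le {α : Type*} [Finite α] {P : List α → Prop} {R : ℕ} (n : ℕ)
    (hR : ∀ q, {d | ¬ P (q ++ [d])}.ncard ≤ R) (f : List α) :
    {l | l.length < n ∧ IsLongestPrefix P l f}.ncard ≤ seqBound R n := by
  have h1 := ncard_lists_le R n (fun s => ¬ P (f ++ s)) fun q => by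
    simpa only [List.append_assoc] using hR (f ++ q)
  refine le_trans ?_ (le_trans (Set.ncard_image_le (f := fun s => f ++ s)
    ((List.finite_length_lt α n).subset fun s hs => hs.1)) h1)
  refine Set.ncard_le_ncard ?_ (((List.finite_length_lt α n).subset fun s hs => hs.1).image _)
  rintro l ⟨hl, ⟨s, rfl⟩, h2, h3⟩
  refine ⟨s, ⟨?_, fun q d hq hP => ?_⟩, rfl⟩
  · rw [List.length_append] at hl; omega
  · have := (h3 (f ++ (q ++ [d])) ((List.prefix_append_right_inj f).2 hq) hP).length_le
    simp at this

end Counting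

/-! ### The trees of height `n + 1` are not below the trees of height `n` -/

section Strict

variable {k p : ℕ}

/-- The relation between parents and children in the output of a transduction is definable. -/
theorem exists_parent_formula (τ : BasicTransduction
    (((incLang FirstOrder.Language.graph).sum (colourLang p)).sum (copyLang k))
      (incLang FirstOrder.Language.graph)) :
    ∃ φ : MSO (((incLang FirstOrder.Language.graph).sum (colourLang p)).sum (copyLang k)) 2,
      ∀ (B : FinStr (incLang FirstOrder.Language.graph)) (Q : Fin p → Set B)
        (x y : copy k (expand B Q)), φ.Realize (copy k (expand B Q)) ![{x}, {y}] ↔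
          ∃ (x' y' : τ.apply (copy k (expand B Q))), x'.1 = x ∧ y'.1 = y ∧ par _ x' y' := by
  have hδ : Def1 (copyExpand (incLang FirstOrder.Language.graph) k p)
      fun i x => τ.delta.RealizeElts (copy k (expand i.1 i.2)) fun _ => x := by
    refine ⟨τ.delta, fun i x => iff_of_eq (congrArg (MSO.Realize _ _) (funext fun j => ?_))⟩
    fin_cases j; rfl
  have hφ (R : (incLang FirstOrder.Language.graph).Relations 2) :
      Def2 (copyExpand (incLang FirstOrder.Language.graph) k p)
        fun i x y => (τ.phi R).RealizeElts (copy k (expand i.1 i.2)) ![x, y] := by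
    refine ⟨τ.phi R, fun i x y => iff_of_eq (congrArg (MSO.Realize _ _) (funext fun j => ?_))⟩
    fin_cases j <;> rfl
  obtain ⟨φ, H⟩ := (hδ.fst.and hδ.snd).and (Def2.comp
    ((hφ (IncRel.inc 0 (graph_arity 0 (by simp)))).and hδ.snd)
    (hφ (IncRel.inc 1 (graph_arity 1 (by simp)))).swap)
  refine ⟨φ, fun B Q x y => (H ⟨B, Q⟩ x y).trans ?_⟩
  have e (x y : τ.apply (copy k (expand B Q))) (R : (incLang FirstOrder.Language.graph).Relations 2) :
      FirstOrder.Language.Structure.RelMap R ![x, y] ↔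
        (τ.phi R).RealizeElts (copy k (expand B Q)) ![x.1, y.1] := by
    refine iff_of_eq (congrArg (MSO.RealizeElts _ _) (funext fun j => ?_))
    fin_cases j <;> rfl
  constructor
  · rintro ⟨⟨hx, hy⟩, z, ⟨h0, hz⟩, h1⟩
    exact ⟨⟨x, hx⟩, ⟨y, hy⟩, rfl, rfl, ⟨z, hz⟩, (e _ _ _).2 h0, (e _ _ _).2 h1⟩
  · rintro ⟨x, y, rfl, rfl, z, h0, h1⟩
    exact ⟨⟨x.2, y.2⟩, z.1, ⟨(e _ _ _).1 h0, z.2⟩, (e _ _ _).1 h1⟩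

theorem par_equiv {A B : FinStr (incLang FirstOrder.Language.graph)}
    (e : A ≃[incLang FirstOrder.Language.graph] B) (x y : A) : par B (e x) (e y) ↔ par A x y := by
  have key (R : (incLang FirstOrder.Language.graph).Relations 2) (a b : A) :
      FirstOrder.Language.Structure.RelMap R ![e a, e b] ↔
        FirstOrder.Language.Structure.RelMap R ![a, b] := by
    rw [← e.map_rel R (![a, b])]
    refine iff_of_eq (congrArg _ (funext fun j => ?_))
    fin_cases j <;> rfl
  constructor
  · rintro ⟨z, h0, h1⟩
    obtain ⟨z, rfl⟩ := e.surjective z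
    exact ⟨z, (key _ _ _).1 h0, (key _ _ _).1 h1⟩
  · rintro ⟨z, h0, h1⟩
    exact ⟨e z, (key _ _ _).2 h0, (key _ _ _).2 h1⟩

theorem par_unique {m n : ℕ} {x y z : incidence (completeTree m n)}
    (hx : par (incidence (completeTree m n)) x z) (hy : par (incidence (completeTree m n)) y z) :
    x = y := by
  obtain ⟨c, h0, h1⟩ := hx
  obtain ⟨c', h0', h1'⟩ := hy
  obtain ⟨c, hx, hc⟩ := (relMap_inc (i := 0) (by simp) _ _).1 h0
  obtain ⟨c2, hz, hc2⟩ := (relMap_inc (i := 1) (by simp) _ _).1 h1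
  obtain ⟨c', hy, hc'⟩ := (relMap_inc (i := 0) (by simp) _ _).1 h0'
  obtain ⟨c2', hz', hc2'⟩ := (relMap_inc (i := 1) (by simp) _ _).1 h1'
  have e1 : c = c2 := Sum.inr.inj (hc.symm.trans hc2)
  have e2 : c' = c2' := Sum.inr.inj (hc'.symm.trans hc2')
  subst e1 e2
  have e3 : edgeEnd c 1 = edgeEnd c' 1 := Sum.inl.inj (hz.symm.trans hz')
  have e4 : c = c' := edgeEnd_one_injective e3
  subst e4
  exact (show x = _ from hx).trans (show y = _ from hy).symm

/-- Each output vertex is assigned the longest prefix of its location that ends in a frequent step.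
Uniqueness of parents makes this prefix grow along edges, and branching larger than every fibre
makes it grow strictly along a suitable branch, until it is too long for height `n`. -/
theorem not_belowIn_succ (n : ℕ) : ¬ BelowIn (completeTrees (n + 1)) (completeTrees n) := by
  rintro ⟨τ, hτ⟩
  obtain ⟨φ, hφ⟩ := exists_parent_formula τ.base
  obtain ⟨M, hM⟩ := exists_exchange n φ
  -- At most two infrequent children per type; in `K` the factor `2 * τ.copies` counts the elements
  -- at one location, a vertex and an edge in every copy. Neither bound depends on the input tree.
  let R := 2 * ∑ h ∈ Finset.range (n + 1), Nat.card (Ty M (Fin τ.params → Bool → Prop) h)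
  let K := seqBound R n * (2 * τ.copies)
  have h0 := hτ ⟨_, ⟨K + 1, rfl⟩, rfl⟩
  obtain ⟨_, ⟨_, ⟨m, rfl⟩, rfl⟩, Q, _, ⟨e⟩⟩ := Set.mem_iUnion₂.1 h0
  let x : completeTree (K + 1) (n + 1) → incidence (completeTree m n) × Fin τ.copies :=
    fun u => (e (Sum.inl u)).1
  have hxinj : Function.Injective x := fun u w h => Sum.inl.inj (e.injective (Subtype.ext h))
  -- Only the last step of `f` has to be frequent; `[]` qualifies vacuously.
  let P : List (Fin m) → Prop := fun f =>
    ∀ q d, f = q ++ [d] → Frequent M n (colourLabel Q) q d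
  choose F hF using exists_longest_prefix P fun q d h => by simp at h
  have hmono (u w : completeTree (K + 1) (n + 1)) (d : Fin (K + 1)) (h : w.1 = u.1 ++ [d]) :
      -- If this fails, `u` sits below a frequent vertex and `w` does not. The exchange then gives a
      -- second element related to `w` as its parent.
      F (loc (x u).1) <+: F (loc (x w).1) := by
    refine (hF _).2.2 _ ?_ (hF _).2.1
    by_contra hcon
    rcases List.eq_nil_or_concat' (F (loc (x u).1)) with h1 | ⟨q, d', h1⟩
    · rw [h1] at hcon
      exact hcon List.nil_prefix
    · have hpar : par (incidence (completeTree (K + 1) (n + 1))) (Sum.inl u) (Sum.inl w) :=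
        (par_completeTree _ _).2 ⟨w, rfl, d, h⟩
      rw [h1] at hcon
      obtain ⟨y, hy, hy'⟩ := hM m Q (x u) (x w) q d' ((hF _).2.1 q d' h1) (h1 ▸ (hF _).1) hcon
        ((hφ _ Q _ _).2 ⟨e (Sum.inl u), e (Sum.inl w), rfl, rfl, (par_equiv e _ _).2 hpar⟩)
      obtain ⟨y, w', rfl, hw', hyw⟩ := (hφ _ Q _ _).1 hy'
      have e1 : w' = e (Sum.inl w) := Subtype.ext hw'
      subst e1
      obtain ⟨y, rfl⟩ := e.surjective y
      have e2 := par_unique ((par_equiv e _ _).1 hyw) hpar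
      subst e2
      exact hy rfl
  have hfib (f : List (Fin m)) :
      {y : incidence (completeTree m n) × Fin τ.copies | F (loc y.1) = f}.ncard ≤ K := by
    let A : Set (List (Fin m)) := {l | l.length < n ∧ IsLongestPrefix P l f}
    have hA : A.ncard ≤ seqBound R n := by
      refine ncard_longest_prefix_le n (fun q => ?_) f
      have h1 := ncard_infrequent_le fun d =>
        ty M (n - q.length - 1) fun l => colourLabel Q (q ++ d :: l)
      have h2 : Nat.card (Ty M (Fin τ.params → Bool → Prop) (n - q.length - 1)) ≤
          ∑ h ∈ Finset.range (n + 1), Nat.card (Ty M (Fin τ.params → Bool → Prop) h) :=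
        Finset.single_le_sum (f := fun h => Nat.card (Ty M (Fin τ.params → Bool → Prop) h))
          (fun _ _ => Nat.zero_le _) (Finset.mem_range.2 (by omega))
      refine le_trans (Set.ncard_le_ncard (fun d hd => ?_) (Set.toFinite _))
        (h1.trans (Nat.mul_le_mul_left 2 h2))
      intro hfr
      refine hd fun q' d' h => ?_
      obtain ⟨rfl, h⟩ := List.append_inj' h rfl
      obtain rfl : d = d' := by simpa using h
      exact hfr
    have hAfin : A.Finite := (List.finite_length_lt (Fin m) n).subset fun l hl => hl.1
    have h3 : (A ×ˢ (Set.univ : Set (Bool × Fin τ.copies))).ncard ≤ K := by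
      rw [Set.ncard_prod, Set.ncard_univ]
      refine Nat.mul_le_mul hA ?_
      simp
    refine le_trans (Set.ncard_le_ncard_of_injOn (fun y => (loc y.1, isEdge y.1, y.2)) ?_ ?_
      (hAfin.prod Set.finite_univ)) h3
    · intro y hy
      have hy : F (loc y.1) = f := hy
      exact ⟨⟨loc_length _, hy ▸ hF _⟩, Set.mem_univ _⟩
    · intro y _ z _ h
      simp only [Prod.mk.injEq] at h
      exact Prod.ext (eq_of_loc_eq h.1 h.2.1) h.2.2
  have hchain (j : ℕ) (hj : j ≤ n) : ∃ u : completeTree (K + 1) (n + 1),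
      u.1.length = j ∧ j ≤ (F (loc (x u).1)).length := by
    induction j with
    | zero => exact ⟨⟨[], Nat.succ_pos n⟩, rfl, Nat.zero_le _⟩
    | succ j ih =>
      obtain ⟨u, hu, hju⟩ := ih (by omega)
      let w : Fin (K + 1) → completeTree (K + 1) (n + 1) := fun d =>
        ⟨u.1 ++ [d], by simp; omega⟩
      have hwinj : Function.Injective w := fun d d' h => by
        simpa [w] using congrArg Subtype.val h
      -- The `K + 1` children of `u` do not fit into one fibre of `F`, so some child has a
      -- different, hence longer, prefix.
      obtain ⟨d, hd⟩ : ∃ d, F (loc (x (w d)).1) ≠ F (loc (x u).1) := by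
        by_contra hcon
        push Not at hcon
        have h1 : (Set.univ : Set (Fin (K + 1))).ncard ≤ K :=
          le_trans (Set.ncard_le_ncard_of_injOn (fun d => x (w d)) (fun d _ => hcon d)
            (hxinj.comp hwinj).injOn (Set.toFinite _)) (hfib (F (loc (x u).1)))
        rw [Set.ncard_univ] at h1
        simp at h1
      refine ⟨w d, by simp [w, hu], ?_⟩
      have h1 := hmono u (w d) d rfl
      have h2 := h1.length_le
      have h3 : (F (loc (x u).1)).length ≠ (F (loc (x (w d)).1)).length :=
        fun h => hd (h1.eq_of_length h).symm
      omega
  obtain ⟨u, -, hu⟩ := hchain n le_rfl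
  have h1 := (hF (loc (x u).1)).1.length_le
  have h2 := loc_length (x u).1
  omega

end Strict

/-! ### The main theorem -/

section Main

theorem transGen_lift_inl {α β : Type*} {S : α → α → Prop} {x y : α ⊕ β} :
    Relation.TransGen (fun x y => ∃ a b, x = Sum.inl a ∧ y = Sum.inl b ∧ S a b) x y ↔
      ∃ a b, x = Sum.inl a ∧ y = Sum.inl b ∧ Relation.TransGen S a b := by
  constructor
  · intro h
    induction h with
    | single h =>
      obtain ⟨a, b, rfl, rfl, h⟩ := h
      exact ⟨a, b, rfl, rfl, .single h⟩
    | tail _ h ih =>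
      obtain ⟨a, b, rfl, rfl, h⟩ := h
      obtain ⟨a', b', rfl, hb, h'⟩ := ih
      rw [Sum.inl.injEq] at hb
      subst hb
      exact ⟨a', b, rfl, rfl, h'.tail h⟩
  · rintro ⟨a, b, rfl, rfl, h⟩
    exact h.lift Sum.inl fun a b h => ⟨a, b, rfl, rfl, h⟩

theorem Marking.inl {α β : Type*} {S : α → α → Prop} {m n : ℕ} {φ : List (Fin m) → α}
    (H : Marking S m n φ) : Marking
      (fun x y : α ⊕ β => ∃ a b, x = Sum.inl a ∧ y = Sum.inl b ∧ S a b) m n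
        (fun l => Sum.inl (φ l)) := by
  have key (a b : α) : Relation.TransGen
      (fun x y : α ⊕ β => ∃ a b, x = Sum.inl a ∧ y = Sum.inl b ∧ S a b) (Sum.inl a) (Sum.inl b) ↔
      Relation.TransGen S a b := by
    rw [transGen_lift_inl]
    constructor
    · rintro ⟨a', b', h1, h2, h⟩
      rw [Sum.inl.injEq] at h1 h2
      rwa [h1, h2]
    · exact fun h => ⟨a, b, rfl, rfl, h⟩
  exact ⟨fun l l' h1 h2 h3 h4 h => H.inj l l' h1 h2 h3 h4 (Sum.inl.inj h),
    fun l d h1 h2 => (key _ _).2 (H.transGen l d h1 h2),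
    fun l d z h1 h2 h3 h4 h5 h6 => H.length_lt l d z h1 h2 h3 h4 ((key _ _).1 h5) ((key _ _).1 h6)⟩

theorem treeMap_completeTree (m n n' : ℕ) (hn : n ≤ n') :
    TreeMap (completeTree m n) m n' 1 fun v => v.1 where
  length_lt v := v.2.trans_le hn
  fibre u := (Set.ncard_le_one (Set.toFinite _)).2 fun a ha b hb =>
    Subtype.ext (Eq.trans ha (Eq.symm hb))
  chain k R c hc := by
    cases R
    obtain ⟨d, hd⟩ := hc
    refine ⟨(c 1).1, (c 1).2.trans_le hn, fun i => ?_⟩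
    fin_cases i
    · exact ⟨[d], hd.symm⟩
    · exact List.prefix_rfl

/-- The marking transduction is the same for all `m`. If for every `m` it produced `m^{<n+1}` from
some member of `C`, it would witness `T_{n+1} ⊑ C`. So one `m` fails on all members at once, and the
dichotomy for this `m` gives a common bound. -/
theorem exists_treeMap_of_not_belowIn {n : ℕ} {L : FirstOrder.Language.{0, 0}} [L.IsRelational]
    [Finite (Σ k, L.Relations k)] {C : Set (FinStr L)} (hC : ¬ BelowIn (completeTrees (n + 1)) C) :
    ∃ K, ∀ A ∈ C, ∃ (m : ℕ) (h : A → List (Fin m)), TreeMap A m n K h := by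
  obtain ⟨τ, hτ⟩ := exists_transduction_of_marking L n
  have hC' : ∃ m, ∀ A ∈ C, incidence (completeTree m (n + 1)) ∉ τ.image (incidence A) := by
    by_contra hcon
    push Not at hcon
    refine hC ⟨τ, ?_⟩
    rintro _ ⟨_, ⟨m, rfl⟩, rfl⟩
    obtain ⟨A, hA, h⟩ := hcon m
    exact Set.mem_iUnion₂.2 ⟨_, ⟨A, hA, rfl⟩, h⟩
  obtain ⟨m, hm⟩ := hC'
  refine ⟨fibreBound m ((m + 1) ^ n), fun A hA => ?_⟩
  rcases isEmpty_or_nonempty A with hE | hE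
  · refine ⟨0, fun a => isEmptyElim a, ⟨fun a => isEmptyElim a, fun u => ?_, fun k R c hc => ?_⟩⟩
    · rw [Set.eq_empty_of_isEmpty {a : A | _}, Set.ncard_empty]
      exact Nat.zero_le _
    · rcases Nat.eq_zero_or_pos n with rfl | hn
      -- An empty structure may still contain a nullary tuple, which no tree of height `0` can
      -- accommodate. But that tuple is an element of `A_in` and marks the one-vertex tree `m^{<1}`,
      -- against the choice of `m`.
      · refine absurd (hτ A m (fun _ _ => False) (fun _ => Sum.inr ⟨⟨k, c⟩, R, hc⟩)
          (fun _ _ h => h.elim) (fun _ _ _ h => h.elim) ⟨?_, ?_, ?_⟩) (hm A hA)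
        · intro l l' hl _ hl'
          exact absurd (List.length_eq_zero_iff.1 (Nat.le_zero.1 hl')) hl
        · intro l d _ h
          omega
        · intro l d z _ h
          omega
      · exact ⟨[], hn, fun i => isEmptyElim (c i)⟩
  · rcases exists_marking_or_treeMap (A := A) m n with ⟨S, φ, h1, h2, h3⟩ | h
    · refine absurd (hτ A m _ _ ?_ ?_ h3.inl) (hm A hA)
      · rintro _ _ ⟨a, b, rfl, rfl, h⟩
        exact ⟨a, b, rfl, rfl, h1 a b h⟩
      · rintro _ _ _ ⟨a, c, rfl, rfl, h⟩ ⟨b, c', rfl, hc, h'⟩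
        rw [Sum.inl.injEq] at hc
        subst hc
        rw [h2 a b c h h']
    · exact h

theorem belowIn_of_treeMap {n K : ℕ} {L : FirstOrder.Language.{0, 0}} [L.IsRelational]
    [Finite (Σ k, L.Relations k)] {C : Set (FinStr L)}
    (H : ∀ A ∈ C, ∃ (m : ℕ) (h : A → List (Fin m)), TreeMap A m n K h) :
    BelowIn C (completeTrees n) := by
  obtain ⟨τ, hτ⟩ := exists_transduction_of_treeMap L n K
  refine ⟨τ, ?_⟩
  rintro _ ⟨A, hA, rfl⟩
  obtain ⟨m, h, hh⟩ := H A hA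
  exact Set.mem_iUnion₂.2 ⟨_, ⟨_, ⟨m, rfl⟩, rfl⟩, hτ A m h hh⟩

theorem classTwd_lt_top {n K : ℕ} {L : FirstOrder.Language.{0, 0}} {C : Set (FinStr L)}
    (H : ∀ A ∈ C, ∃ (m : ℕ) (h : A → List (Fin m)), TreeMap A m n K h) : classTwd n C < ⊤ := by
  refine lt_of_le_of_lt (iSup₂_le fun A hA => ?_) (EReal.coe_lt_top ((n * K : ℕ) : ℝ))
  obtain ⟨m, h, hh⟩ := H A hA
  exact hh.twd_le

end Main

end MSOTrans

theorem mainTheorem6 (n : ℕ) :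
    (∀ (L : FirstOrder.Language.{0, 0}) [L.IsRelational] [Finite (Σ k, L.Relations k)]
      (C : Set (MSOTrans.FinStr L)),
      ¬ MSOTrans.BelowIn (MSOTrans.completeTrees (n + 1)) C →
        MSOTrans.classTwd n C < ⊤ ∧ MSOTrans.BelowIn C (MSOTrans.completeTrees n)) ∧
    MSOTrans.CoversIn (MSOTrans.completeTrees n) (MSOTrans.completeTrees (n + 1)) := by
  refine ⟨fun L _ _ C hC => ?_, ⟨?_, MSOTrans.not_belowIn_succ n⟩, fun M _ _ D hD => ?_⟩
  · obtain ⟨K, hK⟩ := MSOTrans.exists_treeMap_of_not_belowIn hC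
    exact ⟨MSOTrans.classTwd_lt_top hK, MSOTrans.belowIn_of_treeMap hK⟩
  · refine MSOTrans.belowIn_of_treeMap (K := 1) ?_
    rintro _ ⟨m, rfl⟩
    exact ⟨m, _, MSOTrans.treeMap_completeTree m n (n + 1) (Nat.le_succ n)⟩
  · obtain ⟨K, hK⟩ := MSOTrans.exists_treeMap_of_not_belowIn hD.2.2
    exact hD.1.2 (MSOTrans.belowIn_of_treeMap hK)
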